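/- Let $E$ be an imaginary quadratic field with ring of integers $\mathcal O_E$, let $n\ge 0$ be an integer and let $V_n=E^n$ carry the standard Hermitian form $\langle v,w\rangle=v^\dagger w$. For a commutative $\mathbb Q$-algebra $A$ put $\mathbf U_n(A)=\{g\in \mathrm{GL}_n(A\otimes_{\mathbb Q}E) : g^\dagger g=I_n\}$, and let $\hat{\mathbb Q}$ be the ring of finite adeles of $\mathbb Q$. A Hermitian lattice is a full $\mathcal O_E$-lattice $L\subset V_n$. Its dual is $L^\#=\{v\in V_n:\langle v,L\rangle\subset\mathcal O_E\}$; $L$ is integral if $L\subseteq L^\#$; its discriminant $\partial(L)$ is the product of the invariant factors of $L^\#$ and $L$, that is, $\partial(L)=\prod_i I_i$ if $L^\#=\bigoplus_i A_i e_i$ and $L=\bigoplus_i A_i I_i e_i$ for an $E$-basis $(e_i)$ of $V_n$ and fractional ideals $A_i$ and $I_1\supseteq\dots\supseteq I_n$. The group $\mathbf U_n(\hat{\mathbb Q})$ acts on Hermitian lattices by $gL=g(L\otimes_{\mathbb Z}\hat{\mathbb Z})\cap V_n$; the orbit of $L$ is $\mathrm{genus}(L)$ and the stabiliser of $L$ is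 $K_L$. Let $L$ be an integral Hermitian lattice and let $\mathfrak p\subset\mathcal O_E$ be a nonzero prime ideal with $\mathfrak p\nmid\partial(L)$; if $n$ is even, assume moreover that $\mathfrak p$ is not a ramified prime above $2$ (i.e. $\mathfrak p^2\nmid 2\mathcal O_E$). Let $N(L,\mathfrak p)$ be the set of $\mathfrak p$-neighbours of $L$, i.e. of integral Hermitian lattices $L'\subset V_n$ with $L/(L\cap L')\cong\mathcal O_E/\mathfrak p$ and $L'/(L\cap L')\cong\mathcal O_E/\overline{\mathfrak p}$. 1. If $n\ge 3$, then $N(L,\mathfrak p)\subseteq\mathrm{genus}(L)$. 2. If $\gamma\in\mathbf U_n(\hat{\mathbb Q})$ satisfies $\gamma L\in N(L,\mathfrak p)$, then $N(L,\mathfrak p)=(K_L\gamma K_L)\{L\}=\{\kappa\gamma\kappa' L:\kappa,\kappa'\in K_L\}$. -/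

import Mathlib

open NumberField IsDedekindDomain
open scoped TensorProduct nonZeroDivisors

noncomputable section

namespace HermitianNeighbour

/-! ### Hermitian lattices in `V_n = E ^ n` -/

section Lattices

variable (E : Type*) [Field E] [NumberField E] [IsTotallyComplex E]
  [Algebra.IsQuadraticExtension ℚ E]

/-- An imaginary quadratic field is a CM field. -/
instance isCMField : IsCMField E := IsCMField.ofCMExtension ℚ E

/-- Complex conjugation of the imaginary quadratic field `E`, as a `ℚ`-algebra automorphism. -/
def conj : E ≃ₐ[ℚ] E := (IsCMField.complexConj E).restrictScalars ℚ

/-- Complex conjugation on the ring of integers of `E`. -/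
def conjInt : 𝓞 E ≃+* 𝓞 E := RingOfIntegers.mapRingEquiv (conj E).toRingEquiv

variable {E} {n : ℕ}

/-- The standard Hermitian form `⟨v, w⟩ = v† w` on `E ^ n`. -/
def herm (v w : Fin n → E) : E := ∑ i, conj E (v i) * w i

/-- The dual `L^# = {v | ⟨v, L⟩ ⊆ 𝓞_E}`. -/
def dual (L : Submodule (𝓞 E) (Fin n → E)) : Submodule (𝓞 E) (Fin n → E) where
  carrier := {v | ∀ w ∈ L, IsIntegral ℤ (herm v w)}
  zero_mem' := by
    intro w _
    have h : herm (0 : Fin n → E) w = 0 := by simp [herm]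
    rw [h]
    exact isIntegral_zero
  add_mem' := by
    intro v v' hv hv' w hw
    have h : herm (v + v') w = herm v w + herm v' w := by
      simp [herm, add_mul, Finset.sum_add_distrib]
    rw [h]
    exact (hv w hw).add (hv' w hw)
  smul_mem' := by
    intro a v hv w hw
    have h : herm (a • v) w = conj E (a : E) * herm v w := by
      simp [herm, Finset.mul_sum, mul_assoc, Algebra.smul_def]
    rw [h]
    exact ((RingOfIntegers.isIntegral_coe a).map ((conj E).restrictScalars ℤ)).mul (hv w hw)

/-- `L` is integral if `L ⊆ L^#`. -/
def Integral (L : Submodule (𝓞 E) (Fin n → E)) : Prop := L ≤ dual L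

/-- `I 0 ⊇ I 1 ⊇ ⋯` are the invariant factors of the lattices `M` and `L`: in some `E`-basis `b`
of `E ^ n` and for some nonzero fractional ideals `A i` one has
`M = ⨁ i, A i • b i` and `L = ⨁ i, (A i * I i) • b i`. -/
def IsInvariantFactors (M L : Submodule (𝓞 E) (Fin n → E))
    (I : Fin n → FractionalIdeal (𝓞 E)⁰ E) : Prop :=
  (∀ i, I i ≠ 0) ∧ Antitone I ∧
    ∃ (b : Module.Basis (Fin n) E (Fin n → E)) (A : Fin n → FractionalIdeal (𝓞 E)⁰ E),
      (∀ i, A i ≠ 0) ∧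
      (∀ v, v ∈ M ↔ ∀ i, b.repr v i ∈ A i) ∧
      (∀ v, v ∈ L ↔ ∀ i, b.repr v i ∈ A i * I i)

open Classical in
/-- The discriminant `∂(L)`: the product of the invariant factors of `L^#` and `L`. By the
invariant factor theorem these exist and are unique for every lattice `L` (the value `0` is never
taken for a lattice). -/
def discr (L : Submodule (𝓞 E) (Fin n → E)) : FractionalIdeal (𝓞 E)⁰ E :=
  if h : ∃ I : Fin n → FractionalIdeal (𝓞 E)⁰ E, IsInvariantFactors (dual L) L I
  then ∏ i, h.choose i else 0

/-- The set `N(L, 𝔭)` of `𝔭`-neighbours of `L`: the integral Hermitian lattices `L'` such that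
`L / (L ∩ L') ≅ 𝓞_E / 𝔭` and `L' / (L ∩ L') ≅ 𝓞_E / 𝔭̄` as `𝓞_E`-modules. -/
def neighbours (L : Submodule (𝓞 E) (Fin n → E)) (𝔭 : Ideal (𝓞 E)) :
    Set (Submodule (𝓞 E) (Fin n → E)) :=
  {L' | L'.IsLattice E ∧ Integral L' ∧
    Nonempty ((L ⧸ (L ⊓ L').submoduleOf L) ≃ₗ[𝓞 E] (𝓞 E ⧸ 𝔭)) ∧
    Nonempty ((L' ⧸ (L ⊓ L').submoduleOf L') ≃ₗ[𝓞 E] (𝓞 E ⧸ 𝔭.map (conjInt E)))}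

end Lattices

/-! ### The unitary group, and its finite adelic points acting on lattices -/

section Unitary

variable (E : Type*) [Field E] [NumberField E] [IsTotallyComplex E]
  [Algebra.IsQuadraticExtension ℚ E] (n : ℕ)

/-- Complex conjugation on `A ⊗ E`, acting on the second factor. -/
def conjTensor (A : Type*) [CommRing A] [Algebra ℚ A] : A ⊗[ℚ] E →ₐ[A] A ⊗[ℚ] E :=
  Algebra.TensorProduct.map (AlgHom.id A A) (conj E : E →ₐ[ℚ] E)

/-- The group `U_n(A) = {g ∈ GL_n(A ⊗ E) | g† g = 1}` of `A`-points of the unitary group. -/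
def unitary (A : Type*) [CommRing A] [Algebra ℚ A] : Subgroup (GL (Fin n) (A ⊗[ℚ] E)) where
  carrier := {g | (g.val.map (conjTensor E A)).transpose * g.val = 1}
  one_mem' := by
    simp
  mul_mem' := by
    intro g h hg hh
    simp only [Set.mem_ofPred_eq] at hg hh ⊢
    rw [Units.val_mul, Matrix.map_mul, Matrix.transpose_mul, Matrix.mul_assoc,
      ← Matrix.mul_assoc _ g.val, hg, Matrix.one_mul, hh]
  inv_mem' := by
    intro g hg
    simp only [Set.mem_ofPred_eq] at hg ⊢
    have h1 : (g.val.map (conjTensor E A)) * (g⁻¹).val.map (conjTensor E A) = 1 := by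
      rw [← Matrix.map_mul, Units.mul_inv]
      simp
    have h2 : (g⁻¹).val = (g.val.map (conjTensor E A)).transpose := by
      calc (g⁻¹).val = ((g.val.map (conjTensor E A)).transpose * g.val) * (g⁻¹).val := by
            rw [hg, Matrix.one_mul]
        _ = _ := by rw [Matrix.mul_assoc, Units.mul_inv, Matrix.mul_one]
    have h3 : ((g⁻¹).val.map (conjTensor E A)).transpose
        * (g.val.map (conjTensor E A)).transpose = 1 := by
      rw [← Matrix.transpose_mul, h1, Matrix.transpose_one]
    rw [h2] at h3 ⊢
    exact h3

/-- The ring `ℚ̂` of finite adeles of `ℚ`. -/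
abbrev QHat : Type := FiniteAdeleRing ℤ ℚ

/-- The subring `ℤ̂` of `ℚ̂`: the adeles that are integral at every prime. -/
def ZHat : Subring QHat where
  carrier := {x | ∀ v : HeightOneSpectrum ℤ, x v ∈ v.adicCompletionIntegers ℚ}
  zero_mem' := fun v => (v.adicCompletionIntegers ℚ).zero_mem
  one_mem' := fun v => (v.adicCompletionIntegers ℚ).one_mem
  add_mem' := fun hx hy v => (v.adicCompletionIntegers ℚ).add_mem _ _ (hx v) (hy v)
  mul_mem' := fun hx hy v => (v.adicCompletionIntegers ℚ).mul_mem _ _ (hx v) (hy v)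
  neg_mem' := fun hx v => (v.adicCompletionIntegers ℚ).neg_mem _ (hx v)

variable {E n}

/-- The embedding of `V_n = E ^ n` into `V_n ⊗ ℚ̂ = (ℚ̂ ⊗ E) ^ n`. -/
def emb (v : Fin n → E) : Fin n → QHat ⊗[ℚ] E := fun i => 1 ⊗ₜ[ℚ] v i

/-- `L ⊗ ℤ̂`, as a subgroup of `V_n ⊗ ℚ̂`: the `ℤ̂`-span of the image of `L`. -/
def completion (L : Submodule (𝓞 E) (Fin n → E)) : Submodule ZHat (Fin n → QHat ⊗[ℚ] E) :=
  Submodule.span ZHat (emb '' (L : Set (Fin n → E)))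

set_option linter.unusedSectionVars false in
theorem smul_mem_completion (L : Submodule (𝓞 E) (Fin n → E)) (a : 𝓞 E)
    {x : Fin n → QHat ⊗[ℚ] E} (hx : x ∈ completion L) :
    ((1 : QHat) ⊗ₜ[ℚ] (a : E)) • x ∈ completion L := by
  induction hx using Submodule.span_induction with
  | mem x hx =>
    obtain ⟨v, hv, rfl⟩ := hx
    refine Submodule.subset_span ⟨a • v, L.smul_mem a hv, ?_⟩
    funext i
    simp [emb, Algebra.smul_def]
  | zero => simp
  | add x y _ _ hx hy => rw [smul_add]; exact add_mem hx hy
  | smul c x _ hx =>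
    have h : ((1 : QHat) ⊗ₜ[ℚ] (a : E)) • (c • x) = c • (((1 : QHat) ⊗ₜ[ℚ] (a : E)) • x) := by
      funext i
      simp only [Pi.smul_apply, smul_eq_mul, mul_smul_comm]
    rw [h]
    exact Submodule.smul_mem _ c hx

/-- The action of `g ∈ U_n(ℚ̂)` on lattices in `V_n`: `gL = g(L ⊗ ℤ̂) ∩ V_n`. -/
def act (g : unitary E n QHat) (L : Submodule (𝓞 E) (Fin n → E)) :
    Submodule (𝓞 E) (Fin n → E) where
  carrier := {v | ∃ x ∈ completion L, g.val.val.mulVec x = emb v}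
  zero_mem' := by
    refine ⟨0, zero_mem _, ?_⟩
    funext i
    simp [emb]
  add_mem' := by
    rintro v w ⟨x, hx, hxv⟩ ⟨y, hy, hyw⟩
    refine ⟨x + y, add_mem hx hy, ?_⟩
    rw [Matrix.mulVec_add, hxv, hyw]
    funext i
    simp [emb, TensorProduct.tmul_add]
  smul_mem' := by
    rintro a v ⟨x, hx, hxv⟩
    refine ⟨_, smul_mem_completion L a hx, ?_⟩
    rw [Matrix.mulVec_smul, hxv]
    funext i
    simp [emb, Algebra.smul_def]

/-- The genus of `L`: its orbit under `U_n(ℚ̂)`. -/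
def genus (L : Submodule (𝓞 E) (Fin n → E)) : Set (Submodule (𝓞 E) (Fin n → E)) :=
  Set.range fun g : unitary E n QHat => act g L

/-- The stabiliser `K_L` of `L` in `U_n(ℚ̂)`, as a set of group elements. -/
def stab (L : Submodule (𝓞 E) (Fin n → E)) : Set (unitary E n QHat) :=
  {g | act g L = L}

end Unitary

end HermitianNeighbour

end

noncomputable section

set_option linter.unusedSectionVars false

namespace HermitianNeighbour

variable {E : Type*} [Field E] [NumberField E] [IsTotallyComplex E]
  [Algebra.IsQuadraticExtension ℚ E] {n : ℕ}

/-! ### Complex conjugation and the Hermitian form -/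

/-! The local work takes place over the semilocal ring R obtained from 𝓞_E by localising at 𝔭 and
𝔭̄. As 𝔭 does not divide ∂(L), the localisation M of L is unimodular over R. Let π generate 𝔭R. If
x' lies in a neighbour L' but not in L, then x = π̄x' lies in M, has norm in ππ̄R, and L' is locally
{y + rπ̄⁻¹x : y ∈ M, ⟨x,y⟩ ∈ 𝔭R, r ∈ R} (`exists_loc_eq_localNeighbour`). This set does not change
when x is replaced by x + π̄y with y ∈ M and ⟨x,y⟩ ∈ 𝔭R. In rank at least 2 this freedom makes x
good: primitive at both primes, with norm ππ̄ times a trace (`exists_isGood`).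

The isometries are quasi-reflections y ↦ y - d⁻¹⟨v,y⟩v with d + d̄ = ⟨v,v⟩. At most two of them,
each preserving M, carry one good vector to another modulo ππ̄M, hence one neighbour to another
(`exists_isometry_of_isGood`). A single one carries M onto a given neighbour
(`exists_isometry_localNeighbour`).

Finding d means solving trace equations. If 𝔭² does not divide 2, every self-conjugate element of R
is a trace of the required kind (`isTrace_of_not_sq_dvd`). Otherwise n is odd and M/𝔭M is a
nondegenerate symmetric bilinear space over 𝔽₂ of odd dimension. Its norm is a linear form,
represented by a characteristic vector, which is anisotropic because alternating forms have even
rank (`isOddDyadic_loc`). Adding this vector corrects norms of the wrong parity.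

Finally, an isometry of V_n is inserted at the rational prime below 𝔭 and completed by the identity
elsewhere, where L and its neighbours agree (`exists_unitary_act_eq`). Thus neighbours lie in the
genus and K_L permutes them transitively. In rank at most 1 there is at most one neighbour. -/

@[simp]
theorem conj_conj (x : E) : conj E (conj E x) = x :=
  IsCMField.complexConj_apply_apply E x

@[simp]
theorem coe_conjInt (a : 𝓞 E) : ((conjInt E a : 𝓞 E) : E) = conj E (a : E) := rfl

@[simp]
theorem conjInt_conjInt (a : 𝓞 E) : conjInt E (conjInt E a) = a := by
  apply RingOfIntegers.ext
  simp

/-- The degree of ℚ(x) divides 2. If it were 2, then x would generate E and conjugation would be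
trivial. -/
theorem exists_rat_of_conj_eq {x : E} (h : conj E x = x) : ∃ r : ℚ, (r : E) = x := by
  have hK : x ∈ maximalRealSubfield E := (IsCMField.complexConj_eq_self_iff E x).1 h
  have hne : ¬ Function.Surjective (algebraMap ℚ E) := by
    intro hs
    apply IsCMField.complexConj_ne_one E
    ext y
    obtain ⟨r, rfl⟩ := hs y
    simp
  let F : IntermediateField ℚ E := IntermediateField.adjoin ℚ {x}
  by_cases hx : F = ⊥
  · obtain ⟨r, hr⟩ := IntermediateField.mem_bot.1 (IntermediateField.adjoin_simple_eq_bot_iff.1 hx)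
    exact ⟨r, by rw [← hr]; simp⟩
  · exfalso
    apply IsCMField.complexConj_ne_one E
    have hdvd : Module.finrank ℚ F ∣ 2 := by
      rw [← Algebra.IsQuadraticExtension.finrank_eq_two ℚ E]
      exact ⟨_, (Module.finrank_mul_finrank ℚ F E).symm⟩
    have h2 : Module.finrank ℚ F = 2 := by
      rcases (Nat.dvd_prime Nat.prime_two).1 hdvd with h1 | h2
      · exact absurd (IntermediateField.finrank_eq_one_iff.1 h1) hx
      · exact h2
    have hF : F = ⊤ := by
      apply IntermediateField.eq_of_le_of_finrank_eq le_top
      rw [h2, IntermediateField.finrank_top', Algebra.IsQuadraticExtension.finrank_eq_two ℚ E]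
    have hconj : ((conj E : E ≃ₐ[ℚ] E) : E →ₐ[ℚ] E) = AlgHom.id ℚ E := by
      refine AlgHom.ext_of_adjoin_eq_top (s := {x}) ?_ ?_
      · have : (IntermediateField.adjoin ℚ {x}).toSubalgebra = ⊤ := by
          change F.toSubalgebra = ⊤
          rw [hF]; rfl
        rwa [IntermediateField.adjoin_simple_toSubalgebra_of_isAlgebraic
          (Algebra.IsAlgebraic.isAlgebraic x)] at this
      · intro y hy
        rw [Set.mem_singleton_iff.1 hy]
        exact h
    ext y
    exact congrArg (fun f => f y) hconj

theorem exists_int_of_conj_eq {a : 𝓞 E} (h : conjInt E a = a) : ∃ m : ℤ, (m : 𝓞 E) = a := by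
  obtain ⟨r, hr⟩ := exists_rat_of_conj_eq (x := (a : E)) (by rw [← coe_conjInt, h])
  have hi : IsIntegral ℤ r := by
    have h' : IsIntegral ℤ (algebraMap ℚ E r) := by
      rw [eq_ratCast, hr]
      exact RingOfIntegers.isIntegral_coe a
    exact (isIntegral_algebraMap_iff (algebraMap ℚ E).injective).1 h'
  obtain ⟨m, hm⟩ := IsIntegrallyClosed.isIntegral_iff.1 hi
  refine ⟨m, RingOfIntegers.ext ?_⟩
  rw [← hr, ← hm]
  simp

theorem exists_int_mul_conjInt (a : 𝓞 E) : ∃ m : ℤ, (m : 𝓞 E) = a * conjInt E a :=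
  exists_int_of_conj_eq (by simp [mul_comm])

theorem herm_add_left (u v w : Fin n → E) : herm (u + v) w = herm u w + herm v w := by
  simp [herm, add_mul, Finset.sum_add_distrib]

theorem herm_add_right (u v w : Fin n → E) : herm u (v + w) = herm u v + herm u w := by
  simp [herm, mul_add, Finset.sum_add_distrib]

theorem herm_smul_left (a : E) (v w : Fin n → E) : herm (a • v) w = conj E a * herm v w := by
  simp [herm, Finset.mul_sum, mul_assoc]

theorem herm_smul_right (a : E) (v w : Fin n → E) : herm v (a • w) = a * herm v w := by
  simp [herm, Finset.mul_sum, mul_left_comm]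

@[simp]
theorem herm_zero_right (w : Fin n → E) : herm w 0 = 0 := by simp [herm]

theorem herm_neg_left (v w : Fin n → E) : herm (-v) w = -herm v w := by simp [herm]

theorem herm_neg_right (v w : Fin n → E) : herm v (-w) = -herm v w := by simp [herm]

theorem herm_sub_left (u v w : Fin n → E) : herm (u - v) w = herm u w - herm v w := by
  rw [sub_eq_add_neg, herm_add_left, herm_neg_left, sub_eq_add_neg]

theorem herm_sub_right (u v w : Fin n → E) : herm u (v - w) = herm u v - herm u w := by
  rw [sub_eq_add_neg, herm_add_right, herm_neg_right, sub_eq_add_neg]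

theorem conj_herm (v w : Fin n → E) : conj E (herm v w) = herm w v := by
  simp [herm, mul_comm]

theorem int_smul_eq (a : 𝓞 E) (v : Fin n → E) : a • v = (a : E) • v :=
  (algebraMap_smul E a v).symm

theorem herm_single_left (i : Fin n) (v : Fin n → E) : herm (Pi.single i 1) v = v i := by
  classical
  rw [herm, Finset.sum_eq_single i]
  · simp
  · intro j _ hj
    simp [Pi.single_eq_of_ne hj]
  · simp

theorem eq_zero_of_herm_eq_zero {v : Fin n → E} (h : ∀ w, herm w v = 0) : v = 0 := by
  funext i
  rw [← herm_single_left i v, h]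
  rfl

/-- `g` is an isometry of `E ^ n`, i.e. an element of the group of `ℚ`-points of `U_n`. -/
def IsIsometry (g : (Fin n → E) ≃ₗ[E] (Fin n → E)) : Prop :=
  ∀ v w, herm (g v) (g w) = herm v w

theorem IsIsometry.symm {g : (Fin n → E) ≃ₗ[E] (Fin n → E)} (hg : IsIsometry g) :
    IsIsometry g.symm := by
  intro v w
  rw [← hg]
  simp

theorem IsIsometry.trans {g h : (Fin n → E) ≃ₗ[E] (Fin n → E)} (hg : IsIsometry g)
    (hh : IsIsometry h) : IsIsometry (g.trans h) := by
  intro v w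
  simp only [LinearEquiv.trans_apply]
  rw [hh, hg]

/-- Quasi-reflections: for `d + d̄ = ⟨v, v⟩` and `d ≠ 0` the map `y ↦ y - d⁻¹ ⟨v, y⟩ v` is an
isometry. -/
theorem exists_quasiReflection (v : Fin n → E) {d : E} (hd : d ≠ 0)
    (h : d + conj E d = herm v v) :
    ∃ g : (Fin n → E) ≃ₗ[E] (Fin n → E), IsIsometry g ∧
      ∀ y, g y = y - (herm v y * d⁻¹) • v := by
  have hd' : conj E d ≠ 0 := by simpa using hd
  let f (d : E) : (Fin n → E) →ₗ[E] (Fin n → E) :=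
    { toFun := fun y => y - (herm v y * d⁻¹) • v
      map_add' := fun x y => by rw [herm_add_right, add_mul, add_smul]; abel
      map_smul' := fun a y => by
        rw [herm_smul_right, RingHom.id_apply, smul_sub, smul_smul, mul_assoc] }
  have hf : ∀ d y, f d y = y - (herm v y * d⁻¹) • v := fun _ _ => rfl
  -- The trace relation says that the parameters d and d̄ give mutually inverse maps.
  have hinv : ∀ d d' : E, d ≠ 0 → d' ≠ 0 → d + d' = herm v v → ∀ y, f d (f d' y) = y := by
    intro d d' hd hd' h y
    have : herm v (f d' y) = herm v y * (-d * d'⁻¹) := by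
      rw [hf, herm_sub_right, herm_smul_right, ← h]
      field_simp
      ring
    rw [hf, this, hf, sub_sub, ← add_smul]
    have : herm v y * d'⁻¹ + herm v y * (-d * d'⁻¹) * d⁻¹ = 0 := by
      field_simp
      ring
    rw [this, zero_smul, sub_zero]
  refine ⟨LinearEquiv.ofLinearMap (f d) (f (conj E d)) ?_ ?_, ?_, hf d⟩
  · exact LinearMap.ext fun y => (hinv d _ hd hd' h y)
  · exact LinearMap.ext fun y => (hinv _ d hd' hd (by rw [add_comm, h]) y)
  · intro x y
    change herm (f d x) (f d y) = _
    rw [hf, hf, herm_sub_left, herm_sub_right, herm_sub_right, herm_smul_left, herm_smul_left,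
      herm_smul_right, herm_smul_right, ← h]
    simp only [map_mul, conj_herm, map_inv₀]
    field_simp
    ring

/-! ### Neighbours in order-theoretic terms -/

/-- A simple module is 𝓞_E modulo its annihilator, so its isomorphism class is detected by
simplicity and by being killed by I. Both conditions are easy to transport along the adelic action.
-/
theorem nonempty_quotEquiv_iff {I : Ideal (𝓞 E)} (hI : I.IsMaximal)
    {A B : Submodule (𝓞 E) (Fin n → E)} (hAB : A ≤ B) :
    Nonempty ((B ⧸ A.submoduleOf B) ≃ₗ[𝓞 E] (𝓞 E ⧸ I)) ↔
      A ⋖ B ∧ ∀ a ∈ I, ∀ v ∈ B, a • v ∈ A := by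
  constructor
  · rintro ⟨e⟩
    refine ⟨?_, ?_⟩
    · rw [covBy_iff_quot_is_simple hAB]
      have : IsSimpleModule (𝓞 E) (𝓞 E ⧸ I) :=
        isSimpleModule_iff_isCoatom.2 (Ideal.isMaximal_def.1 hI)
      exact IsSimpleModule.congr e
    · intro a ha v hv
      have h0 : a • (Submodule.Quotient.mk ⟨v, hv⟩ : B ⧸ A.submoduleOf B) = 0 := by
        apply e.injective
        rw [map_smul, map_zero]
        obtain ⟨y, hy⟩ := Ideal.Quotient.mk_surjective (e (Submodule.Quotient.mk ⟨v, hv⟩))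
        rw [← hy, Algebra.smul_def]
        change Ideal.Quotient.mk I a * _ = 0
        rw [Ideal.Quotient.eq_zero_iff_mem.2 ha, zero_mul]
      rw [← Submodule.Quotient.mk_smul, Submodule.Quotient.mk_eq_zero] at h0
      exact h0
  · rintro ⟨hcov, hI'⟩
    have hs : IsSimpleModule (𝓞 E) (B ⧸ A.submoduleOf B) :=
      (covBy_iff_quot_is_simple hAB).1 hcov
    obtain ⟨m, hm, ⟨e⟩⟩ := isSimpleModule_iff_quot_maximal.1 hs
    have : m = I := by
      refine (hI.eq_of_le hm.ne_top ?_).symm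
      intro a ha
      rw [← Ideal.Quotient.eq_zero_iff_mem]
      have h0 : a • e.symm (Ideal.Quotient.mk m 1) = 0 := by
        obtain ⟨⟨v, hv⟩, hy⟩ := Submodule.Quotient.mk_surjective _ (e.symm (Ideal.Quotient.mk m 1))
        rw [← hy, ← Submodule.Quotient.mk_smul, Submodule.Quotient.mk_eq_zero]
        exact hI' a ha v hv
      have h1 := congrArg e h0
      rw [map_smul, e.apply_symm_apply, map_zero, Algebra.smul_def, map_one, mul_one] at h1
      exact h1
    subst this
    exact ⟨e⟩

theorem mem_map_conjInt {I : Ideal (𝓞 E)} {a : 𝓞 E} :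
    a ∈ I.map (conjInt E) ↔ conjInt E a ∈ I := by
  rw [Ideal.mem_map_iff_of_surjective _ (conjInt E).surjective]
  constructor
  · rintro ⟨b, hb, rfl⟩
    simpa using hb
  · intro h
    exact ⟨_, h, by simp⟩

theorem isMaximal_map_conjInt {I : Ideal (𝓞 E)} (hI : I.IsMaximal) :
    (I.map (conjInt E)).IsMaximal :=
  Ideal.map_isMaximal_of_equiv (conjInt E)

theorem mem_neighbours_iff {L L' : Submodule (𝓞 E) (Fin n → E)} {𝔭 : Ideal (𝓞 E)}
    (hp : 𝔭.IsMaximal) :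
    L' ∈ neighbours L 𝔭 ↔ L'.IsLattice E ∧ Integral L' ∧
      (L ⊓ L' ⋖ L ∧ ∀ a ∈ 𝔭, ∀ v ∈ L, a • v ∈ L') ∧
      (L ⊓ L' ⋖ L' ∧ ∀ a ∈ 𝔭.map (conjInt E), ∀ v ∈ L', a • v ∈ L) := by
  have h1 := nonempty_quotEquiv_iff hp (inf_le_left : L ⊓ L' ≤ L)
  have h2 := nonempty_quotEquiv_iff (isMaximal_map_conjInt hp) (inf_le_right : L ⊓ L' ≤ L')
  have h3 : (∀ a ∈ 𝔭, ∀ v ∈ L, a • v ∈ L ⊓ L') ↔ (∀ a ∈ 𝔭, ∀ v ∈ L, a • v ∈ L') :=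
    ⟨fun h a ha v hv => (h a ha v hv).2, fun h a ha v hv => ⟨L.smul_mem a hv, h a ha v hv⟩⟩
  have h4 : (∀ a ∈ 𝔭.map (conjInt E), ∀ v ∈ L', a • v ∈ L ⊓ L') ↔
      (∀ a ∈ 𝔭.map (conjInt E), ∀ v ∈ L', a • v ∈ L) :=
    ⟨fun h a ha v hv => (h a ha v hv).1, fun h a ha v hv => ⟨h a ha v hv, L'.smul_mem a hv⟩⟩
  rw [h3] at h1
  rw [h4] at h2
  rw [← h1, ← h2]
  rfl

/-! ### Consequences of the hypothesis on the discriminant -/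

theorem exists_herm_eq (f : (Fin n → E) →ₗ[E] E) : ∃ u : Fin n → E, ∀ v, herm u v = f v := by
  refine ⟨fun i => conj E (f fun j => if i = j then 1 else 0), fun v => ?_⟩
  rw [LinearMap.pi_apply_eq_sum_univ f v]
  simp [herm, mul_comm]

theorem mem_fractionalIdeal_of_forall_mul {B : FractionalIdeal (𝓞 E)⁰ E} (hB : B ≠ 0) {x : E}
    (h : ∀ y ∈ B⁻¹, IsIntegral ℤ (y * x)) : x ∈ B := by
  have h1 : x ∈ (B⁻¹)⁻¹ := by
    rw [FractionalIdeal.mem_inv_iff (inv_ne_zero hB)]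
    intro y hy
    rw [FractionalIdeal.mem_one_iff, mul_comm]
    exact ⟨⟨_, h y hy⟩, rfl⟩
  rwa [inv_inv] at h1

/-- If c represents the i-th coordinate and y ∈ Bᵢ⁻¹, then ȳc lies in the dual. Pairing u with it
shows that y times the i-th coordinate of u is integral for all such y. -/
theorem dual_dual_le {L : Submodule (𝓞 E) (Fin n → E)} (b : Module.Basis (Fin n) E (Fin n → E))
    (B : Fin n → FractionalIdeal (𝓞 E)⁰ E) (hB : ∀ i, B i ≠ 0)
    (hL : ∀ v, v ∈ L ↔ ∀ i, b.repr v i ∈ B i) : dual (dual L) ≤ L := by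
  intro u hu
  rw [hL]
  intro i
  apply mem_fractionalIdeal_of_forall_mul (hB i)
  intro y hy
  obtain ⟨c, hc⟩ := exists_herm_eq (b.coord i)
  have hmem : conj E y • c ∈ dual L := by
    intro w hw
    rw [herm_smul_left, hc, conj_conj, Module.Basis.coord_apply]
    have h1 := (FractionalIdeal.mem_inv_iff (hB i)).1 hy _ ((hL w).1 hw i)
    obtain ⟨z, hz⟩ := (FractionalIdeal.mem_one_iff _).1 h1
    rw [← hz]
    exact RingOfIntegers.isIntegral_coe z
  have h2 := hu _ hmem
  rw [herm_smul_right] at h2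
  have h3 := h2.map ((conj E).restrictScalars ℤ)
  have h4 : (conj E).restrictScalars ℤ (conj E y * herm u c) = y * b.repr u i := by
    change conj E (conj E y * herm u c) = _
    rw [map_mul, conj_conj, conj_herm, hc, Module.Basis.coord_apply]
  rwa [h4] at h3

/-- The default value 0 of `discr` is contained in 𝔭, so the hypothesis rules it out. -/
theorem exists_decomposition {L : Submodule (𝓞 E) (Fin n → E)} {𝔭 : Ideal (𝓞 E)}
    (hdisc : ¬ discr L ≤ (𝔭 : FractionalIdeal (𝓞 E)⁰ E)) :
    ∃ I : Fin n → FractionalIdeal (𝓞 E)⁰ E, IsInvariantFactors (dual L) L I ∧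
      ¬ ∏ i, I i ≤ (𝔭 : FractionalIdeal (𝓞 E)⁰ E) := by
  unfold discr at hdisc
  split_ifs at hdisc with h
  · exact ⟨_, h.choose_spec, hdisc⟩
  · exact absurd (FractionalIdeal.zero_le _) hdisc

/-- Integrality of L makes every Iᵢ an integral ideal, so ∂(L) is contained in each of them and
multiplies L^# into L. Any element of ∂(L) outside 𝔭 will do. -/
theorem exists_notMem_smul_dual_le {L : Submodule (𝓞 E) (Fin n → E)} (hint : Integral L)
    {𝔭 : Ideal (𝓞 E)} (hdisc : ¬ discr L ≤ (𝔭 : FractionalIdeal (𝓞 E)⁰ E)) :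
    ∃ a ∉ 𝔭, ∀ v ∈ dual L, a • v ∈ L := by
  classical
  obtain ⟨I, ⟨-, -, b, A, hA, hM, hL⟩, hI⟩ := exists_decomposition hdisc
  have hI1 : ∀ i, I i ≤ 1 := by
    intro i
    have h1 : A i * I i ≤ A i := by
      intro x hx
      have hx' : x • b i ∈ L := by
        rw [hL]
        intro j
        rw [map_smul, Module.Basis.repr_self, Finsupp.smul_apply, Finsupp.single_apply]
        split_ifs with hj
        · subst hj; simpa using hx
        · have h0 : (0 : E) ∈ A j * I j :=
            ((A j * I j : FractionalIdeal (𝓞 E)⁰ E) : Submodule (𝓞 E) E).zero_mem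
          simpa using h0
      have := (hM _).1 (hint hx') i
      simpa using this
    calc I i = (A i)⁻¹ * (A i * I i) := by
          rw [← mul_assoc, inv_mul_cancel₀ (hA i), one_mul]
      _ ≤ (A i)⁻¹ * A i := by gcongr
      _ = 1 := inv_mul_cancel₀ (hA i)
  have hle : ∀ i, ∏ j, I j ≤ I i := by
    intro i
    rw [← Finset.mul_prod_erase _ _ (Finset.mem_univ i)]
    calc I i * ∏ j ∈ Finset.univ.erase i, I j ≤ I i * 1 := by
          gcongr
          exact Finset.prod_le_one' fun j _ => hI1 j
      _ = I i := mul_one _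
  have hle1 : ∏ j, I j ≤ 1 := Finset.prod_le_one' fun j _ => hI1 j
  obtain ⟨x, hx, hxp⟩ := SetLike.not_le_iff_exists.1 hI
  obtain ⟨a, rfl⟩ := (FractionalIdeal.mem_one_iff _).1 (hle1 hx)
  refine ⟨a, fun ha => hxp ((FractionalIdeal.mem_coeIdeal _).2 ⟨a, ha, rfl⟩), fun v hv => ?_⟩
  rw [hL]
  intro i
  rw [int_smul_eq, map_smul, Finsupp.smul_apply, smul_eq_mul, mul_comm]
  exact FractionalIdeal.mul_mem_mul (hle i hx) ((hM v).1 hv i)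

/-- `s` is a unit at `𝔭` and at `𝔭̄`. -/
def Away (𝔭 : Ideal (𝓞 E)) (s : 𝓞 E) : Prop := s ∉ 𝔭 ∧ conjInt E s ∉ 𝔭

/-- The multipliers of L^# into L form an ideal, stable under conjugation by biduality. If a ∉ 𝔭 but
ā ∈ 𝔭, the self-conjugate element a + ā avoids 𝔭 and hence 𝔭̄. -/
theorem exists_away_smul_dual_le {L : Submodule (𝓞 E) (Fin n → E)} (hint : Integral L)
    {𝔭 : Ideal (𝓞 E)} (hdisc : ¬ discr L ≤ (𝔭 : FractionalIdeal (𝓞 E)⁰ E)) :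
    ∃ a, Away 𝔭 a ∧ ∀ v ∈ dual L, a • v ∈ L := by
  obtain ⟨a, ha, haL⟩ := exists_notMem_smul_dual_le hint hdisc
  obtain ⟨I, ⟨hI0, -, b, A, hA, hM, hL⟩, -⟩ := exists_decomposition hdisc
  have hdd := dual_dual_le b (fun i => A i * I i) (fun i => mul_ne_zero (hA i) (hI0 i)) hL
  have hconj : ∀ v ∈ dual L, conjInt E a • v ∈ L := by
    intro v hv
    refine hdd fun w hw => ?_
    rw [int_smul_eq, herm_smul_left, coe_conjInt, conj_conj, ← herm_smul_right, ← int_smul_eq]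
    exact hv _ (haL w hw)
  by_cases hc : conjInt E a ∈ 𝔭
  · have h1 : a + conjInt E a ∉ 𝔭 := fun h => ha ((𝔭.add_mem_iff_left hc).1 h)
    refine ⟨a + conjInt E a, ⟨h1, ?_⟩, fun v hv => ?_⟩
    · simpa [add_comm] using h1
    · rw [add_smul]
      exact add_mem (haL v hv) (hconj v hv)
  · exact ⟨a, ⟨ha, hc⟩, haL⟩

/-! ### Localisation at `𝔭` and `𝔭̄` -/

section Localisation

variable {𝔭 : Ideal (𝓞 E)}

theorem Away.conj {s : 𝓞 E} (hs : Away 𝔭 s) : Away 𝔭 (conjInt E s) :=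
  ⟨hs.2, by simpa using hs.1⟩

theorem Away.mul (hp : 𝔭.IsPrime) {s t : 𝓞 E} (hs : Away 𝔭 s) (ht : Away 𝔭 t) :
    Away 𝔭 (s * t) :=
  ⟨fun h => (hp.mem_or_mem h).elim hs.1 ht.1, fun h => by
    rw [map_mul] at h
    exact (hp.mem_or_mem h).elim hs.2 ht.2⟩

theorem away_one (hp : 𝔭.IsPrime) : Away 𝔭 (1 : 𝓞 E) :=
  ⟨fun h => hp.ne_top ((Ideal.eq_top_iff_one _).2 h), fun h => by
    rw [map_one] at h
    exact hp.ne_top ((Ideal.eq_top_iff_one _).2 h)⟩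

theorem Away.ne_zero {s : 𝓞 E} (hs : Away 𝔭 s) : (s : E) ≠ 0 := by
  intro h
  apply hs.1
  rw [RingOfIntegers.coe_eq_zero_iff.1 h]
  exact 𝔭.zero_mem

/-- The localisation of an ideal `I` at `𝔭` and `𝔭̄`. -/
def locIdeal (hp : 𝔭.IsPrime) (I : Ideal (𝓞 E)) : AddSubgroup E where
  carrier := {a | ∃ s, Away 𝔭 s ∧ ∃ b ∈ I, (s : E) * a = b}
  zero_mem' := ⟨1, away_one hp, 0, zero_mem _, by simp⟩
  add_mem' := by
    rintro x y ⟨s, hs, b, hb, h⟩ ⟨t, ht, c, hc, h'⟩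
    refine ⟨s * t, hs.mul hp ht, t * b + s * c,
      add_mem (I.mul_mem_left _ hb) (I.mul_mem_left _ hc), ?_⟩
    simp only [map_mul, map_add, ← h, ← h']
    ring
  neg_mem' := by
    rintro x ⟨s, hs, b, hb, h⟩
    exact ⟨s, hs, -b, neg_mem hb, by simp [h]⟩

variable {hp : 𝔭.IsPrime} {I J : Ideal (𝓞 E)} {a b : E}

theorem coe_mem_locIdeal {a : 𝓞 E} (ha : a ∈ I) : (a : E) ∈ locIdeal hp I :=
  ⟨1, away_one hp, a, ha, by simp⟩

theorem mul_mem_locIdeal_mul (ha : a ∈ locIdeal hp I) (hb : b ∈ locIdeal hp J) :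
    a * b ∈ locIdeal hp (I * J) := by
  obtain ⟨s, hs, x, hx, h⟩ := ha
  obtain ⟨t, ht, y, hy, h'⟩ := hb
  refine ⟨s * t, hs.mul hp ht, x * y, Ideal.mul_mem_mul hx hy, ?_⟩
  simp only [map_mul, ← h, ← h']
  ring

variable (hp) in
/-- The localisation of `𝓞 E` at `𝔭` and `𝔭̄`. -/
def locRing : Subring E where
  __ := locIdeal hp ⊤
  one_mem' := ⟨1, away_one hp, 1, trivial, by simp⟩
  mul_mem' := fun ha hb => by
    have := mul_mem_locIdeal_mul (hp := hp) (I := ⊤) (J := ⊤) ha hb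
    rwa [Ideal.top_mul] at this

theorem locIdeal_le (ha : a ∈ locIdeal hp I) : a ∈ locRing hp := by
  obtain ⟨s, hs, x, -, h⟩ := ha
  exact ⟨s, hs, x, trivial, h⟩

theorem coe_mem_locRing (a : 𝓞 E) : (a : E) ∈ locRing hp :=
  coe_mem_locIdeal (hp := hp) (I := ⊤) trivial

theorem mul_mem_locIdeal (ha : a ∈ locRing hp) (hb : b ∈ locIdeal hp I) :
    a * b ∈ locIdeal hp I := by
  simpa using mul_mem_locIdeal_mul (I := ⊤) ha hb

theorem mul_mem_locIdeal_right (ha : a ∈ locIdeal hp I) (hb : b ∈ locRing hp) :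
    a * b ∈ locIdeal hp I := by
  rw [mul_comm]
  exact mul_mem_locIdeal hb ha

theorem conj_mem_locRing (ha : a ∈ locRing hp) : conj E a ∈ locRing hp := by
  obtain ⟨s, hs, x, -, h⟩ := ha
  exact ⟨conjInt E s, hs.conj, conjInt E x, trivial, by simp [← h]⟩

theorem conj_mem_locRing_iff : conj E a ∈ locRing hp ↔ a ∈ locRing hp :=
  ⟨fun h => by simpa using conj_mem_locRing h, conj_mem_locRing⟩

theorem coe_mem_locIdeal_iff {a : 𝓞 E} : (a : E) ∈ locIdeal hp 𝔭 ↔ a ∈ 𝔭 := by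
  refine ⟨fun ⟨s, hs, x, hx, h⟩ => ?_, coe_mem_locIdeal⟩
  have : s * a = x := RingOfIntegers.ext (by simpa using h)
  exact (hp.mem_or_mem (this ▸ hx)).resolve_left hs.1

theorem mem_or_mem_of_mul_mem (ha : a ∈ locRing hp) (hb : b ∈ locRing hp)
    (h : a * b ∈ locIdeal hp 𝔭) : a ∈ locIdeal hp 𝔭 ∨ b ∈ locIdeal hp 𝔭 := by
  obtain ⟨s, hs, x, -, hx⟩ := ha
  obtain ⟨t, ht, y, -, hy⟩ := hb
  have h1 : ((x * y : 𝓞 E) : E) ∈ locIdeal hp 𝔭 := by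
    have : ((x * y : 𝓞 E) : E) = ((s * t : 𝓞 E) : E) * (a * b) := by
      simp only [map_mul, ← hx, ← hy]; ring
    rw [this]
    exact mul_mem_locIdeal (coe_mem_locRing _) h
  rcases hp.mem_or_mem (coe_mem_locIdeal_iff.1 h1) with h2 | h2
  · exact Or.inl ⟨s, hs, x, h2, hx⟩
  · exact Or.inr ⟨t, ht, y, h2, hy⟩

theorem one_notMem_locIdeal : (1 : E) ∉ locIdeal hp 𝔭 := by
  intro h
  have : ((1 : 𝓞 E) : E) ∈ locIdeal hp 𝔭 := by simpa using h
  exact (away_one hp).1 (coe_mem_locIdeal_iff.1 this)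

theorem inv_mem_locRing (ha : a ∈ locRing hp) (h1 : a ∉ locIdeal hp 𝔭)
    (h2 : conj E a ∉ locIdeal hp 𝔭) : a⁻¹ ∈ locRing hp := by
  obtain ⟨s, hs, x, -, hx⟩ := ha
  have ha0 : a ≠ 0 := by rintro rfl; exact h1 (zero_mem _)
  refine ⟨x, ⟨fun h => h1 ⟨s, hs, x, h, hx⟩, fun h => h2 ⟨conjInt E s, hs.conj, _, h, ?_⟩⟩, s,
    trivial, ?_⟩
  · simp [← hx]
  · rw [← hx, mul_assoc, mul_inv_cancel₀ ha0, mul_one]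

/-- An element of `𝔭 ∖ 𝔭²` (outside `𝔭̄` if `𝔭 ≠ 𝔭̄`) generates the localisation of `𝔭`. -/
theorem div_mem_locRing {π : 𝓞 E} (h1 : π ∈ 𝔭) (h2 : π ∉ 𝔭 ^ 2)
    (h3 : conjInt E π ∉ 𝔭 ∨ ∀ a ∈ 𝔭, conjInt E a ∈ 𝔭) (ha : a ∈ locIdeal hp 𝔭) :
    a / π ∈ locRing hp := by
  obtain ⟨K, hK⟩ := Ideal.dvd_span_singleton.2 h1
  have hK1 : ¬ K ≤ 𝔭 := by
    intro h
    apply h2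
    rw [pow_two, ← Ideal.span_singleton_le_iff_mem, hK]
    exact Ideal.mul_mono_right h
  have hπ0 : (π : E) ≠ 0 := fun h => h2 (by
    rw [RingOfIntegers.coe_eq_zero_iff.1 h]; exact zero_mem _)
  -- Here (π) = 𝔭K, so such an s gives s𝔭 ⊆ (π). If s avoids 𝔭 but not 𝔭̄, adding π, which lies in K
  -- and 𝔭 but not in 𝔭̄, repairs it.
  obtain ⟨s, hs, hsK⟩ : ∃ s, Away 𝔭 s ∧ s ∈ K := by
    obtain ⟨s, hsK, hs⟩ := SetLike.not_le_iff_exists.1 hK1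
    rcases h3 with h3 | h3
    · have hpi : π ∈ K := by
        have h : Ideal.span {π} ≤ K := hK.le.trans Ideal.mul_le_right
        exact h (Ideal.mem_span_singleton_self π)
      by_cases hc : conjInt E s ∈ 𝔭
      · refine ⟨s + π, ⟨fun h => hs ((𝔭.add_mem_iff_left h1).1 h), fun h => ?_⟩,
          add_mem hsK hpi⟩
        rw [map_add] at h
        exact h3 ((𝔭.add_mem_iff_right hc).1 h)
      · exact ⟨s, ⟨hs, hc⟩, hsK⟩
    · exact ⟨s, ⟨hs, fun h => hs (by simpa using h3 _ h)⟩, hsK⟩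
  obtain ⟨t, ht, x, hx, hxa⟩ := ha
  have h4 : s * x ∈ Ideal.span {π} := by
    rw [hK, mul_comm s]
    exact Ideal.mul_mem_mul hx hsK
  obtain ⟨y, hy⟩ := Ideal.mem_span_singleton'.1 h4
  refine ⟨s * t, hs.mul hp ht, y, trivial, ?_⟩
  have : (y : E) * π = s * x := by exact_mod_cast congrArg (algebraMap (𝓞 E) E) hy
  simp only [map_mul]
  rw [mul_div_assoc', mul_assoc, hxa, ← this, mul_div_cancel_right₀ _ hπ0]

/-- When 𝔭 ≠ 𝔭̄ this is prime avoidance: 𝔭 is not covered by 𝔭² and 𝔭̄. -/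
theorem exists_uniformizer (hp : 𝔭.IsPrime) (hp0 : 𝔭 ≠ ⊥) :
    ∃ π ∈ 𝔭, π ∉ 𝔭 ^ 2 ∧ (conjInt E π ∉ 𝔭 ∨ ∀ a ∈ 𝔭, conjInt E a ∈ 𝔭) := by
  have hlt : ¬ 𝔭 ≤ 𝔭 ^ 2 := by
    intro h
    have h1 : 𝔭 ^ 2 < 𝔭 ^ 1 := Ideal.pow_right_strictAnti 𝔭 hp0 hp.ne_top (by norm_num)
    rw [pow_one] at h1
    exact h1.not_ge h
  by_cases hc : ∀ a ∈ 𝔭, conjInt E a ∈ 𝔭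
  · obtain ⟨π, h1, h2⟩ := SetLike.not_le_iff_exists.1 hlt
    exact ⟨π, h1, h2, Or.inr hc⟩
  · have h3 : ¬ 𝔭 ≤ 𝔭.map (conjInt E) := fun h => hc fun a ha => mem_map_conjInt.1 (h ha)
    have h4 : ¬ ((𝔭 : Set (𝓞 E)) ⊆ (𝔭 ^ 2 : Ideal (𝓞 E)) ∪ (𝔭.map (conjInt E) : Ideal (𝓞 E))) := by
      rw [Ideal.subset_union]
      exact not_or.2 ⟨hlt, h3⟩
    obtain ⟨π, h5, h6⟩ := Set.not_subset.1 h4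
    simp only [Set.mem_union, SetLike.mem_coe, not_or] at h6
    exact ⟨π, h5, h6.1, Or.inl fun h => h6.2 (mem_map_conjInt.2 h)⟩

/-- The localisation of a lattice at `𝔭` and `𝔭̄`. -/
def loc (hp : 𝔭.IsPrime) (L : Submodule (𝓞 E) (Fin n → E)) : Submodule (𝓞 E) (Fin n → E) where
  carrier := {v | ∃ s, Away 𝔭 s ∧ s • v ∈ L}
  zero_mem' := ⟨1, away_one hp, by simp⟩
  add_mem' := by
    rintro v w ⟨s, hs, h⟩ ⟨t, ht, h'⟩
    refine ⟨s * t, hs.mul hp ht, ?_⟩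
    rw [smul_add]
    refine add_mem ?_ ?_
    · rw [mul_comm, mul_smul]; exact L.smul_mem _ h
    · rw [mul_smul]; exact L.smul_mem _ h'
  smul_mem' := by
    rintro a v ⟨s, hs, h⟩
    exact ⟨s, hs, by rw [smul_comm]; exact L.smul_mem _ h⟩

variable {L : Submodule (𝓞 E) (Fin n → E)} {v w : Fin n → E}

theorem mem_loc : v ∈ loc hp L ↔ ∃ s, Away 𝔭 s ∧ s • v ∈ L := Iff.rfl

theorem le_loc : L ≤ loc hp L := fun v hv => ⟨1, away_one hp, by simpa using hv⟩

theorem smul_mem_loc (ha : a ∈ locRing hp) (hv : v ∈ loc hp L) : a • v ∈ loc hp L := by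
  obtain ⟨s, hs, x, -, hx⟩ := ha
  obtain ⟨t, ht, h⟩ := hv
  refine ⟨s * t, hs.mul hp ht, ?_⟩
  have : (s * t) • a • v = x • t • v := by
    simp only [int_smul_eq, smul_smul, ← hx, map_mul]
    congr 1
    ring
  rw [this]
  exact L.smul_mem _ h

theorem herm_mem_of_mem_loc (hint : Integral L) (hv : v ∈ loc hp L) (hw : w ∈ loc hp L) :
    herm v w ∈ locRing hp := by
  obtain ⟨s, hs, h⟩ := hv
  obtain ⟨t, ht, h'⟩ := hw
  refine ⟨conjInt E s * t, hs.conj.mul hp ht, ⟨_, hint h _ h'⟩, trivial, ?_⟩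
  simp only [int_smul_eq, herm_smul_left, herm_smul_right, RingOfIntegers.map_mk, map_mul,
    coe_conjInt]
  ring

/-- A unimodular lattice over the localisation of `𝓞 E` at `𝔭` and `𝔭̄`. -/
structure IsUnimodular (hp : 𝔭.IsPrime) (M : Submodule (𝓞 E) (Fin n → E)) : Prop where
  smul_mem : ∀ {a : E} {v : Fin n → E}, a ∈ locRing hp → v ∈ M → a • v ∈ M
  herm_mem : ∀ {v w : Fin n → E}, v ∈ M → w ∈ M → herm v w ∈ locRing hp
  mem_of_herm : ∀ {v : Fin n → E}, (∀ w ∈ M, herm v w ∈ locRing hp) → v ∈ M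
  exists_smul_mem : ∀ v : Fin n → E, ∃ a : 𝓞 E, a ≠ 0 ∧ a • v ∈ M

theorem exists_smul_mem (hL : L.IsLattice E) (v : Fin n → E) :
    ∃ a : 𝓞 E, a ≠ 0 ∧ a • v ∈ L := by
  have hv : v ∈ Submodule.span E (L : Set (Fin n → E)) := by
    rw [hL.span_eq_top]
    trivial
  induction hv using Submodule.span_induction with
  | mem x hx => exact ⟨1, one_ne_zero, by simpa using hx⟩
  | zero => exact ⟨1, one_ne_zero, by simp⟩
  | add x y _ _ hx hy =>
    obtain ⟨a, ha, hax⟩ := hx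
    obtain ⟨b, hb, hby⟩ := hy
    refine ⟨a * b, mul_ne_zero ha hb, ?_⟩
    rw [smul_add]
    refine add_mem ?_ ?_
    · rw [mul_comm, mul_smul]; exact L.smul_mem _ hax
    · rw [mul_smul]; exact L.smul_mem _ hby
  | smul c x _ hx =>
    obtain ⟨a, ha, hax⟩ := hx
    obtain ⟨b, d, hd, hbd⟩ := IsFractionRing.div_surjective (A := 𝓞 E) c
    have hd0 : (d : E) ≠ 0 := by
      rw [Ne, RingOfIntegers.coe_eq_zero_iff]
      exact nonZeroDivisors.ne_zero hd
    refine ⟨d * a, mul_ne_zero (nonZeroDivisors.ne_zero hd) ha, ?_⟩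
    have : (d * a) • c • x = b • a • x := by
      simp only [int_smul_eq, smul_smul, ← hbd, map_mul]
      congr 1
      field_simp
    rw [this]
    exact L.smul_mem _ hax

theorem exists_away_forall_mul_eq (s : Finset (Fin n → E)) (f : (Fin n → E) → E)
    (h : ∀ w ∈ s, f w ∈ locRing hp) : ∃ t, Away 𝔭 t ∧ ∀ w ∈ s, ∃ b : 𝓞 E, (t : E) * f w = b := by
  classical
  induction s using Finset.induction_on with
  | empty => exact ⟨1, away_one hp, by simp⟩
  | insert x s hx ih =>
    obtain ⟨t, ht, h1⟩ := ih fun w hw => h w (Finset.mem_insert_of_mem hw)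
    obtain ⟨u, hu, b, -, hb⟩ := h x (Finset.mem_insert_self _ _)
    refine ⟨t * u, ht.mul hp hu, fun w hw => ?_⟩
    rcases Finset.mem_insert.1 hw with rfl | hw
    · exact ⟨t * b, by simp only [map_mul, mul_assoc, hb]⟩
    · obtain ⟨c, hc⟩ := h1 w hw
      exact ⟨u * c, by simp only [map_mul, ← hc]; ring⟩

/-- For self-duality, a common denominator t of ⟨v,·⟩ on finitely many generators of L puts t̄v in
L^#, and a multiplier of L^# into L prime to 𝔭 and 𝔭̄ then puts v in the localisation. -/
theorem isUnimodular_loc (hp : 𝔭.IsPrime) (hL : L.IsLattice E) (hint : Integral L)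
    (hdisc : ¬ discr L ≤ (𝔭 : FractionalIdeal (𝓞 E)⁰ E)) : IsUnimodular hp (loc hp L) where
  smul_mem := smul_mem_loc
  herm_mem := herm_mem_of_mem_loc hint
  mem_of_herm := by
    intro v hv
    obtain ⟨a, ha, haL⟩ := exists_away_smul_dual_le hint hdisc
    obtain ⟨S, hS⟩ := hL.fg
    obtain ⟨t, ht, h⟩ := exists_away_forall_mul_eq (hp := hp) S (herm v) fun w hw =>
      hv w (le_loc (hS ▸ Submodule.subset_span hw))
    refine ⟨a * conjInt E t, ha.mul hp ht.conj, ?_⟩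
    rw [mul_smul]
    apply haL
    intro w hw
    rw [int_smul_eq, herm_smul_left, coe_conjInt, conj_conj, ← herm_smul_right]
    rw [← hS] at hw
    induction hw using Submodule.span_induction with
    | mem w hw =>
      obtain ⟨b, hb⟩ := h w hw
      rw [herm_smul_right, hb]
      exact RingOfIntegers.isIntegral_coe b
    | zero => simpa using isIntegral_zero
    | add x y _ _ hx hy => rw [smul_add, herm_add_right]; exact hx.add hy
    | smul c x _ hx =>
      rw [int_smul_eq, smul_comm, herm_smul_right]
      exact (RingOfIntegers.isIntegral_coe c).mul hx
  exists_smul_mem := fun v => by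
    obtain ⟨a, ha, h⟩ := exists_smul_mem hL v
    exact ⟨a, ha, le_loc h⟩

end Localisation

/-! ### Neighbours of a unimodular lattice over the localisation -/

section Local

variable {𝔭 : Ideal (𝓞 E)}

/-- `π` is a generator of the localisation of `𝔭`. -/
structure IsUniformizer (hp : 𝔭.IsPrime) (π : 𝓞 E) : Prop where
  mem : π ∈ 𝔭
  ne_zero : π ≠ 0
  div_mem : ∀ {a : E}, a ∈ locIdeal hp 𝔭 → a / π ∈ locRing hp
  conj_notMem_or : conjInt E π ∉ 𝔭 ∨ ∀ a ∈ locIdeal hp 𝔭, conj E a ∈ locIdeal hp 𝔭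

theorem exists_isUniformizer (hp : 𝔭.IsPrime) (hp0 : 𝔭 ≠ ⊥) : ∃ π, IsUniformizer hp π := by
  obtain ⟨π, h1, h2, h3⟩ := exists_uniformizer hp hp0
  refine ⟨π, h1, ?_, fun ha => div_mem_locRing h1 h2 h3 ha, h3.imp_right fun h a ha => ?_⟩
  · rintro rfl
    exact h2 (zero_mem _)
  · obtain ⟨s, hs, b, hb, hx⟩ := ha
    exact ⟨_, hs.conj, _, h b hb, by simp [← hx]⟩

/-- Units of the localisation of `𝓞 E` at `𝔭` and `𝔭̄`. -/
structure IsLocUnit (hp : 𝔭.IsPrime) (a : E) : Prop where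
  mem : a ∈ locRing hp
  notMem : a ∉ locIdeal hp 𝔭
  conj_notMem : conj E a ∉ locIdeal hp 𝔭

/-- `s` is the trace of an element `ε` of the localisation with `ε 𝔭 ⊆ 𝔭 ∩ 𝔭̄`. -/
def IsTrace (hp : 𝔭.IsPrime) (s : E) : Prop :=
  ∃ ε ∈ locRing hp, ε + conj E ε = s ∧ ∀ a ∈ locIdeal hp 𝔭, conj E (ε * a) ∈ locIdeal hp 𝔭

/-- `𝔭` is ramified of residue field `𝔽₂` and `M` has a characteristic vector which is not
isotropic modulo `𝔭`. -/
structure IsOddDyadic (hp : 𝔭.IsPrime) (M : Submodule (𝓞 E) (Fin n → E)) : Prop where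
  conj_mem : ∀ a ∈ locIdeal hp 𝔭, conj E a ∈ locIdeal hp 𝔭
  two_mem : (2 : E) ∈ locIdeal hp 𝔭
  mem_or : ∀ a ∈ locRing hp, a ∈ locIdeal hp 𝔭 ∨ a - 1 ∈ locIdeal hp 𝔭
  isTrace : ∀ s ∈ locIdeal hp 𝔭, conj E s = s → IsTrace hp s
  exists_characteristic : ∃ y ∈ M, herm y y ∉ locIdeal hp 𝔭 ∧
    ∀ v ∈ M, herm y v - herm v v ∈ locIdeal hp 𝔭

/-- The condition on traces under which all neighbours are conjugate. -/
def TraceCondition (hp : 𝔭.IsPrime) (M : Submodule (𝓞 E) (Fin n → E)) : Prop :=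
  (∀ s ∈ locRing hp, conj E s = s → IsTrace hp s) ∨ IsOddDyadic hp M

/-- `x` is a vector of `M` which is primitive at `𝔭` and `𝔭̄`, and whose norm is `π π̄` times a
trace. -/
structure IsGood (hp : 𝔭.IsPrime) (M : Submodule (𝓞 E) (Fin n → E)) (π : 𝓞 E) (x : Fin n → E) :
    Prop where
  mem : x ∈ M
  primitive : ∃ w ∈ M, herm x w ∉ locIdeal hp 𝔭
  primitive_conj : ∃ w ∈ M, conj E (herm x w) ∉ locIdeal hp 𝔭
  norm : ∃ s, herm x x = π * conj E π * s ∧ IsTrace hp s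

/-- The localisation of the neighbour of `M` defined by `x`. -/
def localNeighbour (hp : 𝔭.IsPrime) (M : Submodule (𝓞 E) (Fin n → E)) (π : 𝓞 E)
    (x : Fin n → E) : Set (Fin n → E) :=
  {v | ∃ y ∈ M, herm x y ∈ locIdeal hp 𝔭 ∧
    ∃ r ∈ locRing hp, v = y + (r * (conj E π)⁻¹) • x}

variable {hp : 𝔭.IsPrime} {M : Submodule (𝓞 E) (Fin n → E)} {π : 𝓞 E} {a b s : E}

theorem IsTrace.mem (h : IsTrace hp s) : s ∈ locRing hp := by
  obtain ⟨ε, hε, rfl, -⟩ := h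
  exact add_mem hε (conj_mem_locRing hε)

theorem IsTrace.mul (h : IsTrace hp s) (ha : a ∈ locRing hp) (ha' : conj E a = a) :
    IsTrace hp (a * s) := by
  obtain ⟨ε, hε, rfl, h⟩ := h
  refine ⟨a * ε, mul_mem ha hε, by rw [map_mul, ha']; ring, fun b hb => ?_⟩
  rw [mul_assoc, map_mul, ha']
  exact mul_mem_locIdeal ha (h b hb)

theorem IsTrace.add (ha : IsTrace hp a) (hb : IsTrace hp b) : IsTrace hp (a + b) := by
  obtain ⟨ε, hε, rfl, h⟩ := ha
  obtain ⟨δ, hδ, rfl, h'⟩ := hb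
  refine ⟨ε + δ, add_mem hε hδ, by rw [map_add]; ring, fun c hc => ?_⟩
  rw [add_mul, map_add]
  exact add_mem (h c hc) (h' c hc)

theorem IsLocUnit.map_conj (h : IsLocUnit hp a) : IsLocUnit hp (conj E a) :=
  ⟨conj_mem_locRing h.mem, h.conj_notMem, by simpa using h.notMem⟩

theorem IsLocUnit.ne_zero (h : IsLocUnit hp a) : a ≠ 0 := by
  rintro rfl
  exact h.notMem (zero_mem _)

theorem IsLocUnit.inv_mem (h : IsLocUnit hp a) : a⁻¹ ∈ locRing hp :=
  inv_mem_locRing h.mem h.notMem h.conj_notMem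

theorem IsLocUnit.neg (h : IsLocUnit hp a) : IsLocUnit hp (-a) :=
  ⟨neg_mem h.mem, by simpa using h.notMem, by simpa using h.conj_notMem⟩

theorem IsLocUnit.add (h : IsLocUnit hp a) (hb : b ∈ locIdeal hp 𝔭)
    (hb' : conj E b ∈ locIdeal hp 𝔭) : IsLocUnit hp (a + b) :=
  ⟨add_mem h.mem (locIdeal_le hb),
    fun h' => h.notMem ((AddSubgroup.add_mem_cancel_right _ hb).1 h'), fun h' => by
      rw [map_add] at h'
      exact h.conj_notMem ((AddSubgroup.add_mem_cancel_right _ hb').1 h')⟩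

theorem isLocUnit_one : IsLocUnit hp (1 : E) :=
  ⟨one_mem _, one_notMem_locIdeal, by simpa using one_notMem_locIdeal⟩

namespace IsUniformizer

variable (hπ : IsUniformizer hp π)

include hπ

theorem coe_ne_zero : (π : E) ≠ 0 := fun h => hπ.ne_zero (RingOfIntegers.coe_eq_zero_iff.1 h)

theorem conj_ne_zero : conj E (π : E) ≠ 0 := by simpa using hπ.ne_zero

theorem coe_mem : (π : E) ∈ locIdeal hp 𝔭 := coe_mem_locIdeal hπ.mem

theorem conj_mem : conj E (π : E) ∈ locRing hp := conj_mem_locRing (coe_mem_locRing π)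

theorem conj_div_mem (ha : conj E a ∈ locIdeal hp 𝔭) : a / conj E π ∈ locRing hp := by
  rw [← conj_mem_locRing_iff, map_div₀, conj_conj]
  exact hπ.div_mem ha

theorem norm_mul_mem (ha : a ∈ locRing hp) : π * conj E π * a ∈ locIdeal hp 𝔭 := by
  rw [mul_assoc]
  exact mul_mem_locIdeal_right hπ.coe_mem (mul_mem hπ.conj_mem ha)

theorem conj_norm_mul_mem (ha : a ∈ locRing hp) :
    conj E (π * conj E π * a) ∈ locIdeal hp 𝔭 := by
  rw [map_mul, map_mul, conj_conj, mul_comm (conj E (π : E))]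
  exact hπ.norm_mul_mem (conj_mem_locRing ha)

end IsUniformizer

theorem IsGood.norm_mem (hπ : IsUniformizer hp π) {x : Fin n → E} (hx : IsGood hp M π x) :
    herm x x ∈ locIdeal hp 𝔭 := by
  obtain ⟨s, h, hs⟩ := hx.norm
  rw [h]
  exact hπ.norm_mul_mem hs.mem

theorem IsOddDyadic.add_mem_of_notMem (hM : IsOddDyadic hp M) (ha : a ∈ locRing hp)
    (ha' : a ∉ locIdeal hp 𝔭) (hb : b ∈ locRing hp) (hb' : b ∉ locIdeal hp 𝔭) :
    a + b ∈ locIdeal hp 𝔭 := by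
  have h1 := (hM.mem_or a ha).resolve_left ha'
  have h2 := (hM.mem_or b hb).resolve_left hb'
  have : a + b = (a - 1) + (b - 1) + 2 := by ring
  rw [this]
  exact add_mem (add_mem h1 h2) hM.two_mem

theorem IsOddDyadic.trace_mem (hM : IsOddDyadic hp M) (ha : a ∈ locRing hp) :
    a + conj E a ∈ locIdeal hp 𝔭 := by
  by_cases h : a ∈ locIdeal hp 𝔭
  · exact add_mem h (hM.conj_mem _ h)
  · exact hM.add_mem_of_notMem ha h (conj_mem_locRing ha) fun h' =>
      h (by simpa using hM.conj_mem _ h')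

/-- A group is not the union of two proper subgroups: one of w₁, w₂, w₁ + w₂ works. -/
theorem exists_herm_notMem_both {x₁ x₂ : Fin n → E}
    (h₁ : ∃ w ∈ M, herm x₁ w ∉ locIdeal hp 𝔭) (h₂ : ∃ w ∈ M, herm x₂ w ∉ locIdeal hp 𝔭) :
    ∃ w ∈ M, herm x₁ w ∉ locIdeal hp 𝔭 ∧ herm x₂ w ∉ locIdeal hp 𝔭 := by
  obtain ⟨w₁, hw₁, h₁⟩ := h₁
  obtain ⟨w₂, hw₂, h₂⟩ := h₂
  by_cases h3 : herm x₂ w₁ ∈ locIdeal hp 𝔭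
  · by_cases h4 : herm x₁ w₂ ∈ locIdeal hp 𝔭
    · refine ⟨w₁ + w₂, add_mem hw₁ hw₂, ?_, ?_⟩
      · rwa [herm_add_right, AddSubgroup.add_mem_cancel_right _ h4]
      · rwa [herm_add_right, AddSubgroup.add_mem_cancel_left _ h3]
    · exact ⟨w₂, hw₂, h4, h₂⟩
  · exact ⟨w₁, hw₁, h₁, h3⟩

theorem exists_conj_herm_notMem_both {x₁ x₂ : Fin n → E}
    (h₁ : ∃ w ∈ M, conj E (herm x₁ w) ∉ locIdeal hp 𝔭)
    (h₂ : ∃ w ∈ M, conj E (herm x₂ w) ∉ locIdeal hp 𝔭) :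
    ∃ w ∈ M, conj E (herm x₁ w) ∉ locIdeal hp 𝔭 ∧ conj E (herm x₂ w) ∉ locIdeal hp 𝔭 := by
  obtain ⟨w₁, hw₁, h₁⟩ := h₁
  obtain ⟨w₂, hw₂, h₂⟩ := h₂
  by_cases h3 : conj E (herm x₂ w₁) ∈ locIdeal hp 𝔭
  · by_cases h4 : conj E (herm x₁ w₂) ∈ locIdeal hp 𝔭
    · refine ⟨w₁ + w₂, add_mem hw₁ hw₂, ?_, ?_⟩
      · rwa [herm_add_right, map_add, AddSubgroup.add_mem_cancel_right _ h4]
      · rwa [herm_add_right, map_add, AddSubgroup.add_mem_cancel_left _ h3]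
    · exact ⟨w₂, hw₂, h4, h₂⟩
  · exact ⟨w₁, hw₁, h₁, h3⟩

theorem exists_isLocUnit_herm_both (hM : IsUnimodular hp M) (hπ : IsUniformizer hp π)
    {x₁ x₂ : Fin n → E} (h₁ : IsGood hp M π x₁) (h₂ : IsGood hp M π x₂) :
    ∃ w ∈ M, IsLocUnit hp (herm x₁ w) ∧ IsLocUnit hp (herm x₂ w) := by
  obtain ⟨u, hu, h3, h4⟩ := exists_herm_notMem_both h₁.primitive h₂.primitive
  obtain ⟨v, hv, h5, h6⟩ := exists_conj_herm_notMem_both h₁.primitive_conj h₂.primitive_conj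
  rcases hπ.conj_notMem_or with hc | hc
  -- For 𝔭 ≠ 𝔭̄ the vectors are glued as in the Chinese remainder theorem: π̄u + πv behaves like u
  -- at 𝔭 and like v at 𝔭̄, up to units.
  · have hc' : conj E (π : E) ∉ locIdeal hp 𝔭 := fun h => hc (coe_mem_locIdeal_iff.1 h)
    have key : ∀ x ∈ M, herm x u ∉ locIdeal hp 𝔭 → conj E (herm x v) ∉ locIdeal hp 𝔭 →
        IsLocUnit hp (herm x (conj E (π : E) • u + (π : E) • v)) := by
      intro x hx h7 h8
      have hxu := hM.herm_mem hx hu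
      have hxv := hM.herm_mem hx hv
      rw [herm_add_right, herm_smul_right, herm_smul_right]
      refine ⟨add_mem (mul_mem hπ.conj_mem hxu) (mul_mem (coe_mem_locRing _) hxv), ?_, ?_⟩
      · rw [AddSubgroup.add_mem_cancel_right _ (mul_mem_locIdeal_right hπ.coe_mem hxv)]
        exact fun h => (mem_or_mem_of_mul_mem hπ.conj_mem hxu h).elim hc' h7
      · rw [map_add, map_mul, map_mul, conj_conj, AddSubgroup.add_mem_cancel_left _
          (mul_mem_locIdeal_right hπ.coe_mem (conj_mem_locRing hxu))]
        exact fun h => (mem_or_mem_of_mul_mem hπ.conj_mem (conj_mem_locRing hxv) h).elim hc' h8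
    exact ⟨_, add_mem (hM.smul_mem hπ.conj_mem hu) (hM.smul_mem (coe_mem_locRing _) hv),
      key x₁ h₁.mem h3 h5, key x₂ h₂.mem h4 h6⟩
  · exact ⟨u, hu, ⟨hM.herm_mem h₁.mem hu, h3, fun h => h3 (by simpa using hc _ h)⟩,
      ⟨hM.herm_mem h₂.mem hu, h4, fun h => h4 (by simpa using hc _ h)⟩⟩

/-- Only the dyadic case with ⟨w,w⟩ a unit needs work. A characteristic vector y pairs into 𝔭 with
good vectors, since their norms lie in 𝔭, so w + y keeps the unit pairings. Its norm is 1 + 1 +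
Tr⟨w,y⟩ ≡ 0 modulo 𝔭. -/
theorem exists_isLocUnit_herm_both_isTrace (hM : IsUnimodular hp M) (hπ : IsUniformizer hp π)
    (hT : TraceCondition hp M) {x₁ x₂ : Fin n → E} (h₁ : IsGood hp M π x₁)
    (h₂ : IsGood hp M π x₂) :
    ∃ w ∈ M, IsLocUnit hp (herm x₁ w) ∧ IsLocUnit hp (herm x₂ w) ∧ IsTrace hp (herm w w) := by
  obtain ⟨w, hw, h3, h4⟩ := exists_isLocUnit_herm_both hM hπ h₁ h₂
  rcases hT with hT | hT
  · exact ⟨w, hw, h3, h4, hT _ (hM.herm_mem hw hw) (conj_herm _ _)⟩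
  by_cases hN : herm w w ∈ locIdeal hp 𝔭
  · exact ⟨w, hw, h3, h4, hT.isTrace _ hN (conj_herm _ _)⟩
  obtain ⟨y, hy, hyN, hyv⟩ := hT.exists_characteristic
  have key : ∀ x, IsGood hp M π x → IsLocUnit hp (herm x w) →
      IsLocUnit hp (herm x (w + y)) := by
    intro x hx hxw
    have hyx : herm y x ∈ locIdeal hp 𝔭 := by
      have := hyv x hx.mem
      rwa [sub_eq_add_neg, AddSubgroup.add_mem_cancel_right _ (neg_mem (hx.norm_mem hπ))] at this
    rw [herm_add_right]
    refine hxw.add ?_ ?_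
    · rw [← conj_herm]
      exact hT.conj_mem _ hyx
    · rwa [conj_herm]
  refine ⟨w + y, add_mem hw hy, key _ h₁ h3, key _ h₂ h4, hT.isTrace _ ?_ (conj_herm _ _)⟩
  have h5 := hT.add_mem_of_notMem (hM.herm_mem hw hw) hN (hM.herm_mem hy hy) hyN
  have h6 := hT.trace_mem (hM.herm_mem hw hy)
  rw [conj_herm] at h6
  have : herm (w + y) (w + y) = herm w w + herm y y + (herm w y + herm y w) := by
    simp only [herm_add_left, herm_add_right]; ring
  rw [this]
  exact add_mem h5 h6

/-! #### Isometries between neighbours -/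

/-- The quasi-reflection along v = x₁ - x₂ with d = ⟨v,x₁⟩ would send x₁ exactly to x₂, but d + d̄ =
⟨v,v⟩ holds only for equal norms. Correcting d by a multiple of ππ̄ makes it an isometry, at the
cost of an error in ππ̄M. -/
theorem exists_isometry_of_isLocUnit (hM : IsUnimodular hp M) (hπ : IsUniformizer hp π)
    {x₁ x₂ : Fin n → E} (h₁ : IsGood hp M π x₁) (h₂ : IsGood hp M π x₂)
    (hu : IsLocUnit hp (herm x₂ x₁)) :
    ∃ g : (Fin n → E) ≃ₗ[E] (Fin n → E), IsIsometry g ∧ (∀ v ∈ M, g v ∈ M) ∧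
      ∃ m ∈ M, g x₁ = x₂ + (π * conj E π : E) • m := by
  obtain ⟨s₁, hs₁, ε₁, hε₁, rfl, -⟩ := h₁.norm
  obtain ⟨s₂, hs₂, ε₂, hε₂, rfl, -⟩ := h₂.norm
  -- The trace of ε is ⟨x₁,x₁⟩ - ⟨x₂,x₂⟩, exactly the defect in the relation for d.
  set ε : E := π * conj E π * (ε₁ - ε₂) with hε
  set d : E := herm x₁ x₁ - herm x₂ x₁ - ε with hd
  have hdu : IsLocUnit hp d := by
    have : d = -herm x₂ x₁ + π * conj E π * (conj E ε₁ + ε₂) := by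
      rw [hd, hε, hs₁]; ring
    rw [this]
    have hmem := add_mem (conj_mem_locRing hε₁) hε₂
    exact hu.neg.add (hπ.norm_mul_mem hmem) (hπ.conj_norm_mul_mem hmem)
  have htr : d + conj E d = herm (x₁ - x₂) (x₁ - x₂) := by
    simp only [hd, hε, herm_sub_left, herm_sub_right, map_sub, map_mul, map_add, conj_herm,
      conj_conj, hs₁, hs₂]
    ring
  obtain ⟨g, hg, hgv⟩ := exists_quasiReflection (x₁ - x₂) hdu.ne_zero htr
  have hv := sub_mem h₁.mem h₂.mem
  refine ⟨g, hg, fun v hv' => ?_, -((ε₁ - ε₂) * d⁻¹) • (x₁ - x₂),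
    hM.smul_mem (neg_mem (mul_mem (sub_mem hε₁ hε₂) hdu.inv_mem)) hv, ?_⟩
  · rw [hgv]
    exact sub_mem hv' (hM.smul_mem (mul_mem (hM.herm_mem hv hv') hdu.inv_mem) hv)
  · have : herm (x₁ - x₂) x₁ * d⁻¹ = 1 + ε * d⁻¹ := by
      rw [herm_sub_left, ← sub_add_cancel (herm x₁ x₁ - herm x₂ x₁) ε, ← hd, add_mul,
        mul_inv_cancel₀ hdu.ne_zero]
    rw [hgv, this, hε, smul_smul]
    module

/-- If ⟨x₂,x₁⟩ is not a unit, the move passes through a third good vector w + rx₁ whose pairings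
with x₁ and x₂ are both units. -/
theorem exists_isometry_of_isGood (hM : IsUnimodular hp M) (hπ : IsUniformizer hp π)
    (hT : TraceCondition hp M) {x₁ x₂ : Fin n → E} (h₁ : IsGood hp M π x₁)
    (h₂ : IsGood hp M π x₂) :
    ∃ g : (Fin n → E) ≃ₗ[E] (Fin n → E), IsIsometry g ∧ (∀ v ∈ M, g v ∈ M) ∧
      ∃ m ∈ M, g x₁ = x₂ + (π * conj E π : E) • m := by
  by_cases hu : IsLocUnit hp (herm x₂ x₁)
  · exact exists_isometry_of_isLocUnit hM hπ h₁ h₂ hu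
  have h21 := hM.herm_mem h₂.mem h₁.mem
  obtain ⟨w, hw, hw₁, hw₂, hwT⟩ := exists_isLocUnit_herm_both_isTrace hM hπ hT h₁ h₂
  have hw₁' : IsLocUnit hp (herm w x₁) := by
    rw [← conj_herm]; exact hw₁.map_conj
  -- The non-unit ⟨x₂,x₁⟩ lies in 𝔭 or in 𝔭̄. Respectively ε or ε̄ multiplies it into both, which is
  -- where the second condition in `IsTrace` enters.
  obtain ⟨ε, hε, hεw, hεJ, hεJ'⟩ : ∃ ε ∈ locRing hp, ε + conj E ε = herm w w ∧
      ε * herm x₂ x₁ ∈ locIdeal hp 𝔭 ∧ conj E (ε * herm x₂ x₁) ∈ locIdeal hp 𝔭 := by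
    obtain ⟨ε, hε, hεw, h⟩ := hwT
    by_cases h21P : herm x₂ x₁ ∈ locIdeal hp 𝔭
    · exact ⟨ε, hε, hεw, mul_mem_locIdeal hε h21P, h _ h21P⟩
    · have h21P' : conj E (herm x₂ x₁) ∈ locIdeal hp 𝔭 := by
        by_contra h'
        exact hu ⟨h21, h21P, h'⟩
      refine ⟨conj E ε, conj_mem_locRing hε, by rw [conj_conj, add_comm, hεw], ?_, ?_⟩
      · simpa using h _ h21P'
      · rw [map_mul]
        exact mul_mem_locIdeal (by simpa using hε) h21P'
  -- With this r the cross terms of ⟨w + rx₁, w + rx₁⟩ are -ε - ε̄ and cancel ⟨w,w⟩; only r̄r⟨x₁,x₁⟩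
  -- remains.
  set r : E := -(ε * (herm w x₁)⁻¹) with hr
  have hrR : r ∈ locRing hp := neg_mem (mul_mem hε hw₁'.inv_mem)
  have hrw : r * herm w x₁ = -ε := by
    rw [hr, neg_mul, mul_assoc, inv_mul_cancel₀ hw₁'.ne_zero, mul_one]
  have hrw' : conj E r * herm x₁ w = -conj E ε := by
    rw [← conj_herm, ← map_mul, hrw, map_neg]
  obtain ⟨s₁, hs₁, hs₁T⟩ := h₁.norm
  have hN : herm (w + r • x₁) (w + r • x₁) = π * conj E π * (conj E r * r * s₁) := by
    have : herm (w + r • x₁) (w + r • x₁) =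
        herm w w + r * herm w x₁ + conj E r * herm x₁ w + conj E r * r * herm x₁ x₁ := by
      simp only [herm_add_left, herm_add_right, herm_smul_left, herm_smul_right]; ring
    rw [this, hrw, hrw', ← hεw, hs₁]
    ring
  have h13 : IsLocUnit hp (herm x₁ (w + r • x₁)) := by
    rw [herm_add_right, herm_smul_right, hs₁, mul_left_comm]
    exact hw₁.add (hπ.norm_mul_mem (mul_mem hrR hs₁T.mem))
      (hπ.conj_norm_mul_mem (mul_mem hrR hs₁T.mem))
  have h31 : IsLocUnit hp (herm (w + r • x₁) x₁) := by
    rw [← conj_herm]; exact h13.map_conj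
  have h23 : IsLocUnit hp (herm x₂ (w + r • x₁)) := by
    have h4 : r * herm x₂ x₁ = (-(herm w x₁)⁻¹) * (ε * herm x₂ x₁) := by rw [hr]; ring
    have h5 := neg_mem hw₁'.inv_mem
    rw [herm_add_right, herm_smul_right, h4]
    refine hw₂.add (mul_mem_locIdeal h5 hεJ) ?_
    rw [map_mul]
    exact mul_mem_locIdeal (conj_mem_locRing h5) hεJ'
  have h₃ : IsGood hp M π (w + r • x₁) :=
    ⟨add_mem hw (hM.smul_mem hrR h₁.mem), ⟨x₁, h₁.mem, h31.notMem⟩,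
      ⟨x₁, h₁.mem, h31.conj_notMem⟩, _, hN,
      hs₁T.mul (mul_mem (conj_mem_locRing hrR) hrR) (by rw [map_mul, conj_conj, mul_comm])⟩
  obtain ⟨g, hg, hgM, m, hm, hgm⟩ := exists_isometry_of_isLocUnit hM hπ h₁ h₃ h31
  obtain ⟨g', hg', hgM', m', hm', hgm'⟩ := exists_isometry_of_isLocUnit hM hπ h₃ h₂ h23
  refine ⟨g.trans g', hg.trans hg', fun v hv => hgM' _ (hgM _ hv), m' + g' m,
    add_mem hm' (hgM' _ hm), ?_⟩
  rw [LinearEquiv.trans_apply, hgm, map_add, map_smul, hgm', smul_add, add_assoc]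

/-- An error ππ̄m in the image of x₁ is harmless: multiplied by rπ̄⁻¹ it becomes rπm, which lies in
M, pairs into 𝔭 with x₂, and is absorbed into y. -/
theorem map_localNeighbour (hM : IsUnimodular hp M) (hπ : IsUniformizer hp π)
    {x₁ x₂ : Fin n → E} (h₂ : x₂ ∈ M) {g : (Fin n → E) ≃ₗ[E] (Fin n → E)}
    (hg : IsIsometry g) (hgM : ∀ v ∈ M, g v ∈ M) {m : Fin n → E} (hm : m ∈ M)
    (hgm : g x₁ = x₂ + (π * conj E π : E) • m) {v : Fin n → E}
    (hv : v ∈ localNeighbour hp M π x₁) : g v ∈ localNeighbour hp M π x₂ := by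
  obtain ⟨y, hy, hxy, r, hr, rfl⟩ := hv
  refine ⟨g y + (r * π) • m,
    add_mem (hgM _ hy) (hM.smul_mem (mul_mem hr (coe_mem_locRing _)) hm), ?_, r, hr, ?_⟩
  · have h3 : herm x₂ (g y) = herm x₁ y - π * conj E π * herm m (g y) := by
      rw [← hg x₁ y, hgm, herm_add_left, herm_smul_left, map_mul, conj_conj]
      ring
    rw [herm_add_right, herm_smul_right, h3]
    refine add_mem (sub_mem hxy (hπ.norm_mul_mem (hM.herm_mem hm (hgM _ hy)))) ?_
    rw [mul_comm r, mul_assoc]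
    exact mul_mem_locIdeal_right hπ.coe_mem (mul_mem hr (hM.herm_mem h₂ hm))
  · rw [map_add, map_smul, hgm, smul_add, smul_smul]
    have : r * (conj E (π : E))⁻¹ * (π * conj E π) = r * π := by
      field_simp [hπ.conj_ne_zero]
    rw [this]
    module

/-- The new term rπ̄⁻¹·π̄y = ry lies in M and is absorbed into z. This is the freedom used to
improve the defining vector. -/
theorem localNeighbour_add_smul (hM : IsUnimodular hp M) (hπ : IsUniformizer hp π)
    {x y : Fin n → E} (hy : y ∈ M) (hxy : herm x y ∈ locIdeal hp 𝔭) :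
    localNeighbour hp M π x ⊆ localNeighbour hp M π (x + conj E (π : E) • y) := by
  rintro v ⟨z, hz, hxz, r, hr, rfl⟩
  have hc := hπ.conj_ne_zero
  refine ⟨z - r • y, sub_mem hz (hM.smul_mem hr hy), ?_, r, hr, ?_⟩
  · rw [herm_add_left, herm_smul_left, conj_conj]
    refine add_mem ?_ (mul_mem_locIdeal_right hπ.coe_mem
      (hM.herm_mem hy (sub_mem hz (hM.smul_mem hr hy))))
    rw [herm_sub_right, herm_smul_right]
    exact sub_mem hxz (mul_mem_locIdeal hr hxy)
  · rw [smul_add, smul_smul, mul_assoc, inv_mul_cancel₀ hc, mul_one]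
    module

/-- Every good vector `x` of `M` gives an isometry from `M` to the neighbour defined by `x`. -/
theorem exists_isometry_localNeighbour (hM : IsUnimodular hp M) (hπ : IsUniformizer hp π)
    (hT : TraceCondition hp M) {x : Fin n → E} (hx : IsGood hp M π x) :
    ∃ g : (Fin n → E) ≃ₗ[E] (Fin n → E), IsIsometry g ∧
      ∀ v ∈ M, g v ∈ localNeighbour hp M π x := by
  have hπ0 := hπ.coe_ne_zero
  have hπ0' := hπ.conj_ne_zero
  obtain ⟨w, hw, hxw, -, hwT⟩ := exists_isLocUnit_herm_both_isTrace hM hπ hT hx hx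
  set z : Fin n → E := (herm x w)⁻¹ • w with hz
  have hzM : z ∈ M := hM.smul_mem hxw.inv_mem hw
  have hxz : herm x z = 1 := by
    rw [hz, herm_smul_right, inv_mul_cancel₀ hxw.ne_zero]
  have hzx : herm z x = 1 := by rw [← conj_herm, hxz, map_one]
  have hzT : IsTrace hp (herm z z) := by
    rw [hz, herm_smul_left, herm_smul_right, ← mul_assoc]
    refine hwT.mul (mul_mem (conj_mem_locRing hxw.inv_mem) hxw.inv_mem) ?_
    rw [map_mul, conj_conj, mul_comm]
  obtain ⟨s, hs, hsT⟩ := hx.norm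
  obtain ⟨ε, hε, hεs, hεP⟩ := hzT.add hsT
  -- Since ⟨x,z⟩ = 1, the norm of v is ⟨z,z⟩ + s - π⁻¹ - π̄⁻¹. So d = -π⁻¹ + ε works as soon as ε
  -- has trace ⟨z,z⟩ + s.
  set v : Fin n → E := z - (conj E (π : E))⁻¹ • x with hv
  -- A unit at both primes, because επ lies in 𝔭 and, by the choice of ε, in 𝔭̄.
  set u : E := 1 - ε * π with hu
  have huU : IsLocUnit hp u := by
    rw [hu, sub_eq_add_neg]
    refine isLocUnit_one.add (neg_mem (mul_mem_locIdeal hε hπ.coe_mem)) ?_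
    rw [map_neg]
    exact neg_mem (hεP _ hπ.coe_mem)
  set d : E := -(π : E)⁻¹ * u with hd
  have hd0 : d ≠ 0 := mul_ne_zero (neg_ne_zero.2 (inv_ne_zero hπ0)) huU.ne_zero
  have hd1 : d⁻¹ = -(π * u⁻¹) := by
    rw [hd, mul_inv, inv_neg, inv_inv, neg_mul]
  have htr : d + conj E d = herm v v := by
    have h1 : d = -(π : E)⁻¹ + ε := by
      rw [hd, hu]
      field_simp
      ring
    have h2 : herm v v = herm z z + s - (π : E)⁻¹ - (conj E (π : E))⁻¹ := by
      simp only [hv, herm_sub_left, herm_sub_right, herm_smul_left, herm_smul_right, hxz, hzx, hs,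
        map_inv₀, conj_conj]
      field_simp
      ring
    rw [h2, h1, ← hεs, map_add, map_neg, map_inv₀]
    ring
  have hvy : ∀ y, herm v y = herm z y - (π : E)⁻¹ * herm x y := by
    intro y
    rw [hv, herm_sub_left, herm_smul_left _ x y, map_inv₀, conj_conj]
  obtain ⟨g, hg, hgv⟩ := exists_quasiReflection v hd0 htr
  refine ⟨g, hg, fun y hy => ?_⟩
  have hπR : (π : E) ∈ locRing hp := coe_mem_locRing π
  set t := herm x y with ht
  have htR : t ∈ locRing hp := hM.herm_mem hx.mem hy
  have hzy := hM.herm_mem hzM hy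
  -- The image y + αv is regrouped as (y + αz) - απ̄⁻¹x. Since u ≡ 1 modulo π, also α ≡ -t, so ⟨x, y
  -- + αz⟩ = t + α lies in 𝔭.
  set α : E := u⁻¹ * (π * herm z y - t) with hα
  have hαR : α ∈ locRing hp := mul_mem huU.inv_mem (sub_mem (mul_mem hπR hzy) htR)
  have hgy : g y = y + α • v := by
    rw [hgv, hd1, hvy, ← ht, sub_eq_add_neg, ← neg_smul]
    congr 2
    rw [hα]
    field_simp
  refine ⟨y + α • z, add_mem hy (hM.smul_mem hαR hzM), ?_, -α, neg_mem hαR, ?_⟩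
  · rw [herm_add_right, herm_smul_right, hxz, mul_one, ← ht]
    have : t + α = π * (u⁻¹ * (herm z y - ε * t)) := by
      have hu0 := huU.ne_zero
      have : t = u⁻¹ * (u * t) := by rw [← mul_assoc, inv_mul_cancel₀ hu0, one_mul]
      rw [hα]
      nth_rewrite 1 [this]
      rw [hu]
      ring
    rw [this]
    exact mul_mem_locIdeal_right hπ.coe_mem
      (mul_mem huU.inv_mem (sub_mem hzy (mul_mem hε htR)))
  · rw [hgy, hv]
    module

end Local

/-! ### Defining vectors of neighbours and the resulting local isometries -/

section Local

variable {𝔭 : Ideal (𝓞 E)} {hp : 𝔭.IsPrime} {M L L' L₁ L₂ : Submodule (𝓞 E) (Fin n → E)} {π : 𝓞 E}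

/-- If every multiple of y in M were imprimitive at 𝔭̄, self-duality of M would allow division by π
indefinitely. A nonzero pairing with y would then have a numerator in every power of 𝔭, against
Krull's intersection theorem. -/
theorem exists_smul_primitive (hM : IsUnimodular hp M) (hπ : IsUniformizer hp π)
    {y : Fin n → E} (hy : y ≠ 0) :
    ∃ a : E, a • y ∈ M ∧ ∃ w ∈ M, conj E (herm (a • y) w) ∉ locIdeal hp 𝔭 := by
  by_contra! hcon
  have hπ0 := hπ.coe_ne_zero
  have hπ0' := hπ.conj_ne_zero
  obtain ⟨b, hb, hbM⟩ := hM.exists_smul_mem y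
  rw [int_smul_eq] at hbM
  have hk : ∀ k : ℕ, (((π : E)⁻¹) ^ k * b) • y ∈ M := by
    intro k
    induction k with
    | zero => simpa using hbM
    | succ k ih =>
      apply hM.mem_of_herm
      intro w hw
      have h1 := hπ.conj_div_mem (hcon _ ih w hw)
      have h2 : herm (((π : E)⁻¹ ^ (k + 1) * (b : E)) • y) w =
          herm (((π : E)⁻¹ ^ k * (b : E)) • y) w / conj E π := by
        simp only [herm_smul_left, map_mul, map_pow, map_inv₀]
        rw [pow_succ, div_eq_mul_inv]
        ring
      rwa [h2]
  obtain ⟨w, hw⟩ : ∃ w, herm w y ≠ 0 := by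
    by_contra! h
    exact hy (eq_zero_of_herm_eq_zero h)
  obtain ⟨c, hc, hcM⟩ := hM.exists_smul_mem w
  rw [int_smul_eq] at hcM
  obtain ⟨s, hs, x, -, hx⟩ := hM.herm_mem hcM hbM
  have hx0 : x ≠ 0 := by
    rintro rfl
    rw [herm_smul_left, herm_smul_right] at hx
    have hb' : (b : E) ≠ 0 := by rwa [Ne, RingOfIntegers.coe_eq_zero_iff]
    have hc' : conj E (c : E) ≠ 0 := by simpa using hc
    exact (mul_ne_zero hs.ne_zero (mul_ne_zero hc' (mul_ne_zero hb' hw))) (by rw [hx]; simp)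
  apply hx0
  have hmem : ∀ k : ℕ, x ∈ 𝔭 ^ k := by
    intro k
    obtain ⟨t, ht, z, -, hz⟩ := hM.herm_mem hcM (hk k)
    have h0 : ((t * x : 𝓞 E) : E) = ((π ^ k * (s * z) : 𝓞 E) : E) := by
      have hpk : (π : E) ^ k * (π : E)⁻¹ ^ k = 1 := by
        rw [← mul_pow, mul_inv_cancel₀ hπ0, one_pow]
      simp only [map_mul, map_pow, ← hz, ← hx, herm_smul_right]
      linear_combination (-(t * s * (b * herm ((c : E) • w) y)) : E) * hpk
    have h1 : t * x = π ^ k * (s * z) := RingOfIntegers.ext h0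
    have h2 : t * x ∈ 𝔭 ^ k := by
      rw [h1]
      exact Ideal.mul_mem_right _ _ (Ideal.pow_mem_pow hπ.mem k)
    have := hp
    exact (Ideal.IsPrime.mul_mem_pow 𝔭 h2).resolve_left ht.1
  have : x ∈ (⨅ k : ℕ, 𝔭 ^ k) := by simpa [Submodule.mem_iInf] using hmem
  rwa [Ideal.iInf_pow_eq_bot_of_isDomain 𝔭 hp.ne_top, Ideal.mem_bot] at this

theorem exists_ne_zero_herm_eq_zero (hn : 2 ≤ n) (x : Fin n → E) : ∃ y ≠ 0, herm x y = 0 := by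
  let f : (Fin n → E) →ₗ[E] E :=
    { toFun := herm x
      map_add' := herm_add_right x
      map_smul' := fun a y => by simp [herm_smul_right] }
  have hker : LinearMap.ker f ≠ ⊥ := by
    intro h
    have h1 := LinearMap.finrank_le_finrank_of_injective (LinearMap.ker_eq_bot.1 h)
    simp at h1
    omega
  obtain ⟨y, hy, hy0⟩ := Submodule.exists_mem_ne_zero_of_ne_bot hker
  exact ⟨y, hy0, hy⟩

/-- A vector defining a neighbour can be replaced by a good vector defining the same one. -/
theorem exists_isGood (hM : IsUnimodular hp M) (hπ : IsUniformizer hp π)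
    (hT : TraceCondition hp M) (hn : 2 ≤ n) {x : Fin n → E} (hx : x ∈ M)
    (hprim : ∃ w ∈ M, herm x w ∉ locIdeal hp 𝔭)
    (hN : ∃ s ∈ locRing hp, herm x x = π * conj E π * s) :
    ∃ y ∈ M, herm x y ∈ locIdeal hp 𝔭 ∧ IsGood hp M π (x + conj E (π : E) • y) := by
  obtain ⟨s, hs, hN⟩ := hN
  have hc0 : (π * conj E π : E) ≠ 0 := mul_ne_zero hπ.coe_ne_zero hπ.conj_ne_zero
  have hss : conj E s = s := by
    apply mul_left_cancel₀ hc0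
    have := conj_herm x x
    rw [hN] at this
    simpa [mul_comm (conj E (π : E))] using this
  have hz : (∃ w ∈ M, conj E (herm x w) ∉ locIdeal hp 𝔭) → IsTrace hp s →
      ∃ y ∈ M, herm x y ∈ locIdeal hp 𝔭 ∧ IsGood hp M π (x + conj E (π : E) • y) :=
    fun hprim' hT => ⟨0, zero_mem _, by simp, by
      simpa using ⟨hx, hprim, hprim', s, hN, hT⟩⟩
  -- For 𝔭 = 𝔭̄ primitivity at the conjugate prime is automatic, and only the trace condition on s
  -- can fail.
  by_cases hsplit : ∀ a ∈ locIdeal hp 𝔭, conj E a ∈ locIdeal hp 𝔭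
  · have hprim' : ∃ w ∈ M, conj E (herm x w) ∉ locIdeal hp 𝔭 := by
      obtain ⟨w, hw, h⟩ := hprim
      exact ⟨w, hw, fun h' => h (by simpa using hsplit _ h')⟩
    rcases hT with hT | hT
    · exact hz hprim' (hT s hs hss)
    by_cases hsP : s ∈ locIdeal hp 𝔭
    · exact hz hprim' (hT.isTrace s hsP hss)
    -- Replacing x by x + π̄y changes s to s + ⟨y,y⟩ + Tr(⟨x,y⟩/π). Both s and ⟨y,y⟩ are units with
    -- residue field 𝔽₂, so the sum lies in 𝔭 and is a trace.
    obtain ⟨y, hy, hyN, hyv⟩ := hT.exists_characteristic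
    have hyx : herm y x ∈ locIdeal hp 𝔭 := by
      have := hyv x hx
      have hN' : herm x x ∈ locIdeal hp 𝔭 := by rw [hN]; exact hπ.norm_mul_mem hs
      rwa [sub_eq_add_neg, AddSubgroup.add_mem_cancel_right _ (neg_mem hN')] at this
    have hxy : herm x y ∈ locIdeal hp 𝔭 := by
      rw [← conj_herm]; exact hT.conj_mem _ hyx
    have hyy := hM.herm_mem hy hy
    refine ⟨y, hy, hxy, add_mem hx (hM.smul_mem hπ.conj_mem hy), ?_, ?_,
      s + herm y y + (herm x y / π + conj E (herm x y / π)), ?_, hT.isTrace _ ?_ ?_⟩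
    · obtain ⟨w, hw, h⟩ := hprim
      refine ⟨w, hw, ?_⟩
      rwa [herm_add_left, herm_smul_left, conj_conj, AddSubgroup.add_mem_cancel_right _
        (mul_mem_locIdeal_right hπ.coe_mem (hM.herm_mem hy hw))]
    · obtain ⟨w, hw, h⟩ := hprim'
      refine ⟨w, hw, ?_⟩
      rwa [herm_add_left, map_add, herm_smul_left, conj_conj, AddSubgroup.add_mem_cancel_right _
        (hsplit _ (mul_mem_locIdeal_right hπ.coe_mem (hM.herm_mem hy hw)))]
    · rw [herm_add_left, herm_add_right, herm_add_right, herm_smul_left, herm_smul_left,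
        herm_smul_right, herm_smul_right, hN, conj_conj, map_div₀, conj_herm]
      have h1 := hπ.coe_ne_zero
      have h2 := hπ.conj_ne_zero
      field_simp
      ring
    · exact add_mem (hT.add_mem_of_notMem hs hsP hyy hyN) (hT.trace_mem (hπ.div_mem hxy))
    · simp only [map_add, hss, conj_herm, conj_conj]
      ring
  · have hT' : ∀ s ∈ locRing hp, conj E s = s → IsTrace hp s :=
      hT.resolve_right fun h => hsplit h.conj_mem
    by_cases hprim' : ∃ w ∈ M, conj E (herm x w) ∉ locIdeal hp 𝔭
    · exact hz hprim' (hT' s hs hss)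
    push Not at hprim'
    -- For 𝔭 ≠ 𝔭̄ only primitivity at 𝔭̄ can fail. It is restored by adding π̄y with y orthogonal to
    -- x and primitive at 𝔭̄: in the first argument π̄ comes out as π, a unit at 𝔭̄. The vector y
    -- exists because the rank is at least 2.
    obtain ⟨y₀, hy₀, hxy₀⟩ := exists_ne_zero_herm_eq_zero hn x
    obtain ⟨a, hy, w, hw, hyw⟩ := exists_smul_primitive hM hπ hy₀
    set y := a • y₀ with hya
    have hxy : herm x y = 0 := by rw [hya, herm_smul_right, hxy₀, mul_zero]
    have hyx : herm y x = 0 := by rw [← conj_herm, hxy, map_zero]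
    have hyy := hM.herm_mem hy hy
    clear_value y
    have hcπ : conj E (π : E) ∉ locIdeal hp 𝔭 := fun h =>
      hπ.conj_notMem_or.elim (fun h' => h' (coe_mem_locIdeal_iff.1 h)) hsplit
    refine ⟨y, hy, by rw [hxy]; exact zero_mem _, add_mem hx (hM.smul_mem hπ.conj_mem hy), ?_,
      ⟨w, hw, ?_⟩, s + herm y y, ?_, hT' _ (add_mem hs hyy) (by rw [map_add, hss, conj_herm])⟩
    · obtain ⟨w, hw, h⟩ := hprim
      refine ⟨w, hw, ?_⟩
      rwa [herm_add_left, herm_smul_left, conj_conj, AddSubgroup.add_mem_cancel_right _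
        (mul_mem_locIdeal_right hπ.coe_mem (hM.herm_mem hy hw))]
    · rw [herm_add_left, map_add, AddSubgroup.add_mem_cancel_left _ (hprim' w hw),
        herm_smul_left, conj_conj, map_mul]
      exact fun h => (mem_or_mem_of_mul_mem hπ.conj_mem
        (conj_mem_locRing (hM.herm_mem hy hw)) h).elim hcπ hyw
    · rw [herm_add_left, herm_add_right, herm_add_right, herm_smul_left, herm_smul_left,
        herm_smul_right, herm_smul_right, hN, conj_conj, hxy, hyx]
      ring

theorem localNeighbour_add_smul_eq (hM : IsUnimodular hp M) (hπ : IsUniformizer hp π)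
    {x y : Fin n → E} (hy : y ∈ M) (hxy : herm x y ∈ locIdeal hp 𝔭) :
    localNeighbour hp M π (x + conj E (π : E) • y) = localNeighbour hp M π x := by
  refine (Set.Subset.antisymm ?_ (localNeighbour_add_smul hM hπ hy hxy))
  have h := localNeighbour_add_smul hM hπ (x := x + conj E (π : E) • y) (neg_mem hy) ?_
  · simpa using h
  · rw [herm_neg_right, herm_add_left, herm_smul_left, conj_conj]
    exact neg_mem (add_mem hxy (mul_mem_locIdeal_right hπ.coe_mem (hM.herm_mem hy hy)))

theorem sup_span_singleton_eq_of_covBy {A B : Submodule (𝓞 E) (Fin n → E)} (h : A ⋖ B)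
    {x : Fin n → E} (hx : x ∈ B) (hx' : x ∉ A) : A ⊔ Submodule.span (𝓞 E) {x} = B := by
  refine (h.eq_or_eq le_sup_left (sup_le h.le ?_)).resolve_left fun h' => hx' ?_
  · rwa [Submodule.span_singleton_le_iff_mem]
  · rw [← h']
    exact Submodule.mem_sup_right (Submodule.mem_span_singleton_self x)

/-- Every neighbour is locally defined by a vector `x`. -/
theorem exists_loc_eq_localNeighbour (hmax : 𝔭.IsMaximal) (hM : IsUnimodular hp (loc hp L))
    (hπ : IsUniformizer hp π) (hL' : L' ∈ neighbours L 𝔭) :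
    ∃ x ∈ loc hp L, (∃ w ∈ loc hp L, herm x w ∉ locIdeal hp 𝔭) ∧
      (∃ s ∈ locRing hp, herm x x = π * conj E π * s) ∧
      (loc hp L' : Set (Fin n → E)) = localNeighbour hp (loc hp L) π x := by
  rw [mem_neighbours_iff hmax] at hL'
  obtain ⟨-, hint', ⟨hcov, hpL⟩, hcov', hpL'⟩ := hL'
  have hπ0 := hπ.coe_ne_zero
  have hπ0' := hπ.conj_ne_zero
  obtain ⟨x', hx', hx'L⟩ : ∃ x' ∈ L', x' ∉ L := by
    by_contra! h
    exact hcov'.ne (inf_eq_right.2 h)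
  have hspan := sup_span_singleton_eq_of_covBy hcov' hx' fun h => hx'L h.1
  have hxL : conj E (π : E) • x' ∈ L := by
    rw [← coe_conjInt, ← int_smul_eq]
    exact hpL' _ (mem_map_conjInt.2 (by simpa using hπ.mem)) _ hx'
  set x := conj E (π : E) • x' with hx
  have hxv : ∀ v, herm x v = π * herm x' v := by
    intro v
    rw [hx, herm_smul_left, conj_conj]
  have hx'x : x' = (conj E (π : E))⁻¹ • x := by
    rw [hx, smul_smul, inv_mul_cancel₀ hπ0', one_smul]
  -- Otherwise x' = π̄⁻¹x pairs M into R, so x' lies in M by self-duality; as 𝔭̄x' ⊆ L, this would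
  -- force x' ∈ L.
  have hprim : ∃ w ∈ loc hp L, herm x w ∉ locIdeal hp 𝔭 := by
    by_contra! h
    have h1 : x' ∈ loc hp L := by
      apply hM.mem_of_herm
      intro w hw
      have h2 := hπ.div_mem (h w hw)
      rwa [hxv, mul_div_cancel_left₀ _ hπ0] at h2
    obtain ⟨s, hs, hsx⟩ := h1
    have hmax' := isMaximal_map_conjInt hmax
    obtain ⟨t, i, hi, hti⟩ : ∃ t, ∃ i ∈ 𝔭.map (conjInt E), t * s + i = 1 :=
      hmax'.exists_inv fun h => hs.2 (mem_map_conjInt.1 h)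
    apply hx'L
    rw [← one_smul (𝓞 E) x', ← hti, add_smul, mul_smul]
    exact add_mem (L.smul_mem _ hsx) (hpL' _ hi _ hx')
  -- If y ∉ L', then L is generated by y and L ∩ L'. Now ⟨x, L ∩ L'⟩ = π⟨x', L ∩ L'⟩ lies in 𝔭
  -- because L' is integral, so x would pair all of L into 𝔭.
  have hL0 : ∀ y ∈ L, herm x y ∈ locIdeal hp 𝔭 → y ∈ L' := by
    intro y hy hxy
    by_contra hyL'
    have hspan' := sup_span_singleton_eq_of_covBy hcov hy fun h => hyL' h.2
    obtain ⟨w, ⟨s, hs, hw⟩, hxw⟩ := hprim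
    rw [← hspan', Submodule.mem_sup] at hw
    obtain ⟨u, hu, y', hy', huy⟩ := hw
    obtain ⟨a, rfl⟩ := Submodule.mem_span_singleton.1 hy'
    have h1 : (s : E) * herm x w ∈ locIdeal hp 𝔭 := by
      rw [← herm_smul_right, ← int_smul_eq, ← huy, herm_add_right, int_smul_eq, herm_smul_right]
      refine add_mem ?_ (mul_mem_locIdeal (coe_mem_locRing _) hxy)
      rw [hxv]
      exact mul_mem_locIdeal_right hπ.coe_mem
        (herm_mem_of_mem_loc hint' (le_loc hx') (le_loc hu.2))
    exact (mem_or_mem_of_mul_mem (coe_mem_locRing s)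
      (hM.herm_mem (le_loc hxL) ⟨s, hs, by
        rw [← hspan', Submodule.mem_sup]; exact ⟨u, hu, _, hy', huy⟩⟩) h1).elim
      (fun h => hs.1 (coe_mem_locIdeal_iff.1 h)) hxw
  refine ⟨x, le_loc hxL, hprim,
    ⟨herm x' x', herm_mem_of_mem_loc hint' (le_loc hx') (le_loc hx'), ?_⟩, ?_⟩
  · rw [hxv, hx, herm_smul_right, mul_assoc]
  ext v
  constructor
  · rintro ⟨s, hs, hv⟩
    rw [← hspan, Submodule.mem_sup] at hv
    obtain ⟨u, hu, y', hy', huy⟩ := hv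
    obtain ⟨a, rfl⟩ := Submodule.mem_span_singleton.1 hy'
    have hs0 := hs.ne_zero
    have hsinv : (s : E)⁻¹ ∈ locRing hp :=
      inv_mem_locRing (coe_mem_locRing s) (fun h => hs.1 (coe_mem_locIdeal_iff.1 h))
        (fun h => hs.2 (coe_mem_locIdeal_iff.1 h))
    refine ⟨(s : E)⁻¹ • u, hM.smul_mem hsinv (le_loc hu.1), ?_, (s : E)⁻¹ * a,
      mul_mem hsinv (coe_mem_locRing a), ?_⟩
    · rw [herm_smul_right, hxv]
      exact mul_mem_locIdeal hsinv (mul_mem_locIdeal_right hπ.coe_mem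
        (herm_mem_of_mem_loc hint' (le_loc hx') (le_loc hu.2)))
    · rw [mul_smul ((s : E)⁻¹ * a), ← hx'x, mul_smul, ← smul_add, ← int_smul_eq, huy,
        int_smul_eq, smul_smul, inv_mul_cancel₀ hs0, one_smul]
  · rintro ⟨y, ⟨s, hs, hy⟩, hxy, r, hr, rfl⟩
    rw [mul_smul, ← hx'x]
    refine add_mem ⟨s, hs, hL0 _ hy ?_⟩ (smul_mem_loc hr (le_loc hx'))
    rw [int_smul_eq, herm_smul_right]
    exact mul_mem_locIdeal (coe_mem_locRing _) hxy

theorem exists_isGood_loc_eq (hmax : 𝔭.IsMaximal) (hM : IsUnimodular hp (loc hp L))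
    (hπ : IsUniformizer hp π) (hT : TraceCondition hp (loc hp L)) (hn : 2 ≤ n)
    (hL' : L' ∈ neighbours L 𝔭) :
    ∃ x, IsGood hp (loc hp L) π x ∧
      (loc hp L' : Set (Fin n → E)) = localNeighbour hp (loc hp L) π x := by
  obtain ⟨x, hx, hprim, hN, h⟩ := exists_loc_eq_localNeighbour hmax hM hπ hL'
  obtain ⟨y, hy, hxy, hgood⟩ := exists_isGood hM hπ hT hn hx hprim hN
  exact ⟨_, hgood, by rw [h, localNeighbour_add_smul_eq hM hπ hy hxy]⟩

/-- A self-dual lattice is maximal among integral ones: the preimage of the localised L' contains M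
and is integral, hence equals M. -/
theorem symm_mem_of_isIsometry (hM : IsUnimodular hp M) (hint : Integral L')
    {g : (Fin n → E) ≃ₗ[E] (Fin n → E)} (hg : IsIsometry g) (h : ∀ v ∈ M, g v ∈ loc hp L') :
    ∀ v ∈ loc hp L', g.symm v ∈ M := by
  intro v hv
  apply hM.mem_of_herm
  intro w hw
  rw [← hg, g.apply_symm_apply]
  exact herm_mem_of_mem_loc hint hv (h w hw)

/-- Locally, `L` is isometric to each of its neighbours. -/
theorem exists_isometry_loc (hp0 : 𝔭 ≠ ⊥) (hM : IsUnimodular hp (loc hp L))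
    (hT : TraceCondition hp (loc hp L)) (hn : 2 ≤ n) (hL' : L' ∈ neighbours L 𝔭) :
    ∃ g : (Fin n → E) ≃ₗ[E] (Fin n → E), IsIsometry g ∧
      (∀ v ∈ loc hp L, g v ∈ loc hp L') ∧ ∀ v ∈ loc hp L', g.symm v ∈ loc hp L := by
  obtain ⟨π, hπ⟩ := exists_isUniformizer hp hp0
  obtain ⟨x, hx, h⟩ := exists_isGood_loc_eq (hp.isMaximal hp0) hM hπ hT hn hL'
  obtain ⟨g, hg, hgM⟩ := exists_isometry_localNeighbour hM hπ hT hx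
  have hgM' : ∀ v ∈ loc hp L, g v ∈ loc hp L' := fun v hv => by
    rw [← SetLike.mem_coe, h]; exact hgM v hv
  exact ⟨g, hg, hgM', symm_mem_of_isIsometry hM hL'.2.1 hg hgM'⟩

/-- Locally, any two neighbours of `L` are conjugate under an isometry which stabilises `L`. -/
theorem exists_isometry_loc_loc (hp0 : 𝔭 ≠ ⊥) (hint : Integral L)
    (hM : IsUnimodular hp (loc hp L))
    (hT : TraceCondition hp (loc hp L)) (hn : 2 ≤ n) (h₁ : L₁ ∈ neighbours L 𝔭)
    (h₂ : L₂ ∈ neighbours L 𝔭) :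
    ∃ g : (Fin n → E) ≃ₗ[E] (Fin n → E), IsIsometry g ∧
      ((∀ v ∈ loc hp L, g v ∈ loc hp L) ∧ ∀ v ∈ loc hp L, g.symm v ∈ loc hp L) ∧
      (∀ v ∈ loc hp L₁, g v ∈ loc hp L₂) ∧ ∀ v ∈ loc hp L₂, g.symm v ∈ loc hp L₁ := by
  obtain ⟨π, hπ⟩ := exists_isUniformizer hp hp0
  obtain ⟨x₁, hx₁, hL₁⟩ := exists_isGood_loc_eq (hp.isMaximal hp0) hM hπ hT hn h₁
  obtain ⟨x₂, hx₂, hL₂⟩ := exists_isGood_loc_eq (hp.isMaximal hp0) hM hπ hT hn h₂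
  obtain ⟨g, hg, hgM, m, hm, hgm⟩ := exists_isometry_of_isGood hM hπ hT hx₁ hx₂
  have hgM' := symm_mem_of_isIsometry hM hint hg hgM
  have hgm' : g.symm x₂ = x₁ + (π * conj E π : E) • (-g.symm m) := by
    rw [smul_neg, ← sub_eq_add_neg, ← map_smul, eq_sub_iff_add_eq, ← map_add, ← hgm,
      g.symm_apply_apply]
  refine ⟨g, hg, ⟨hgM, hgM'⟩, fun v hv => ?_, fun v hv => ?_⟩
  · rw [← SetLike.mem_coe, hL₁] at hv
    rw [← SetLike.mem_coe, hL₂]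
    exact map_localNeighbour hM hπ hx₂.mem hg hgM hm hgm hv
  · rw [← SetLike.mem_coe, hL₂] at hv
    rw [← SetLike.mem_coe, hL₁]
    exact map_localNeighbour hM hπ hx₁.mem hg.symm hgM' (neg_mem (hgM' m hm)) hgm' hv

end Local

/-! ### The condition on traces -/

section Trace

variable {𝔭 : Ideal (𝓞 E)} {hp : 𝔭.IsPrime} {L M : Submodule (𝓞 E) (Fin n → E)}

theorem isTrace_of_trace_eq_one {t : E} (ht : t ∈ locRing hp) (ht1 : t + conj E t = 1)
    (htP : ∀ a ∈ locIdeal hp 𝔭, conj E (t * a) ∈ locIdeal hp 𝔭) :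
    ∀ s ∈ locRing hp, conj E s = s → IsTrace hp s := by
  intro s hs hss
  refine ⟨s * t, mul_mem hs ht, by rw [map_mul, hss, ← mul_add, ht1, mul_one], fun a ha => ?_⟩
  rw [mul_assoc, map_mul, hss]
  exact mul_mem_locIdeal hs (htP a ha)

theorem conj_mem_locIdeal (hc : ∀ a ∈ 𝔭, conjInt E a ∈ 𝔭) :
    ∀ a ∈ locIdeal hp 𝔭, conj E a ∈ locIdeal hp 𝔭 := by
  rintro a ⟨s, hs, b, hb, hx⟩
  exact ⟨_, hs.conj, _, hc b hb, by simp [← hx]⟩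

theorem coe_two : ((2 : 𝓞 E) : E) = 2 := map_ofNat (algebraMap (𝓞 E) E) 2

theorem coe_intCast (m : ℤ) : ((m : 𝓞 E) : E) = m := map_intCast (algebraMap (𝓞 E) E) m

/-- Take a - ā ≠ 0 and divide by the largest power of 2, which is finite as 2 is not a unit. The
element d replaces an explicit √D. -/
theorem exists_conjInt_eq_neg : ∃ d : 𝓞 E, conjInt E d = -d ∧ ¬ (2 : 𝓞 E) ∣ d := by
  obtain ⟨a, ha⟩ : ∃ a : 𝓞 E, conjInt E a ≠ a := by
    by_contra! h
    apply IsCMField.complexConj_ne_one E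
    ext y
    obtain ⟨x, z, -, rfl⟩ := IsFractionRing.div_surjective (A := 𝓞 E) y
    have h' : ∀ x : 𝓞 E, conj E (x : E) = x := fun x => by rw [← coe_conjInt, h]
    change conj E _ = _
    rw [map_div₀, h', h']
    rfl
  have h0 : a - conjInt E a ≠ 0 := sub_ne_zero.2 ha.symm
  have h2 : (2 : 𝓞 E) ≠ 0 := two_ne_zero
  have hu : ¬ IsUnit (2 : 𝓞 E) := by
    intro h
    obtain ⟨b, hb⟩ := h.exists_right_inv
    have hint : IsIntegral ℤ (algebraMap ℚ E (1 / 2)) := by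
      have : (b : E) = algebraMap ℚ E (1 / 2) := by
        have hb' : (2 : E) * b = 1 := by
          rw [← coe_two, ← map_mul, hb, map_one]
        rw [eq_ratCast]
        push_cast
        field_simp
        linear_combination hb'
      rw [← this]
      exact RingOfIntegers.isIntegral_coe b
    obtain ⟨m, hm⟩ := IsIntegrallyClosed.isIntegral_iff.1
      ((isIntegral_algebraMap_iff (algebraMap ℚ E).injective).1 hint)
    have hm' : (m : ℚ) * 2 = 1 := by
      rw [show (m : ℚ) = 1 / 2 from hm]
      norm_num
    have : m * 2 = 1 := by exact_mod_cast hm'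
    omega
  obtain ⟨k, d, hd, hk⟩ := WfDvdMonoid.max_power_factor' h0 hu
  refine ⟨d, ?_, hd⟩
  have h3 : (2 : 𝓞 E) ^ k * conjInt E d = 2 ^ k * -d := by
    have h4 := congrArg (conjInt E) hk
    rw [map_sub, conjInt_conjInt, map_mul, map_pow, map_ofNat] at h4
    rw [← h4, mul_neg, ← hk]
    ring
  exact mul_left_cancel₀ (pow_ne_zero k h2) h3

theorem two_dvd_int_of_mem (h2 : (2 : 𝓞 E) ∈ 𝔭) (hp : 𝔭.IsPrime) {m : ℤ}
    (hm : (m : 𝓞 E) ∈ 𝔭) : 2 ∣ m := by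
  by_contra h
  obtain ⟨k, rfl⟩ := Int.not_even_iff_odd.1 (fun h' => h h'.two_dvd)
  apply (away_one (E := E) hp).1
  have h3 : (1 : 𝓞 E) = ((2 * k + 1 : ℤ) : 𝓞 E) - k * 2 := by push_cast; ring
  rw [h3]
  exact sub_mem hm (𝔭.mul_mem_left _ h2)

/-- Here 2 generates 𝔭 locally. With d̄ = -d and D = d² ∈ ℤ, if D is odd then (d + 1)² ∈ 𝔭, so (d +
1)/2 lies in R and has trace 1. An even D would make d divisible by 2. -/
theorem isTrace_of_inert (hc : ∀ a ∈ 𝔭, conjInt E a ∈ 𝔭) (h2 : (2 : 𝓞 E) ∈ 𝔭)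
    (h2' : (2 : 𝓞 E) ∉ 𝔭 ^ 2) : ∃ t ∈ locRing hp, t + conj E t = 1 := by
  obtain ⟨d, hd, hd2⟩ := exists_conjInt_eq_neg (E := E)
  have hcd : conj E (d : E) = -d := by rw [← coe_conjInt, hd]; simp
  obtain ⟨D, hD⟩ := exists_int_of_conj_eq (a := d ^ 2) (by rw [map_pow, hd]; ring)
  have hdiv : ∀ a ∈ locIdeal hp 𝔭, a / 2 ∈ locRing hp := fun a ha => by
    simpa only [coe_two] using div_mem_locRing (π := (2 : 𝓞 E)) h2 h2' (Or.inr hc) ha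
  by_cases hDe : 2 ∣ D
  · exfalso
    have hdp : d ∈ 𝔭 := by
      apply hp.mem_of_pow_mem 2
      obtain ⟨k, rfl⟩ := hDe
      rw [← hD]
      push_cast
      exact 𝔭.mul_mem_right _ h2
    obtain ⟨s, hs, x, -, hx⟩ := hdiv _ (coe_mem_locIdeal (hp := hp) hdp)
    have hx' : s * d = 2 * x := by
      have : ((s * d : 𝓞 E) : E) = ((2 * x : 𝓞 E) : E) := by
        simp only [map_mul, map_ofNat, ← hx]
        ring
      exact RingOfIntegers.ext this
    -- Local divisibility of d by 2 is made global: m = ss̄ is odd and m²D = 4y² with y² ∈ ℤ, so 4 ∣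
    -- D and (d/2)² is an integer. Thus d/2 is integral, contradicting the choice of d.
    obtain ⟨m, hm⟩ := exists_int_mul_conjInt s
    have hmodd : ¬ 2 ∣ m := by
      rintro ⟨k, rfl⟩
      apply (hs.mul hp hs.conj).1
      rw [← hm]
      push_cast
      exact 𝔭.mul_mem_right _ h2
    set y := conjInt E s * x with hy
    have hy2 : 4 * y ^ 2 = ((m ^ 2 * D : ℤ) : 𝓞 E) := by
      push_cast
      rw [hm, hD, hy]
      linear_combination (-(conjInt E s) ^ 2 * (2 * x + s * d)) * hx'
    obtain ⟨z, hz⟩ := exists_int_of_conj_eq (a := y ^ 2) (by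
      have h4 : (4 : 𝓞 E) ≠ 0 := by
        have : (4 : 𝓞 E) = 2 * 2 := by norm_num
        rw [this]
        exact mul_ne_zero two_ne_zero two_ne_zero
      apply mul_left_cancel₀ h4
      have := congrArg (conjInt E) hy2
      rw [map_mul, map_ofNat, map_intCast] at this
      rw [this, hy2])
    have h4 : 4 * z = m ^ 2 * D := by
      rw [← hz] at hy2
      exact_mod_cast hy2
    have h4D : (4 : ℤ) ∣ D := by
      have hcop : IsCoprime (4 : ℤ) (m ^ 2) := by
        have h22 : IsCoprime (2 : ℤ) m := by
          rwa [Prime.coprime_iff_not_dvd Int.prime_two]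
        have := h22.pow (m := 2) (n := 2)
        norm_num at this
        exact this
      exact hcop.dvd_of_dvd_mul_left ⟨z, h4.symm⟩
    obtain ⟨D', rfl⟩ := h4D
    apply hd2
    have hint : IsIntegral ℤ ((d : E) / 2) := by
      refine IsIntegral.of_pow (n := 2) (by norm_num) ?_
      have : ((d : E) / 2) ^ 2 = algebraMap ℤ E D' := by
        have hD' : ((4 * D' : ℤ) : E) = (d : E) ^ 2 := by
          rw [← coe_intCast, hD]
          simp only [map_pow]
        rw [div_pow, ← hD', eq_intCast]
        push_cast
        ring
      rw [this]
      exact isIntegral_algebraMap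
    obtain ⟨c, hcd⟩ : ∃ c : 𝓞 E, (c : E) = d / 2 := ⟨⟨_, hint⟩, rfl⟩
    refine ⟨c, RingOfIntegers.ext ?_⟩
    simp only [map_mul, hcd, coe_two]
    ring
  · have hdp : d + 1 ∈ 𝔭 := by
      apply hp.mem_of_pow_mem 2
      obtain ⟨k, rfl⟩ := Int.not_even_iff_odd.1 (fun h' => hDe h'.two_dvd)
      have : (d + 1) ^ 2 = (k + 1 + d) * 2 := by
        rw [add_sq, ← hD]
        push_cast
        ring
      rw [this]
      exact 𝔭.mul_mem_left _ h2
    refine ⟨_, hdiv _ (coe_mem_locIdeal (hp := hp) hdp), ?_⟩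
    simp only [map_add, map_one, map_div₀, hcd, map_ofNat]
    ring

/-- One element t of trace 1 with t𝔭 ⊆ 𝔭̄ suffices, since s = Tr(st). For 𝔭 = 𝔭̄ take 1/2, or the
element of the inert case if 2 ∈ 𝔭. Otherwise take t = b̄/(b + b̄) with b ∈ 𝔭 and b̄ ∉ 𝔭. -/
theorem isTrace_of_not_sq_dvd (h : ¬ 𝔭 ^ 2 ∣ Ideal.span {(2 : 𝓞 E)}) :
    ∀ s ∈ locRing hp, conj E s = s → IsTrace hp s := by
  rw [Ideal.dvd_span_singleton] at h
  by_cases hc : ∀ a ∈ 𝔭, conjInt E a ∈ 𝔭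
  · obtain ⟨t, ht, ht1⟩ : ∃ t ∈ locRing hp, t + conj E t = 1 := by
      by_cases h2 : (2 : 𝓞 E) ∈ 𝔭
      · exact isTrace_of_inert hc h2 h
      · have h2' : (2 : E)⁻¹ ∈ locRing hp := by
          refine ⟨2, ⟨h2, by rwa [map_ofNat]⟩, 1, trivial, ?_⟩
          rw [coe_two, mul_inv_cancel₀ two_ne_zero]
          simp only [map_one]
        refine ⟨_, h2', ?_⟩
        rw [map_inv₀, map_ofNat]
        norm_num
    refine isTrace_of_trace_eq_one ht ht1 fun a ha => ?_
    exact conj_mem_locIdeal hc _ (mul_mem_locIdeal ht ha)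
  · push Not at hc
    obtain ⟨b, hb, hb'⟩ := hc
    set a := conjInt E b with ha
    have hab : conjInt E a = b := by simp [ha]
    have hu : a + b ∉ 𝔭 := fun h' => hb' ((𝔭.add_mem_iff_left hb).1 h')
    have hcu : conjInt E (a + b) = a + b := by rw [map_add, hab, ← ha, add_comm]
    have hu' : Away 𝔭 (a + b) := ⟨hu, by rwa [hcu]⟩
    have hinv : ((a + b : 𝓞 E) : E)⁻¹ ∈ locRing hp :=
      ⟨a + b, hu', 1, trivial, by rw [mul_inv_cancel₀ hu'.ne_zero]; simp⟩
    have hcu' : conj E ((a + b : 𝓞 E) : E) = ((a + b : 𝓞 E) : E) := by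
      rw [← coe_conjInt, hcu]
    have hca : conj E (a : E) = b := by rw [← coe_conjInt, hab]
    refine isTrace_of_trace_eq_one (t := a * ((a + b : 𝓞 E) : E)⁻¹)
      (mul_mem (coe_mem_locRing _) hinv) ?_ fun x hx => ?_
    · rw [map_mul, map_inv₀, hcu', hca, ← add_mul]
      have : (a : E) + b = ((a + b : 𝓞 E) : E) := by simp
      rw [this, mul_inv_cancel₀ hu'.ne_zero]
    · rw [map_mul, map_mul, hca]
      exact mul_mem_locIdeal_right (mul_mem_locIdeal_right (coe_mem_locIdeal hb)
        (conj_mem_locRing hinv)) (conj_mem_locRing (locIdeal_le hx))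

/-! #### Ramified primes above `2` -/

/-- The ideal (2) has norm 4, leaving no room for a larger residue field or a further factor. -/
theorem absNorm_eq_two_and_sq_eq (hp : 𝔭.IsPrime) (h : 𝔭 ^ 2 ∣ Ideal.span {(2 : 𝓞 E)}) :
    Ideal.absNorm 𝔭 = 2 ∧ 𝔭 ^ 2 = Ideal.span {(2 : 𝓞 E)} := by
  obtain ⟨K, hK⟩ := h
  have hnorm : Ideal.absNorm (Ideal.span {(2 : 𝓞 E)}) = 4 := by
    rw [Ideal.absNorm_span_singleton]
    have : (2 : 𝓞 E) = algebraMap ℤ (𝓞 E) 2 := by simp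
    rw [this, Algebra.norm_algebraMap, RingOfIntegers.rank,
      Algebra.IsQuadraticExtension.finrank_eq_two ℚ E]
    norm_num
  have h1 : Ideal.absNorm 𝔭 ^ 2 * Ideal.absNorm K = 4 := by
    rw [← map_pow, ← map_mul, ← hK, hnorm]
  have hne : Ideal.absNorm 𝔭 ≠ 1 := fun h => hp.ne_top (Ideal.absNorm_eq_one_iff.1 h)
  have hle : Ideal.absNorm 𝔭 ≤ 2 := by
    by_contra! h3
    have : Ideal.absNorm K ≠ 0 := by intro h0; rw [h0] at h1; simp at h1
    have : 1 ≤ Ideal.absNorm K := Nat.one_le_iff_ne_zero.2 this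
    nlinarith
  have h2 : Ideal.absNorm 𝔭 = 2 := by
    interval_cases h : Ideal.absNorm 𝔭
    · simp at h1
    · exact absurd rfl hne
    · rfl
  refine ⟨h2, ?_⟩
  have hK1 : Ideal.absNorm K = 1 := by rw [h2] at h1; omega
  rw [hK, Ideal.absNorm_eq_one_iff.1 hK1, Ideal.mul_top]

theorem mem_or_sub_one_mem (h : Ideal.absNorm 𝔭 = 2) (a : 𝓞 E) : a ∈ 𝔭 ∨ a - 1 ∈ 𝔭 := by
  rw [Ideal.absNorm_apply, Submodule.cardQuot_apply] at h
  obtain ⟨y, hy, hyu⟩ := (Nat.card_eq_two_iff' (0 : 𝓞 E ⧸ 𝔭)).1 h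
  by_cases ha : a ∈ 𝔭
  · exact Or.inl ha
  right
  have h1 := hyu (Ideal.Quotient.mk 𝔭 a) (fun h0 => ha (Ideal.Quotient.eq_zero_iff_mem.1 h0))
  have h2 := hyu (Ideal.Quotient.mk 𝔭 1) (fun h0 =>
    ha (by simpa using 𝔭.mul_mem_left a (Ideal.Quotient.eq_zero_iff_mem.1 h0)))
  rw [← Ideal.Quotient.eq_zero_iff_mem, map_sub, h1, h2, sub_self]

/-- Any β ∈ B outside 𝔭B generates locally: some z ∈ B⁻¹ has βz ∉ 𝔭, and x/β = xz/(βz). -/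
theorem exists_local_generator (hp : 𝔭.IsPrime) (hc : ∀ a ∈ 𝔭, conjInt E a ∈ 𝔭)
    {B : FractionalIdeal (𝓞 E)⁰ E} (hB : B ≠ 0) :
    ∃ β ∈ B, β ≠ 0 ∧ ∀ x ∈ B, x / β ∈ locRing hp := by
  have h1 : ¬ B ≤ (𝔭 : FractionalIdeal (𝓞 E)⁰ E) * B := by
    intro h
    have h2 : B * B⁻¹ ≤ (𝔭 : FractionalIdeal (𝓞 E)⁰ E) * B * B⁻¹ := by gcongr
    rw [mul_assoc, mul_inv_cancel₀ hB, mul_one] at h2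
    have h3 : (1 : E) ∈ (𝔭 : FractionalIdeal (𝓞 E)⁰ E) := h2 (FractionalIdeal.one_mem_one _)
    obtain ⟨x, hx, hx1⟩ := (FractionalIdeal.mem_coeIdeal _).1 h3
    have : x = 1 := RingOfIntegers.ext (by simpa using hx1)
    exact (away_one hp).1 (this ▸ hx)
  obtain ⟨β, hβ, hβ'⟩ := SetLike.not_le_iff_exists.1 h1
  have hβ0 : β ≠ 0 := by
    rintro rfl
    exact hβ' ((𝔭 : FractionalIdeal (𝓞 E)⁰ E) * B : FractionalIdeal (𝓞 E)⁰ E).1.zero_mem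
  obtain ⟨z, hz, s, hs, hsz⟩ : ∃ z ∈ B⁻¹, ∃ s : 𝓞 E, s ∉ 𝔭 ∧ (s : E) = β * z := by
    by_contra! hcon
    apply hβ'
    have h2 : FractionalIdeal.spanSingleton (𝓞 E)⁰ β * B⁻¹ ≤
        (𝔭 : FractionalIdeal (𝓞 E)⁰ E) := by
      rw [FractionalIdeal.spanSingleton_mul_le_iff]
      intro z hz
      have h3 := (FractionalIdeal.mem_inv_iff hB).1 hz β hβ
      obtain ⟨s, hs⟩ := (FractionalIdeal.mem_one_iff _).1 h3
      rw [mul_comm] at hs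
      refine (FractionalIdeal.mem_coeIdeal _).2 ⟨s, ?_, hs⟩
      by_contra hsp
      exact hcon z hz s hsp hs
    have h4 : FractionalIdeal.spanSingleton (𝓞 E)⁰ β * B⁻¹ * B ≤
        (𝔭 : FractionalIdeal (𝓞 E)⁰ E) * B := by gcongr
    rw [mul_assoc, inv_mul_cancel₀ hB, mul_one] at h4
    exact h4 (FractionalIdeal.mem_spanSingleton_self _ _)
  refine ⟨β, hβ, hβ0, fun x hx => ?_⟩
  have h3 := (FractionalIdeal.mem_inv_iff hB).1 hz x hx
  obtain ⟨t, ht⟩ := (FractionalIdeal.mem_one_iff _).1 h3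
  refine ⟨s, ⟨hs, fun h => hs (by simpa using hc _ h)⟩, t, trivial, ?_⟩
  refine Eq.trans ?_ ht.symm
  rw [hsz]
  field_simp

theorem exists_local_basis (hc : ∀ a ∈ 𝔭, conjInt E a ∈ 𝔭)
    (hdisc : ¬ discr L ≤ (𝔭 : FractionalIdeal (𝓞 E)⁰ E)) :
    ∃ e : Module.Basis (Fin n) E (Fin n → E), (∀ i, e i ∈ loc hp L) ∧
      ∀ v ∈ loc hp L, ∀ i, e.repr v i ∈ locRing hp := by
  obtain ⟨I, ⟨hI0, -, b, A, hA, -, hL⟩, -⟩ := exists_decomposition hdisc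
  have hB : ∀ i, A i * I i ≠ 0 := fun i => mul_ne_zero (hA i) (hI0 i)
  choose β hβ hβ0 hβR using fun i => exists_local_generator hp hc (hB i)
  refine ⟨b.isUnitSMul fun i => (hβ0 i).isUnit, fun i => le_loc ?_, ?_⟩
  · rw [Module.Basis.isUnitSMul_apply, hL]
    intro j
    rw [map_smul, Module.Basis.repr_self, Finsupp.smul_apply, Finsupp.single_apply]
    split_ifs with hj
    · subst hj; simpa using hβ i
    · have h0 : (0 : E) ∈ A j * I j :=
        ((A j * I j : FractionalIdeal (𝓞 E)⁰ E) : Submodule (𝓞 E) E).zero_mem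
      simpa using h0
  · rintro v ⟨s, hs, hv⟩ i
    rw [Module.Basis.repr_isUnitSMul]
    have h1 := hβR i _ ((hL _).1 hv i)
    rw [int_smul_eq, map_smul, Finsupp.smul_apply, smul_eq_mul] at h1
    obtain ⟨t, ht, x, -, hx⟩ := h1
    refine ⟨t * s, ht.mul hp hs, x, trivial, ?_⟩
    rw [← hx, Units.smul_def, smul_eq_mul, Units.val_inv_eq_inv_val]
    simp only [map_mul, IsUnit.unit_spec]
    ring

/-- The computation is over ℤ, where 2 can be cancelled. Alternating matrices over 𝔽₂ lift to the
form A - Aᵀ. -/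
theorem det_sub_transpose_eq_zero (hn : Odd n) (A : Matrix (Fin n) (Fin n) ℤ) :
    (A - A.transpose).det = 0 := by
  have h1 : (A - A.transpose).transpose = -(A - A.transpose) := by
    rw [Matrix.transpose_sub, Matrix.transpose_transpose, neg_sub]
  have h2 := Matrix.det_transpose (A - A.transpose)
  rw [h1, Matrix.det_neg, Fintype.card_fin, hn.neg_one_pow] at h2
  linarith

/-- Modulo 𝔭 conjugation is trivial and the residue field is 𝔽₂, so the form b is symmetric bilinear
and the norm is linear, equal to b(y,·). If b(y,y) = 0, then b(u,v) + b(u,y)b(y,v) is alternating,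
hence degenerate in odd dimension, and a vector of its radical lies in the radical of b, which is
zero. -/
theorem isOddDyadic_loc (hn : Odd n) (hM : IsUnimodular hp (loc hp L))
    (h : 𝔭 ^ 2 ∣ Ideal.span {(2 : 𝓞 E)})
    (hdisc : ¬ discr L ≤ (𝔭 : FractionalIdeal (𝓞 E)⁰ E)) : IsOddDyadic hp (loc hp L) := by
  obtain ⟨hnorm, hsq⟩ := absNorm_eq_two_and_sq_eq hp h
  have h2 : (2 : 𝓞 E) ∈ 𝔭 := by
    apply Ideal.pow_le_self two_ne_zero
    rw [hsq]
    exact Ideal.mem_span_singleton_self _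
  have h2E : (2 : E) ∈ locIdeal hp 𝔭 := by simpa only [coe_two] using coe_mem_locIdeal (hp := hp) h2
  have hc : ∀ a ∈ 𝔭, conjInt E a ∈ 𝔭 := by
    intro a ha
    have h1 := Ideal.pow_mem_pow ha 2
    rw [hsq] at h1
    obtain ⟨b, hb⟩ := Ideal.mem_span_singleton'.1 h1
    apply hp.mem_of_pow_mem 2
    rw [← map_pow, ← hb, map_mul, map_ofNat]
    exact 𝔭.mul_mem_left _ h2
  have hcE := conj_mem_locIdeal (hp := hp) hc
  have hres : ∀ a ∈ locRing hp, a ∈ locIdeal hp 𝔭 ∨ a - 1 ∈ locIdeal hp 𝔭 := by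
    rintro a ⟨s, hs, b, -, hb⟩
    rcases mem_or_sub_one_mem hnorm b with hb' | hb'
    · exact Or.inl ⟨s, hs, b, hb', hb⟩
    · refine Or.inr ⟨s, hs, (b - 1) - (s - 1), sub_mem hb'
        ((mem_or_sub_one_mem hnorm s).resolve_left hs.1), ?_⟩
      simp only [map_sub, ← hb]
      ring
  have hsub : ∀ a ∈ locRing hp, conj E a - a ∈ locIdeal hp 𝔭 ∧
      conj E a * a - a ∈ locIdeal hp 𝔭 := by
    intro a ha
    have ha' := conj_mem_locRing ha
    rcases hres a ha with h1 | h1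
    · exact ⟨sub_mem (hcE _ h1) h1, sub_mem (mul_mem_locIdeal ha' h1) h1⟩
    · have h3 := hcE _ h1
      rw [map_sub, map_one] at h3
      constructor
      · have : conj E a - a = (conj E a - 1) - (a - 1) := by ring
        rw [this]
        exact sub_mem h3 h1
      · have : conj E a * a - a = a * (conj E a - 1) := by ring
        rw [this]
        exact mul_mem_locIdeal ha h3
  have htr : ∀ a ∈ locRing hp, a + conj E a ∈ locIdeal hp 𝔭 := by
    intro a ha
    have : a + conj E a = a * 2 + (conj E a - a) := by ring
    rw [this]
    exact add_mem (mul_mem_locIdeal ha h2E) (hsub a ha).1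
  obtain ⟨e, he, heR⟩ := exists_local_basis (hp := hp) hc hdisc
  choose f hf using fun i => exists_herm_eq (e.coord i)
  have hfM : ∀ i, f i ∈ loc hp L := fun i => hM.mem_of_herm fun w hw => by
    rw [hf]
    exact heR w hw i
  have hNe : ∀ i, herm (e i) (e i) ∈ locRing hp := fun i => hM.herm_mem (he i) (he i)
  -- With f the dual basis of e, this y pairs with each eᵢ to the norm of eᵢ. Additivity of the norm
  -- modulo 𝔭 extends the congruence to all of M.
  set y : Fin n → E := ∑ i, herm (e i) (e i) • f i with hy
  have hyM : y ∈ loc hp L := sum_mem fun i _ => hM.smul_mem (hNe i) (hfM i)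
  have hsumr : ∀ (u : Fin n → E) (s : Finset (Fin n)) (g : Fin n → Fin n → E),
      herm u (∑ i ∈ s, g i) = ∑ i ∈ s, herm u (g i) := by
    intro u s g
    let F : (Fin n → E) →+ E := ⟨⟨herm u, herm_zero_right u⟩, herm_add_right u⟩
    exact map_sum F g s
  have hyv : ∀ v, herm y v = ∑ i, herm (e i) (e i) * e.repr v i := by
    intro v
    rw [← conj_herm, hy, hsumr, map_sum]
    refine Finset.sum_congr rfl fun i _ => ?_
    rw [conj_herm, herm_smul_left, conj_herm, hf, Module.Basis.coord_apply]
  have hye : ∀ i, herm y (e i) = herm (e i) (e i) := by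
    intro i
    rw [hyv, Finset.sum_eq_single i]
    · simp
    · intro j _ hj
      simp [hj.symm]
    · simp
  have hsum : ∀ v, v = ∑ i, e.repr v i • e i := fun v => (e.sum_repr v).symm
  have hchar : ∀ v ∈ loc hp L, herm y v - herm v v ∈ locIdeal hp 𝔭 := by
    intro v hv
    have key : v ∈ loc hp L ∧ herm y v - herm v v ∈ locIdeal hp 𝔭 := by
      rw [hsum v]
      refine Finset.sum_induction (fun i => e.repr v i • e i)
        (fun u => u ∈ loc hp L ∧ herm y u - herm u u ∈ locIdeal hp 𝔭) ?_ ?_ ?_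
      · rintro u w ⟨hu, hu'⟩ ⟨hw, hw'⟩
        refine ⟨add_mem hu hw, ?_⟩
        have h3 := htr _ (hM.herm_mem hu hw)
        rw [conj_herm] at h3
        have : herm y (u + w) - herm (u + w) (u + w) = (herm y u - herm u u) +
            (herm y w - herm w w) - (herm u w + herm w u) := by
          simp only [herm_add_left, herm_add_right]
          ring
        rw [this]
        exact sub_mem (add_mem hu' hw') h3
      · exact ⟨zero_mem _, by simp⟩
      · intro i _
        have hr := heR v hv i
        refine ⟨hM.smul_mem hr (he i), ?_⟩
        rw [herm_smul_right, herm_smul_left, herm_smul_right, hye]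
        have : e.repr v i * herm (e i) (e i) - conj E (e.repr v i) *
            (e.repr v i * herm (e i) (e i)) =
            -(herm (e i) (e i) * (conj E (e.repr v i) * e.repr v i - e.repr v i)) := by ring
        rw [this]
        exact neg_mem (mul_mem_locIdeal (hNe i) (hsub _ hr).2)
    exact key.2
  refine ⟨hcE, h2E, hres, ?_, y, hyM, ?_, hchar⟩
  · rintro s ⟨t, ht, b, hb, hbs⟩ hss
    -- Up to the self-conjugate factor tt̄, s is a rational integer in 𝔭, hence even. So s = s/2 +
    -- s/2 is a trace.
    obtain ⟨k, hk⟩ := exists_int_of_conj_eq (a := conjInt E t * b) (by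
      have : ((conjInt E (conjInt E t * b) : 𝓞 E) : E) = ((conjInt E t * b : 𝓞 E) : E) := by
        simp only [map_mul, conjInt_conjInt, coe_conjInt, ← hbs, hss]
        ring
      exact RingOfIntegers.ext this)
    obtain ⟨j, rfl⟩ := two_dvd_int_of_mem h2 hp (m := k) (by
      rw [hk]; exact 𝔭.mul_mem_left _ hb)
    have hs2 : s / 2 ∈ locRing hp := by
      refine ⟨t * conjInt E t, ht.mul hp ht.conj, (j : 𝓞 E), trivial, ?_⟩
      have h3 : ((2 * j : ℤ) : E) = conj E t * b := by
        rw [← coe_intCast, hk]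
        simp only [map_mul, coe_conjInt]
      have h4 : (2 : E) * j = conj E t * (t * s) := by
        rw [hbs, ← h3]; push_cast; ring
      simp only [map_mul, coe_conjInt, coe_intCast]
      linear_combination (-(1 / 2 : E)) * h4
    refine ⟨_, hs2, ?_, fun a ha => hcE _ (mul_mem_locIdeal hs2 ha)⟩
    rw [map_div₀, hss, map_ofNat]
    ring
  · intro hyy
    -- Modulo 𝔭 this Gram matrix is alternating: with N = ⟨eᵢ,eᵢ⟩ its diagonal entries are N + N̄N ≡
    -- 2N ≡ 0.
    set G : Fin n → Fin n → E := fun i j => herm (e i) (e j) + herm (e i) y * herm y (e j) with hG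
    have hGR : ∀ i j, G i j ∈ locRing hp := fun i j =>
      add_mem (hM.herm_mem (he i) (he j))
        (mul_mem (hM.herm_mem (he i) hyM) (hM.herm_mem hyM (he j)))
    have hlift : ∀ a ∈ locRing hp, ∃ k : ℤ, a - k ∈ locIdeal hp 𝔭 := by
      intro a ha
      rcases hres a ha with h3 | h3
      · exact ⟨0, by simpa using h3⟩
      · exact ⟨1, by simpa using h3⟩
    choose k hk using fun i j => hlift _ (hGR i j)
    -- The integral lift of the upper triangle of G; A - Aᵀ is then congruent to G.
    let A : Matrix (Fin n) (Fin n) ℤ := fun i j => if i < j then k i j else 0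
    have hAij : ∀ i j, (A - A.transpose) i j =
        (if i < j then k i j else 0) - if j < i then k j i else 0 := fun _ _ => rfl
    have hA : ∀ i j, G i j - ((A - A.transpose) i j : ℤ) ∈ locIdeal hp 𝔭 := by
      intro i j
      rcases lt_trichotomy i j with hij | rfl | hij
      · simpa [hAij, hij, hij.not_gt] using hk i j
      · have h3 := (hsub _ (hNe i)).2
        have h4 : G i i = herm (e i) (e i) * 2 +
            (conj E (herm (e i) (e i)) * herm (e i) (e i) - herm (e i) (e i)) := by
          rw [hG]
          simp only [hye]
          rw [← conj_herm y (e i), hye]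
          ring
        simp only [Matrix.sub_apply, Matrix.transpose_apply, sub_self, Int.cast_zero, sub_zero]
        rw [h4]
        exact add_mem (mul_mem_locIdeal (hNe i) h2E) h3
      · have h3 : G i j = conj E (G j i) := by
          simp only [hG, map_add, map_mul, conj_herm]
          ring
        have h4 : G i j - ((A - A.transpose) i j : ℤ) =
            (conj E (G j i) - G j i) + (G j i - k j i) + k j i * 2 := by
          rw [h3]
          simp only [hAij, hij, hij.not_gt, if_true, if_false]
          push_cast
          ring
        rw [h4]
        refine add_mem (add_mem (hsub _ (hGR j i)).1 (hk j i)) (mul_mem_locIdeal ?_ h2E)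
        exact intCast_mem (locRing hp) _
    have hdet : ((A - A.transpose).map (Int.castRingHom (ZMod 2))).det = 0 := by
      have h3 := (Int.castRingHom (ZMod 2)).map_det (A - A.transpose)
      rw [det_sub_transpose_eq_zero hn, map_zero] at h3
      exact h3.symm
    obtain ⟨c, hc0, hAc⟩ := Matrix.exists_mulVec_eq_zero_iff.2 hdet
    obtain ⟨i₀, hi₀⟩ := Function.ne_iff.1 hc0
    set w : Fin n → E := ∑ j, ((c j).val : E) • e j with hw
    have hwM : w ∈ loc hp L :=
      sum_mem fun j _ => hM.smul_mem (natCast_mem (locRing hp) _) (he j)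
    have hGw : ∀ i, herm (e i) w + herm (e i) y * herm y w ∈ locIdeal hp 𝔭 := by
      intro i
      have h3 : herm (e i) w + herm (e i) y * herm y w = ∑ j, ((c j).val : E) * G i j := by
        rw [hw, hsumr, hsumr y, Finset.mul_sum, ← Finset.sum_add_distrib]
        refine Finset.sum_congr rfl fun j _ => ?_
        simp only [hG, herm_smul_right]
        ring
      have h4 : ((∑ j, (A - A.transpose) i j * ((c j).val : ℤ) : ℤ) : ZMod 2) = 0 := by
        have h5 := congrFun hAc i
        simp only [Matrix.mulVec, dotProduct, Matrix.map_apply, Pi.zero_apply] at h5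
        rw [← h5]
        push_cast
        refine Finset.sum_congr rfl fun j _ => ?_
        simp
      obtain ⟨m, hm⟩ := (ZMod.intCast_zmod_eq_zero_iff_dvd _ 2).1 h4
      have h6 : ∑ j, ((c j).val : E) * G i j = (∑ j, ((c j).val : E) *
          (G i j - ((A - A.transpose) i j : ℤ))) + m * 2 := by
        have h7 : (∑ j, ((A - A.transpose) i j : E) * ((c j).val : E)) = m * 2 := by
          have := congrArg (Int.cast : ℤ → E) hm
          push_cast at this
          rw [mul_comm (m : E), ← this]
        rw [← h7, ← Finset.sum_add_distrib]
        refine Finset.sum_congr rfl fun j _ => ?_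
        ring
      rw [h3, h6]
      refine add_mem (sum_mem fun j _ => mul_mem_locIdeal (natCast_mem (locRing hp) _) (hA i j))
        (mul_mem_locIdeal (intCast_mem (locRing hp) _) h2E)
    have hall : ∀ v ∈ loc hp L, herm v w + herm v y * herm y w ∈ locIdeal hp 𝔭 := by
      intro v hv
      have h3 : herm v w + herm v y * herm y w =
          ∑ i, conj E (e.repr v i) * (herm (e i) w + herm (e i) y * herm y w) := by
        have h4 : ∀ u, herm v u = ∑ i, conj E (e.repr v i) * herm (e i) u := by
          intro u
          rw [← conj_herm, hsum v, hsumr, map_sum, ← hsum v]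
          refine Finset.sum_congr rfl fun i _ => ?_
          rw [herm_smul_right, map_mul, conj_herm]
        rw [h4 w, h4 y, Finset.sum_mul, ← Finset.sum_add_distrib]
        refine Finset.sum_congr rfl fun i _ => ?_
        ring
      rw [h3]
      exact sum_mem fun i _ => mul_mem_locIdeal (conj_mem_locRing (heR v hv i)) (hGw i)
    -- Taking v = y and using ⟨y,y⟩ ∈ 𝔭 removes the second term, so w pairs all of M into 𝔭. Pairing
    -- with a dual basis vector recovers a coefficient of w equal to 1.
    have hyw : herm y w ∈ locIdeal hp 𝔭 := by
      have h3 := hall y hyM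
      rwa [AddSubgroup.add_mem_cancel_right _
        (mul_mem_locIdeal_right hyy (hM.herm_mem hyM hwM))] at h3
    have hfw : herm (f i₀) w ∈ locIdeal hp 𝔭 := by
      have h3 := hall (f i₀) (hfM i₀)
      rwa [AddSubgroup.add_mem_cancel_right _
        (mul_mem_locIdeal (hM.herm_mem (hfM i₀) hyM) hyw)] at h3
    have hfw' : herm (f i₀) w = ((c i₀).val : E) := by
      rw [hf, Module.Basis.coord_apply, hw]
      simp [Finsupp.single_apply]
    have hc1 : (c i₀).val = 1 := by
      have h3 : (c i₀).val < 2 := ZMod.val_lt _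
      have h4 : (c i₀).val ≠ 0 := by
        rw [Ne, ZMod.val_eq_zero]
        exact hi₀
      omega
    rw [hfw', hc1, Nat.cast_one] at hfw
    exact one_notMem_locIdeal hfw

theorem traceCondition_loc (hM : IsUnimodular hp (loc hp L))
    (hdisc : ¬ discr L ≤ (𝔭 : FractionalIdeal (𝓞 E)⁰ E))
    (hram : Odd n ∨ ¬ 𝔭 ^ 2 ∣ Ideal.span {(2 : 𝓞 E)}) : TraceCondition hp (loc hp L) := by
  by_cases h : 𝔭 ^ 2 ∣ Ideal.span {(2 : 𝓞 E)}
  · exact Or.inr (isOddDyadic_loc (hram.resolve_right (not_not.2 h)) hM h hdisc)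
  · exact Or.inl (isTrace_of_not_sq_dvd h)

end Trace

/-! ### The rings `ℚ̂` and `ℤ̂` -/

section Adeles

theorem QHat.add_apply (x y : QHat) (v : HeightOneSpectrum ℤ) : (x + y) v = x v + y v := rfl

theorem QHat.sub_apply (x y : QHat) (v : HeightOneSpectrum ℤ) : (x - y) v = x v - y v := rfl

theorem QHat.mul_apply (x y : QHat) (v : HeightOneSpectrum ℤ) : (x * y) v = x v * y v := rfl

theorem QHat.one_apply (v : HeightOneSpectrum ℤ) : (1 : QHat) v = 1 := rfl

theorem QHat.valued_algebraMap (r : ℚ) (v : HeightOneSpectrum ℤ) :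
    Valued.v ((algebraMap ℚ QHat r) v) = v.valuation ℚ r := by
  rw [FiniteAdeleRing.algebraMap_apply, HeightOneSpectrum.valuedAdicCompletion_eq_valuation']

theorem valuation_intCast_le_one (v : HeightOneSpectrum ℤ) (m : ℤ) :
    v.valuation ℚ (m : ℚ) ≤ 1 := by
  simpa using v.valuation_le_one (K := ℚ) m

theorem valuation_intCast_eq_one {v : HeightOneSpectrum ℤ} {m : ℤ} (h : m ∉ v.asIdeal) :
    v.valuation ℚ (m : ℚ) = 1 := by
  simpa using (v.valuation_eq_one_iff_notMem (K := ℚ)).2 h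

theorem exists_int_of_algebraMap_mem_ZHat {r : ℚ} (h : algebraMap ℚ QHat r ∈ ZHat) :
    ∃ m : ℤ, (m : ℚ) = r := by
  obtain ⟨m, hm⟩ := HeightOneSpectrum.mem_integers_of_valuation_le_one (R := ℤ) ℚ r fun v => by
    rw [← QHat.valued_algebraMap]
    exact h v
  exact ⟨m, by simpa using hm⟩

theorem intCast_mem_ZHat (m : ℤ) : algebraMap ℚ QHat m ∈ ZHat := by
  rw [map_intCast]
  exact intCast_mem _ _

/-- Density of ℚ in ℚ_v, applied to x/a and the open ring of integers, then scaled by a. -/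
theorem exists_rat_valued_sub_le (x : QHat) (v : HeightOneSpectrum ℤ) {a : ℚ} (ha : a ≠ 0) :
    ∃ r : ℚ, Valued.v ((x - algebraMap ℚ QHat r) v) ≤ v.valuation ℚ a := by
  have ha' : (algebraMap ℚ (v.adicCompletion ℚ) a) ≠ 0 :=
    (map_ne_zero (algebraMap ℚ (v.adicCompletion ℚ))).2 ha
  have hopen : IsOpen {y : v.adicCompletion ℚ |
      x v / algebraMap ℚ (v.adicCompletion ℚ) a - y ∈ v.adicCompletionIntegers ℚ} :=
    (Valued.isOpen_valuationSubring (v.adicCompletion ℚ)).preimage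
      (continuous_const.sub continuous_id)
  obtain ⟨s, hs⟩ := (HeightOneSpectrum.denseRange_algebraMap ℚ v).exists_mem_open hopen
    ⟨x v / algebraMap ℚ (v.adicCompletion ℚ) a, by simp⟩
  refine ⟨a * s, ?_⟩
  have h1 : (x - algebraMap ℚ QHat (a * s)) v = algebraMap ℚ (v.adicCompletion ℚ) a *
      (x v / algebraMap ℚ (v.adicCompletion ℚ) a - algebraMap ℚ (v.adicCompletion ℚ) s) := by
    rw [mul_sub, mul_div_cancel₀ _ ha', ← map_mul]
    rfl
  rw [h1, map_mul]
  have h2 : Valued.v (algebraMap ℚ (v.adicCompletion ℚ) a) = v.valuation ℚ a :=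
    QHat.valued_algebraMap a v
  rw [h2]
  exact mul_le_of_le_one_right' hs

/-- Only finitely many places are bad. At each, the denominator of a rational approximation clears
x, and the product of these denominators serves everywhere. -/
theorem exists_int_mul_mem_ZHat (x : QHat) :
    ∃ m : ℤ, m ≠ 0 ∧ algebraMap ℚ QHat m * x ∈ ZHat := by
  have hfin : {v : HeightOneSpectrum ℤ | ¬ Valued.v (x v) ≤ 1}.Finite :=
    Filter.eventually_cofinite.1 x.2
  have key : ∀ v : HeightOneSpectrum ℤ, ∃ m : ℤ, m ≠ 0 ∧
      Valued.v ((algebraMap ℚ QHat m * x) v) ≤ 1 := by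
    intro v
    obtain ⟨r, hr⟩ := exists_rat_valued_sub_le x v one_ne_zero
    refine ⟨r.den, by simp, ?_⟩
    have h1 : (algebraMap ℚ QHat (r.den : ℤ) * x) v =
        (algebraMap ℚ QHat (r.den : ℤ)) v * (x - algebraMap ℚ QHat r) v +
          (algebraMap ℚ QHat (r.num : ℤ)) v := by
      rw [← QHat.mul_apply, ← QHat.add_apply, mul_sub, ← map_mul]
      congr 1
      have : (((r.den : ℤ) : ℚ)) * r = (r.num : ℤ) := by
        rw [mul_comm]
        exact_mod_cast r.mul_den_eq_num
      rw [this, sub_add_cancel]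
    rw [h1]
    refine (Valued.v.map_add _ _).trans (max_le ?_ ?_)
    · rw [map_mul, QHat.valued_algebraMap]
      rw [map_one] at hr
      exact mul_le_one' (valuation_intCast_le_one _ _) hr
    · rw [QHat.valued_algebraMap]
      exact valuation_intCast_le_one _ _
  choose m hm0 hm using key
  refine ⟨∏ v ∈ hfin.toFinset, m v, Finset.prod_ne_zero_iff.2 fun v _ => hm0 v, fun v => ?_⟩
  rw [HeightOneSpectrum.mem_adicCompletionIntegers]
  by_cases hv : Valued.v (x v) ≤ 1
  · rw [QHat.mul_apply, map_mul, QHat.valued_algebraMap]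
    exact mul_le_one' (valuation_intCast_le_one _ _) hv
  · classical
    rw [← Finset.prod_erase_mul _ _ (hfin.mem_toFinset.2 hv), Int.cast_mul, map_mul, mul_assoc,
      QHat.mul_apply, map_mul, QHat.valued_algebraMap]
    exact mul_le_one' (valuation_intCast_le_one _ _) (hm v)

theorem exists_int_sub_mem_of_prime {p : ℤ} (hp : Prime p) {x : QHat} (hx : x ∈ ZHat) :
    ∃ k : ℤ, ∃ y ∈ ZHat, x = algebraMap ℚ QHat k + algebraMap ℚ QHat p * y := by
  have hp0 : (p : ℚ) ≠ 0 := by exact_mod_cast hp.ne_zero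
  let v : HeightOneSpectrum ℤ := ⟨Ideal.span {p}, (Ideal.span_singleton_prime hp.ne_zero).2 hp,
    by simpa using hp.ne_zero⟩
  have hpv : p ∈ v.asIdeal := Ideal.mem_span_singleton_self p
  obtain ⟨r, hr⟩ := exists_rat_valued_sub_le x v hp0
  have hr1 : v.valuation ℚ r ≤ 1 := by
    have h1 : (algebraMap ℚ QHat r) v = x v - (x - algebraMap ℚ QHat r) v := by
      rw [QHat.sub_apply]; ring
    rw [← QHat.valued_algebraMap, h1]
    exact (Valued.v.map_sub _ _).trans (max_le (hx v) (hr.trans (valuation_intCast_le_one _ _)))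
  have hden : (r.den : ℤ) ∉ v.asIdeal := Rat.valuation_le_one_iff_den.1 hr1
  have hmax : v.asIdeal.IsMaximal := v.isMaximal
  obtain ⟨c, i, hi, hci⟩ := hmax.exists_inv hden
  obtain ⟨t, rfl⟩ := Ideal.mem_span_singleton'.1 hi
  -- As c inverts the denominator of r modulo p, k is an integer congruent to r modulo p.
  set k : ℤ := r.num * c with hk
  have hrk : v.valuation ℚ (r - k) ≤ v.valuation ℚ p := by
    have hd0 : ((r.den : ℤ) : ℚ) ≠ 0 := by simp
    have h1 : r - k = (r.num * t : ℤ) * p / (r.den : ℤ) := by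
      have h2 : (c : ℚ) * (r.den : ℤ) + t * p = 1 := by exact_mod_cast hci
      have h3 : r * (r.den : ℤ) = r.num := by exact_mod_cast r.mul_den_eq_num
      rw [eq_div_iff hd0, hk]
      push_cast at h2 h3 ⊢
      linear_combination h3 - (r.num : ℚ) * h2
    rw [h1, map_div₀, map_mul, valuation_intCast_eq_one hden, div_one]
    exact mul_le_of_le_one_left' (valuation_intCast_le_one _ _)
  have hxk : Valued.v ((x - algebraMap ℚ QHat k) v) ≤ v.valuation ℚ p := by
    have h1 : (x - algebraMap ℚ QHat k) v =
        (x - algebraMap ℚ QHat r) v + (algebraMap ℚ QHat (r - k)) v := by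
      rw [← QHat.add_apply, map_sub]
      congr 1
      ring
    rw [h1]
    refine (Valued.v.map_add _ _).trans (max_le hr ?_)
    rwa [QHat.valued_algebraMap]
  refine ⟨k, algebraMap ℚ QHat (p : ℚ)⁻¹ * (x - algebraMap ℚ QHat k), fun w => ?_, ?_⟩
  · rw [HeightOneSpectrum.mem_adicCompletionIntegers]
    rw [QHat.mul_apply, map_mul, QHat.valued_algebraMap, map_inv₀]
    by_cases hw : p ∈ w.asIdeal
    · have hwv : w = v := by
        apply HeightOneSpectrum.ext
        exact (hmax.eq_of_le w.isPrime.ne_top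
          ((Ideal.span_singleton_le_iff_mem _).2 hw)).symm
      subst hwv
      rw [inv_mul_eq_div]
      exact div_le_one_of_le₀ hxk zero_le
    · rw [valuation_intCast_eq_one hw, inv_one, one_mul]
      exact (sub_mem hx (intCast_mem_ZHat k) : x - algebraMap ℚ QHat k ∈ ZHat) w
  · rw [← mul_assoc, ← map_mul, mul_inv_cancel₀ hp0, map_one, one_mul]
    ring

theorem exists_int_sub_mem {m : ℤ} (hm : m ≠ 0) {x : QHat} (hx : x ∈ ZHat) :
    ∃ k : ℤ, ∃ y ∈ ZHat, x = algebraMap ℚ QHat k + algebraMap ℚ QHat m * y := by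
  induction m using UniqueFactorizationMonoid.induction_on_prime generalizing x with
  | h₁ => exact absurd rfl hm
  | h₂ u hu =>
    obtain ⟨w, hw⟩ := hu.exists_right_inv
    refine ⟨0, algebraMap ℚ QHat w * x, mul_mem (intCast_mem_ZHat w) hx, ?_⟩
    rw [← mul_assoc, ← map_mul, ← Int.cast_mul, hw]
    simp
  | h₃ a p ha hp ih =>
    obtain ⟨k, y, hy, rfl⟩ := exists_int_sub_mem_of_prime hp hx
    obtain ⟨l, z, hz, rfl⟩ := ih ha hy
    refine ⟨k + p * l, z, hz, ?_⟩
    push_cast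
    ring

/-- The idempotent of `ℚ̂` supported at `v`. -/
def idempotentAt (v : HeightOneSpectrum ℤ) : QHat :=
  open Classical in
  ⟨fun w => if w = v then 1 else 0, Filter.Eventually.of_forall fun w => by
    dsimp only
    split_ifs with h
    · exact one_mem (w.adicCompletionIntegers ℚ)
    · exact zero_mem (w.adicCompletionIntegers ℚ)⟩

theorem idempotentAt_apply_self (v : HeightOneSpectrum ℤ) : idempotentAt v v = 1 :=
  if_pos rfl

theorem idempotentAt_apply_of_ne {v w : HeightOneSpectrum ℤ} (h : w ≠ v) :
    idempotentAt v w = 0 :=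
  if_neg h

theorem idempotentAt_mul_self (v : HeightOneSpectrum ℤ) :
    idempotentAt v * idempotentAt v = idempotentAt v := by
  refine FiniteAdeleRing.ext _ fun w => ?_
  rw [QHat.mul_apply]
  by_cases h : w = v
  · subst h; rw [idempotentAt_apply_self, one_mul]
  · rw [idempotentAt_apply_of_ne h, zero_mul]

theorem idempotentAt_mul_inv_mem {v : HeightOneSpectrum ℤ} {m : ℤ} (hm : m ∉ v.asIdeal) :
    idempotentAt v * algebraMap ℚ QHat (m : ℚ)⁻¹ ∈ ZHat := by
  intro w
  rw [HeightOneSpectrum.mem_adicCompletionIntegers]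
  rw [QHat.mul_apply]
  by_cases h : w = v
  · subst h
    rw [idempotentAt_apply_self, one_mul, QHat.valued_algebraMap, map_inv₀,
      valuation_intCast_eq_one hm, inv_one]
  · rw [idempotentAt_apply_of_ne h, zero_mul, map_zero]
    exact zero_le

theorem one_sub_idempotentAt_mul_inv_mem {v : HeightOneSpectrum ℤ} {m : ℤ}
    (hm : ∀ w ≠ v, m ∉ w.asIdeal) :
    (1 - idempotentAt v) * algebraMap ℚ QHat (m : ℚ)⁻¹ ∈ ZHat := by
  intro w
  rw [HeightOneSpectrum.mem_adicCompletionIntegers]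
  rw [QHat.mul_apply, QHat.sub_apply, QHat.one_apply]
  by_cases h : w = v
  · subst h
    rw [idempotentAt_apply_self, sub_self, zero_mul, map_zero]
    exact zero_le
  · rw [idempotentAt_apply_of_ne h, sub_zero, one_mul, QHat.valued_algebraMap, map_inv₀,
      valuation_intCast_eq_one (hm w h), inv_one]

end Adeles

/-! ### Completions of lattices -/

section Completion

variable {L L' : Submodule (𝓞 E) (Fin n → E)} {v w : Fin n → E}

theorem emb_add (v w : Fin n → E) : emb (v + w) = emb v + emb w := by
  funext i
  simp [emb, TensorProduct.tmul_add]

@[simp]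
theorem emb_zero : emb (0 : Fin n → E) = 0 := by
  funext i
  simp [emb]

theorem emb_smul (r : ℚ) (v : Fin n → E) : emb (r • v) = algebraMap ℚ QHat r • emb v := by
  funext i
  simp only [emb, Pi.smul_apply]
  rw [TensorProduct.tmul_smul, algebraMap_smul]

theorem emb_zsmul (m : ℤ) (v : Fin n → E) : emb (m • v) = algebraMap ℚ QHat m • emb v := by
  rw [← emb_smul, Int.cast_smul_eq_zsmul]

theorem emb_int_smul (a : 𝓞 E) (v : Fin n → E) :
    emb (a • v) = ((1 : QHat) ⊗ₜ[ℚ] (a : E)) • emb v := by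
  funext i
  simp [emb, Algebra.smul_def]

theorem smul_mem_of_mem_ZHat {Λ : Submodule ZHat (Fin n → QHat ⊗[ℚ] E)} {c : QHat} (hc : c ∈ ZHat)
    {x : Fin n → QHat ⊗[ℚ] E} (hx : x ∈ Λ) : c • x ∈ Λ :=
  Λ.smul_mem (⟨c, hc⟩ : ZHat) hx

theorem algebraMap_smul_injective {m : ℤ} (hm : m ≠ 0) {x y : Fin n → QHat ⊗[ℚ] E}
    (h : algebraMap ℚ QHat m • x = algebraMap ℚ QHat m • y) : x = y := by
  have hm' : (m : ℚ) ≠ 0 := by exact_mod_cast hm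
  have h1 := congrArg (algebraMap ℚ QHat (m : ℚ)⁻¹ • ·) h
  simpa only [smul_smul, ← map_mul, inv_mul_cancel₀ hm', map_one, one_smul] using h1

theorem emb_mem_completion (hv : v ∈ L) : emb v ∈ completion L :=
  Submodule.subset_span ⟨v, hv, rfl⟩

theorem completion_mono (h : L ≤ L') : completion L ≤ completion L' :=
  Submodule.span_mono (Set.image_mono h)

/-- The extension of a linear functional on `E ^ n` to the adelic points. -/
def adelicFunctional (f : (Fin n → E) →ₗ[ℚ] ℚ) : (Fin n → QHat ⊗[ℚ] E) →ₗ[QHat] QHat :=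
  ∑ i, ((TensorProduct.AlgebraTensorModule.rid ℚ QHat QHat).toLinearMap ∘ₗ
    LinearMap.baseChange QHat (f ∘ₗ LinearMap.single ℚ (fun _ => E) i)) ∘ₗ
      LinearMap.proj i

theorem adelicFunctional_emb (f : (Fin n → E) →ₗ[ℚ] ℚ) (v : Fin n → E) :
    adelicFunctional f (emb v) = algebraMap ℚ QHat (f v) := by
  conv_rhs => rw [← Finset.univ_sum_single v, map_sum, map_sum]
  simp [adelicFunctional, emb, Algebra.smul_def]

theorem exists_int_smul_mem (hL : L.IsLattice E) (v : Fin n → E) :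
    ∃ m : ℤ, m ≠ 0 ∧ m • v ∈ L := by
  obtain ⟨a, ha, hav⟩ := exists_smul_mem hL v
  obtain ⟨m, hm⟩ := exists_int_mul_conjInt a
  refine ⟨m, ?_, ?_⟩
  · rintro rfl
    rw [Int.cast_zero, eq_comm, mul_eq_zero] at hm
    exact hm.elim ha (by simpa using ha)
  · rw [← Int.cast_smul_eq_zsmul (𝓞 E), hm, mul_comm, mul_smul]
    exact L.smul_mem _ hav

/-- The coordinates for a ℤ-basis of L extend to ℚ̂-linear functionals taking values in ℤ̂ on the
completion. On rational vectors their values are thus in ℚ ∩ ℤ̂ = ℤ. -/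
theorem emb_mem_completion_iff (hL : L.IsLattice E) : emb v ∈ completion L ↔ v ∈ L := by
  refine ⟨fun hv => ?_, emb_mem_completion⟩
  let Λ : Submodule ℤ (Fin n → E) := L.restrictScalars ℤ
  have hfin : Module.Finite (𝓞 E) L := Module.Finite.iff_fg.2 hL.fg
  have hfin' : Module.Finite ℤ Λ := Module.Finite.trans (R := ℤ) (𝓞 E) L
  have hfree : Module.Free ℤ Λ := inferInstance
  let b := Module.Free.chooseBasis ℤ Λ
  let u : Module.Free.ChooseBasisIndex ℤ Λ → Fin n → E := fun j => (b j : Fin n → E)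
  have hu : LinearIndependent ℤ u := b.linearIndependent.map' Λ.subtype Λ.ker_subtype
  have hu' : LinearIndependent ℚ u := (LinearIndependent.iff_fractionRing ℤ ℚ).1 hu
  let c := Module.Basis.span hu'
  choose f hf using fun j => (c.coord j).exists_extend
  have hfu : ∀ j i, f j (u i) = if i = j then 1 else 0 := by
    intro j i
    have h1 : (c i : Fin n → E) = u i := congrArg Subtype.val (Module.Basis.span_apply hu' i)
    rw [← h1]
    have h2 := LinearMap.congr_fun (hf j) (c i)
    simp only [LinearMap.comp_apply, Submodule.subtype_apply, Module.Basis.coord_apply,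
      Module.Basis.repr_self, Finsupp.single_apply] at h2
    exact h2
  have hsum : ∀ w (hw : w ∈ L), w = ∑ i, (b.repr ⟨w, hw⟩ i) • u i := by
    intro w hw
    have h1 := congrArg Λ.subtype (b.sum_repr ⟨w, hw⟩)
    rw [map_sum] at h1
    exact h1.symm
  have hfL : ∀ j, ∀ w (hw : w ∈ L), f j w = b.repr ⟨w, hw⟩ j := by
    intro j w hw
    conv_lhs => rw [hsum w hw]
    simp only [map_sum, map_zsmul, hfu]
    simp
  have hfv : ∀ j, ∀ x ∈ completion L, adelicFunctional (f j) x ∈ ZHat := by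
    intro j x hx
    induction hx using Submodule.span_induction with
    | mem x hx =>
      obtain ⟨w, hw, rfl⟩ := hx
      rw [adelicFunctional_emb, hfL j w hw]
      exact intCast_mem_ZHat _
    | zero => rw [map_zero]; exact zero_mem _
    | add x y _ _ hx hy => rw [map_add]; exact add_mem hx hy
    | smul c x _ hx =>
      have h1 : c • x = (c : QHat) • x := rfl
      rw [h1, map_smul, smul_eq_mul]
      exact mul_mem c.2 hx
  choose l hl using fun j => exists_int_of_algebraMap_mem_ZHat
    (adelicFunctional_emb (f j) v ▸ hfv j _ hv)
  obtain ⟨m, hm, hmv⟩ := exists_int_smul_mem hL v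
  have hv' : v = ∑ j, l j • u j := by
    have h1 : m • v = m • ∑ j, l j • u j := by
      rw [hsum _ hmv, Finset.smul_sum]
      refine Finset.sum_congr rfl fun j _ => ?_
      rw [smul_smul]
      congr 1
      have h2 := hfL j _ hmv
      rw [map_zsmul, ← hl j, zsmul_eq_mul] at h2
      exact_mod_cast h2.symm
    exact (smul_right_injective _ hm) h1
  rw [hv']
  exact sum_mem fun j _ => Λ.smul_mem _ (b j).2

theorem exists_eq_emb_add {m : ℤ} (hm : m ≠ 0) {x : Fin n → QHat ⊗[ℚ] E}
    (hx : x ∈ completion L) :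
    ∃ w ∈ L, ∃ y ∈ completion L, x = emb w + algebraMap ℚ QHat m • y := by
  induction hx using Submodule.span_induction with
  | mem x hx =>
    obtain ⟨w, hw, rfl⟩ := hx
    exact ⟨w, hw, 0, zero_mem _, by simp⟩
  | zero => exact ⟨0, zero_mem _, 0, zero_mem _, by simp⟩
  | add x x' _ _ hx hx' =>
    obtain ⟨w, hw, y, hy, rfl⟩ := hx
    obtain ⟨w', hw', y', hy', rfl⟩ := hx'
    exact ⟨w + w', add_mem hw hw', y + y', add_mem hy hy', by rw [emb_add, smul_add]; abel⟩
  | smul c x _ hx =>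
    obtain ⟨w, hw, y, hy, rfl⟩ := hx
    obtain ⟨k, z, hz, hc⟩ := exists_int_sub_mem hm c.2
    refine ⟨k • w, zsmul_mem hw k, z • emb w + (c : QHat) • y,
      add_mem (smul_mem_of_mem_ZHat hz (emb_mem_completion hw)) (smul_mem_of_mem_ZHat c.2 hy), ?_⟩
    have h1 : c • (emb w + algebraMap ℚ QHat m • y) =
        (c : QHat) • (emb w + algebraMap ℚ QHat m • y) := rfl
    rw [h1, emb_zsmul, smul_add, smul_add, smul_smul, smul_smul, smul_smul,
      mul_comm (c : QHat) (algebraMap ℚ QHat m), ← add_assoc, ← add_smul, ← hc]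

/-- A `ℤ̂`-lattice in `V_n ⊗ ℚ̂` is spanned by its intersection with `V_n`. -/
theorem mem_span_emb {Λ : Submodule ZHat (Fin n → QHat ⊗[ℚ] E)} {m : ℤ}
    (hm : m ≠ 0) (h₁ : ∀ w ∈ L, emb (m • w) ∈ Λ)
    (h₂ : ∀ x ∈ Λ, algebraMap ℚ QHat m • x ∈ completion L) {x : Fin n → QHat ⊗[ℚ] E}
    (hx : x ∈ Λ) : x ∈ Submodule.span ZHat (emb '' {v | emb v ∈ Λ}) := by
  have hm' : (m : ℚ) ≠ 0 := by exact_mod_cast hm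
  have h₃ : ∀ y ∈ completion L, algebraMap ℚ QHat m • y ∈
      Submodule.span ZHat (emb '' {v | emb v ∈ Λ}) := by
    intro y hy
    induction hy using Submodule.span_induction with
    | mem y hy =>
      obtain ⟨w, hw, rfl⟩ := hy
      rw [← emb_zsmul]
      exact Submodule.subset_span ⟨_, h₁ w hw, rfl⟩
    | zero => rw [smul_zero]; exact zero_mem _
    | add y y' _ _ hy hy' => rw [smul_add]; exact add_mem hy hy'
    | smul c y _ hy =>
      have : algebraMap ℚ QHat m • c • y = c • algebraMap ℚ QHat m • y :=
        smul_comm (algebraMap ℚ QHat m) (c : QHat) y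
      rw [this]
      exact Submodule.smul_mem _ c hy
  -- Approximation of mx modulo m², so that after division by m the error still lies in m(L ⊗ ℤ̂),
  -- already known to be in the span.
  obtain ⟨w, hw, y, hy, hxy⟩ := exists_eq_emb_add (mul_ne_zero hm hm) (h₂ x hx)
  have hx' : x = emb ((m : ℚ)⁻¹ • w) + algebraMap ℚ QHat m • y := by
    apply algebraMap_smul_injective hm
    rw [hxy, smul_add, emb_smul, smul_smul, ← map_mul, mul_inv_cancel₀ hm', map_one, one_smul,
      smul_smul, ← map_mul, Int.cast_mul]
  have hle : Submodule.span ZHat (emb '' {v | emb v ∈ Λ}) ≤ Λ := by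
    rw [Submodule.span_le]
    rintro _ ⟨v, hv, rfl⟩
    exact hv
  have h₄ : emb ((m : ℚ)⁻¹ • w) ∈ Λ := by
    have : emb ((m : ℚ)⁻¹ • w) = x - algebraMap ℚ QHat m • y := by rw [hx', add_sub_cancel_right]
    rw [this]
    exact sub_mem hx (hle (h₃ y hy))
  rw [hx']
  exact add_mem (Submodule.subset_span ⟨_, h₄, rfl⟩) (h₃ y hy)

theorem exists_int_smul_mem_completion (hL : L.IsLattice E) (x : Fin n → QHat ⊗[ℚ] E) :
    ∃ m : ℤ, m ≠ 0 ∧ algebraMap ℚ QHat m • x ∈ completion L := by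
  have hadd : ∀ x y : Fin n → QHat ⊗[ℚ] E,
      (∃ m : ℤ, m ≠ 0 ∧ algebraMap ℚ QHat m • x ∈ completion L) →
      (∃ m : ℤ, m ≠ 0 ∧ algebraMap ℚ QHat m • y ∈ completion L) →
      ∃ m : ℤ, m ≠ 0 ∧ algebraMap ℚ QHat m • (x + y) ∈ completion L := by
    rintro x y ⟨m, hm, hx⟩ ⟨k, hk, hy⟩
    refine ⟨m * k, mul_ne_zero hm hk, ?_⟩
    rw [Int.cast_mul, map_mul, smul_add]
    refine add_mem ?_ ?_
    · rw [mul_comm, mul_smul]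
      exact smul_mem_of_mem_ZHat (intCast_mem_ZHat k) hx
    · rw [mul_smul]
      exact smul_mem_of_mem_ZHat (intCast_mem_ZHat m) hy
  have hzero : ∃ m : ℤ, m ≠ 0 ∧
      algebraMap ℚ QHat m • (0 : Fin n → QHat ⊗[ℚ] E) ∈ completion L :=
    ⟨1, one_ne_zero, by rw [smul_zero]; exact zero_mem _⟩
  have hsingle : ∀ (i : Fin n) (t : QHat ⊗[ℚ] E), ∃ m : ℤ, m ≠ 0 ∧
      algebraMap ℚ QHat m • (Pi.single i t : Fin n → QHat ⊗[ℚ] E) ∈ completion L := by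
    intro i t
    induction t using TensorProduct.induction_on with
    | zero => rw [Pi.single_zero]; exact hzero
    | add x y hx hy => rw [Pi.single_add]; exact hadd _ _ hx hy
    | tmul q e =>
      obtain ⟨m, hm, hmq⟩ := exists_int_mul_mem_ZHat q
      obtain ⟨k, hk, hke⟩ := exists_int_smul_mem hL (Pi.single i e)
      refine ⟨m * k, mul_ne_zero hm hk, ?_⟩
      have h1 : algebraMap ℚ QHat ((m * k : ℤ) : ℚ) • (Pi.single i (q ⊗ₜ[ℚ] e) :
          Fin n → QHat ⊗[ℚ] E) = (algebraMap ℚ QHat m * q) • emb (k • Pi.single i e) := by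
        have h2 : (Pi.single i (q ⊗ₜ[ℚ] e) : Fin n → QHat ⊗[ℚ] E) = q • emb (Pi.single i e) := by
          funext j
          by_cases h : j = i
          · subst h
            simp [emb, TensorProduct.smul_tmul']
          · simp [emb, Pi.single_eq_of_ne h]
        rw [h2, emb_zsmul, smul_smul, smul_smul, Int.cast_mul, map_mul]
        congr 1
        ring
      rw [h1]
      exact smul_mem_of_mem_ZHat hmq (emb_mem_completion hke)
  rw [← Finset.univ_sum_single x]
  exact Finset.sum_induction (fun i => (Pi.single i (x i) : Fin n → QHat ⊗[ℚ] E))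
    (fun y => ∃ m : ℤ, m ≠ 0 ∧ algebraMap ℚ QHat m • y ∈ completion L)
    hadd hzero fun i _ => hsingle i (x i)

theorem mulVec_qsmul (g : Matrix (Fin n) (Fin n) (QHat ⊗[ℚ] E)) (c : QHat)
    (x : Fin n → QHat ⊗[ℚ] E) : g.mulVec (c • x) = c • g.mulVec x :=
  Matrix.mulVec_smul g c x

theorem exists_int_smul_mulVec_mem (hL : L.IsLattice E) (hL' : L'.IsLattice E)
    (g : Matrix (Fin n) (Fin n) (QHat ⊗[ℚ] E)) :
    ∃ m : ℤ, m ≠ 0 ∧ ∀ x ∈ completion L, algebraMap ℚ QHat m • g.mulVec x ∈ completion L' := by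
  classical
  have hS : ∀ S : Finset (Fin n → E), ∃ m : ℤ, m ≠ 0 ∧
      ∀ w ∈ S, algebraMap ℚ QHat m • g.mulVec (emb w) ∈ completion L' := by
    intro S
    induction S using Finset.induction_on with
    | empty => exact ⟨1, one_ne_zero, by simp⟩
    | insert x S _ ih =>
      obtain ⟨m, hm, h⟩ := ih
      obtain ⟨k, hk, h'⟩ := exists_int_smul_mem_completion hL' (g.mulVec (emb x))
      refine ⟨m * k, mul_ne_zero hm hk, fun w hw => ?_⟩
      rw [Int.cast_mul, map_mul]
      rcases Finset.mem_insert.1 hw with rfl | hw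
      · rw [mul_smul]
        exact smul_mem_of_mem_ZHat (intCast_mem_ZHat m) h'
      · rw [mul_comm, mul_smul]
        exact smul_mem_of_mem_ZHat (intCast_mem_ZHat k) (h w hw)
  obtain ⟨S, hSL⟩ := hL.fg
  obtain ⟨m, hm, h⟩ := hS S
  refine ⟨m, hm, fun x hx => ?_⟩
  induction hx using Submodule.span_induction with
  | mem x hx =>
    obtain ⟨w, hw, rfl⟩ := hx
    rw [← hSL] at hw
    induction hw using Submodule.span_induction with
    | mem w hw => exact h w hw
    | zero => rw [emb_zero, Matrix.mulVec_zero, smul_zero]; exact zero_mem _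
    | add x y _ _ hx hy => rw [emb_add, Matrix.mulVec_add, smul_add]; exact add_mem hx hy
    | smul a x _ hx =>
      rw [emb_int_smul, Matrix.mulVec_smul, smul_comm]
      exact smul_mem_completion L' a hx
  | zero => rw [Matrix.mulVec_zero, smul_zero]; exact zero_mem _
  | add x y _ _ hx hy => rw [Matrix.mulVec_add, smul_add]; exact add_mem hx hy
  | smul c x _ hx =>
    have h1 : c • x = (c : QHat) • x := rfl
    rw [h1, mulVec_qsmul, smul_comm]
    exact smul_mem_of_mem_ZHat c.2 hx

end Completion

/-! ### The action of `U_n(ℚ̂)` on lattices -/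

section Action

variable {L L' : Submodule (𝓞 E) (Fin n → E)} {v w : Fin n → E} (g h : unitary E n QHat)

theorem coe_mul_mulVec (x : Fin n → QHat ⊗[ℚ] E) :
    (g * h).1.1.mulVec x = g.1.1.mulVec (h.1.1.mulVec x) := by
  rw [Matrix.mulVec_mulVec]
  rfl

theorem coe_one_mulVec (x : Fin n → QHat ⊗[ℚ] E) :
    (1 : unitary E n QHat).1.1.mulVec x = x :=
  Matrix.one_mulVec x

theorem coe_inv_mulVec_mulVec (x : Fin n → QHat ⊗[ℚ] E) :
    g⁻¹.1.1.mulVec (g.1.1.mulVec x) = x := by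
  rw [← coe_mul_mulVec, inv_mul_cancel, coe_one_mulVec]

theorem coe_mulVec_inv_mulVec (x : Fin n → QHat ⊗[ℚ] E) :
    g.1.1.mulVec (g⁻¹.1.1.mulVec x) = x := by
  rw [← coe_mul_mulVec, mul_inv_cancel, coe_one_mulVec]

theorem mem_act : v ∈ act g L ↔ g⁻¹.1.1.mulVec (emb v) ∈ completion L := by
  constructor
  · rintro ⟨x, hx, hxv⟩
    rwa [← hxv, coe_inv_mulVec_mulVec]
  · exact fun hv => ⟨_, hv, coe_mulVec_inv_mulVec g _⟩

theorem act_mono (hle : L ≤ L') : act g L ≤ act g L' := fun _ hv =>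
  (mem_act g).2 (completion_mono hle ((mem_act g).1 hv))

/-- The preimage of `L ⊗ ℤ̂` under a matrix over `ℚ̂ ⊗ E`. -/
def completionComap (L : Submodule (𝓞 E) (Fin n → E))
    (g : Matrix (Fin n) (Fin n) (QHat ⊗[ℚ] E)) :
    Submodule ZHat (Fin n → QHat ⊗[ℚ] E) where
  carrier := {x | g.mulVec x ∈ completion L}
  zero_mem' := by
    simp only [Set.mem_ofPred_eq, Matrix.mulVec_zero]
    exact zero_mem _
  add_mem' := by
    intro x y hx hy
    simp only [Set.mem_ofPred_eq, Matrix.mulVec_add]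
    exact add_mem hx hy
  smul_mem' := by
    intro c x hx
    have h1 : c • x = (c : QHat) • x := rfl
    simp only [Set.mem_ofPred_eq, h1, mulVec_qsmul]
    exact smul_mem_of_mem_ZHat c.2 hx

/-- No information is lost by intersecting g(L ⊗ ℤ̂) with V_n, since it is commensurable with L ⊗ ℤ̂
and so is spanned by its rational vectors. This makes `act` a group action on lattices. -/
theorem mem_completion_act (hL : L.IsLattice E) {x : Fin n → QHat ⊗[ℚ] E} :
    x ∈ completion (act g L) ↔ g⁻¹.1.1.mulVec x ∈ completion L := by
  have hS : {v | emb v ∈ completionComap L g⁻¹.1.1} =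
      ((act g L : Submodule (𝓞 E) (Fin n → E)) : Set (Fin n → E)) :=
    Set.ext fun v => (mem_act g).symm
  constructor
  · intro hx
    have hle : completion (act g L) ≤ completionComap L g⁻¹.1.1 := by
      refine Submodule.span_le.2 ?_
      rintro _ ⟨v, hv, rfl⟩
      exact (mem_act g).1 hv
    exact hle hx
  · intro hx
    obtain ⟨m, hm, h₁⟩ := exists_int_smul_mulVec_mem hL hL g.1.1
    obtain ⟨k, hk, h₂⟩ := exists_int_smul_mulVec_mem hL hL g⁻¹.1.1
    rw [completion, ← hS]
    refine mem_span_emb (mul_ne_zero hm hk) (fun w hw => ?_) (fun y hy => ?_)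
      (Λ := completionComap L g⁻¹.1.1) hx (L := L)
    · change g⁻¹.1.1.mulVec _ ∈ completion L
      rw [emb_zsmul, mulVec_qsmul, Int.cast_mul, map_mul, mul_smul]
      exact smul_mem_of_mem_ZHat (intCast_mem_ZHat m) (h₂ _ (emb_mem_completion hw))
    · have := h₁ _ hy
      rw [coe_mulVec_inv_mulVec] at this
      rw [Int.cast_mul, map_mul, mul_comm, mul_smul]
      exact smul_mem_of_mem_ZHat (intCast_mem_ZHat k) this

theorem act_mul (hL : L.IsLattice E) : act (g * h) L = act g (act h L) := by
  ext v
  rw [mem_act, mem_act, mem_completion_act h hL, mul_inv_rev, coe_mul_mulVec]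

theorem act_one (hL : L.IsLattice E) : act 1 L = L := by
  ext v
  rw [mem_act, inv_one, coe_one_mulVec, emb_mem_completion_iff hL]

theorem act_inv_act (hL : L.IsLattice E) : act g⁻¹ (act g L) = L := by
  rw [← act_mul _ _ hL, inv_mul_cancel, act_one hL]

theorem act_act_inv (hL : L.IsLattice E) : act g (act g⁻¹ L) = L := by
  rw [← act_mul _ _ hL, mul_inv_cancel, act_one hL]

theorem isLattice_of_zsmul_mem (hL : L.IsLattice E) {m : ℤ} (hm : m ≠ 0)
    (h₁ : ∀ v ∈ L', m • v ∈ L) (h₂ : ∀ v ∈ L, m • v ∈ L') : L'.IsLattice E where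
  fg := by
    have hmE : (m : 𝓞 E) ≠ 0 := by exact_mod_cast hm
    have hnoeth : IsNoetherian (𝓞 E) L := isNoetherian_of_fg_of_noetherian L hL.fg
    refine Submodule.fg_of_fg_map_injective (LinearMap.lsmul (𝓞 E) (Fin n → E) m)
      (smul_right_injective _ hmE) ?_
    refine (isNoetherian_submodule.1 hnoeth) _ ?_
    rintro _ ⟨v, hv, rfl⟩
    rw [LinearMap.lsmul_apply, Int.cast_smul_eq_zsmul]
    exact h₁ v hv
  span_eq_top := by
    have hmE : (m : E) ≠ 0 := by exact_mod_cast hm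
    rw [eq_top_iff, ← hL.span_eq_top, Submodule.span_le]
    intro v hv
    have h3 : v = (m : E)⁻¹ • (m • v) := by
      rw [← Int.cast_smul_eq_zsmul E, smul_smul, inv_mul_cancel₀ hmE, one_smul]
    rw [SetLike.mem_coe, h3]
    exact Submodule.smul_mem _ _ (Submodule.subset_span (h₂ v hv))

theorem act_isLattice (hL : L.IsLattice E) : (act g L).IsLattice E := by
  obtain ⟨m, hm, h₁⟩ := exists_int_smul_mulVec_mem hL hL g.1.1
  obtain ⟨k, hk, h₂⟩ := exists_int_smul_mulVec_mem hL hL g⁻¹.1.1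
  refine isLattice_of_zsmul_mem hL (mul_ne_zero hm hk) (fun v hv => ?_) (fun v hv => ?_)
  · rw [mul_comm, mul_smul]
    refine zsmul_mem ?_ k
    rw [← emb_mem_completion_iff hL, emb_zsmul]
    have := h₁ _ ((mem_act g).1 hv)
    rwa [coe_mulVec_inv_mulVec] at this
  · rw [mul_smul]
    refine zsmul_mem ?_ m
    rw [mem_act, emb_zsmul, mulVec_qsmul]
    exact h₂ _ (emb_mem_completion hv)

theorem isLattice_of_le_of_le {L₁ L₂ : Submodule (𝓞 E) (Fin n → E)} (hL₁ : L₁.IsLattice E)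
    (hL₂ : L₂.IsLattice E) (h₁ : L₁ ≤ L) (h₂ : L ≤ L₂) : L.IsLattice E where
  fg := (isNoetherian_submodule.1 (isNoetherian_of_fg_of_noetherian L₂ hL₂.fg)) _ h₂
  span_eq_top := by
    rw [eq_top_iff, ← hL₁.span_eq_top]
    exact Submodule.span_mono h₁

theorem isLattice_inf (hL : L.IsLattice E) (hL' : L'.IsLattice E) : (L ⊓ L').IsLattice E := by
  obtain ⟨m, hm, h⟩ := exists_int_smul_mulVec_mem hL hL' 1
  refine isLattice_of_zsmul_mem hL hm (fun v hv => zsmul_mem hv.1 m)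
    fun v hv => ⟨zsmul_mem hv m, ?_⟩
  rw [SetLike.mem_coe, ← emb_mem_completion_iff hL', emb_zsmul]
  simpa using h _ (emb_mem_completion hv)

theorem act_inf (hL : L.IsLattice E) (hL' : L'.IsLattice E) :
    act g (L ⊓ L') = act g L ⊓ act g L' := by
  refine le_antisymm (le_inf (act_mono g inf_le_left) (act_mono g inf_le_right)) ?_
  have h1 := act_isLattice g hL
  have h2 := act_isLattice g hL'
  have h3 := isLattice_inf h1 h2
  rw [← act_act_inv g h3]
  refine act_mono g (le_inf ?_ ?_)
  · conv_rhs => rw [← act_inv_act g hL]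
    exact act_mono _ inf_le_left
  · conv_rhs => rw [← act_inv_act g hL']
    exact act_mono _ inf_le_right

theorem act_covBy (hL : L.IsLattice E) (hL' : L'.IsLattice E) (hcov : L ⋖ L') :
    act g L ⋖ act g L' := by
  have hlt : ∀ (g : unitary E n QHat) {A B : Submodule (𝓞 E) (Fin n → E)}, A.IsLattice E →
      B.IsLattice E → A < B → act g A < act g B := by
    intro g A B hA hB hAB
    refine lt_of_le_of_ne (act_mono g hAB.le) fun heq => hAB.ne ?_
    rw [← act_inv_act g hA, heq, act_inv_act g hB]
  refine ⟨hlt g hL hL' hcov.lt, fun C h₁ h₂ => ?_⟩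
  -- An intermediate submodule is itself a lattice, so g⁻¹ can be applied to it.
  have hC := isLattice_of_le_of_le (act_isLattice g hL) (act_isLattice g hL') h₁.le h₂.le
  have h₃ := hlt g⁻¹ (act_isLattice g hL) hC h₁
  have h₄ := hlt g⁻¹ hC (act_isLattice g hL') h₂
  rw [act_inv_act g hL] at h₃
  rw [act_inv_act g hL'] at h₄
  exact hcov.2 h₃ h₄

theorem smul_mem_act {a : 𝓞 E} (ha : ∀ v ∈ L, a • v ∈ L') (hv : v ∈ act g L) :
    a • v ∈ act g L' := by
  have hcomp : ∀ x ∈ completion L, ((1 : QHat) ⊗ₜ[ℚ] (a : E)) • x ∈ completion L' := by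
    intro x hx
    induction hx using Submodule.span_induction with
    | mem x hx =>
      obtain ⟨w, hw, rfl⟩ := hx
      rw [← emb_int_smul]
      exact emb_mem_completion (ha w hw)
    | zero => rw [smul_zero]; exact zero_mem _
    | add x y _ _ hx hy => rw [smul_add]; exact add_mem hx hy
    | smul c x _ hx =>
      have h1 : c • x = (c : QHat) • x := rfl
      rw [h1, smul_comm]
      exact smul_mem_of_mem_ZHat c.2 hx
  rw [mem_act, emb_int_smul, Matrix.mulVec_smul]
  exact hcomp _ ((mem_act g).1 hv)

/-- The Hermitian form on `V_n ⊗ ℚ̂`. -/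
def adelicHerm (x y : Fin n → QHat ⊗[ℚ] E) : QHat ⊗[ℚ] E :=
  (conjTensor E QHat ∘ x) ⬝ᵥ y

theorem adelicHerm_emb (v w : Fin n → E) : adelicHerm (emb v) (emb w) = 1 ⊗ₜ[ℚ] herm v w := by
  simp [adelicHerm, emb, herm, dotProduct, conjTensor, TensorProduct.tmul_sum]

theorem adelicHerm_add_left (x y z : Fin n → QHat ⊗[ℚ] E) :
    adelicHerm (x + y) z = adelicHerm x z + adelicHerm y z := by
  simp [adelicHerm, dotProduct, add_mul, Finset.sum_add_distrib]

theorem adelicHerm_add_right (x y z : Fin n → QHat ⊗[ℚ] E) :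
    adelicHerm x (y + z) = adelicHerm x y + adelicHerm x z := by
  simp [adelicHerm]

theorem adelicHerm_smul_left (c : QHat) (x y : Fin n → QHat ⊗[ℚ] E) :
    adelicHerm (c • x) y = c • adelicHerm x y := by
  simp [adelicHerm, dotProduct, Finset.smul_sum]

theorem adelicHerm_smul_right (c : QHat) (x y : Fin n → QHat ⊗[ℚ] E) :
    adelicHerm x (c • y) = c • adelicHerm x y := by
  simp [adelicHerm]

theorem adelicHerm_mulVec (x y : Fin n → QHat ⊗[ℚ] E) :
    adelicHerm (g.1.1.mulVec x) (g.1.1.mulVec y) = adelicHerm x y := by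
  have h1 : conjTensor E QHat ∘ g.1.1.mulVec x =
      (g.1.1.map (conjTensor E QHat)).mulVec (conjTensor E QHat ∘ x) := by
    funext i
    exact RingHom.map_mulVec (conjTensor E QHat : QHat ⊗[ℚ] E →+* QHat ⊗[ℚ] E) g.1.1 x i
  have h2 : (g.1.1.map (conjTensor E QHat)).transpose * g.1.1 = 1 := g.2
  rw [adelicHerm, h1, Matrix.dotProduct_mulVec, ← Matrix.vecMul_transpose, Matrix.vecMul_vecMul,
    h2, Matrix.vecMul_one, adelicHerm]

variable (E) in
/-- The lattice `𝓞_E ⊆ E ^ 1`. -/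
def unitLattice : Submodule (𝓞 E) (Fin 1 → E) := Submodule.span (𝓞 E) {1}

variable (E) in
theorem unitLattice_isLattice : (unitLattice E).IsLattice E where
  fg := Submodule.fg_span_singleton _
  span_eq_top := by
    rw [eq_top_iff]
    intro v _
    have h1 : v = v 0 • (1 : Fin 1 → E) := by
      funext i
      rw [Subsingleton.elim i 0]
      simp
    rw [h1]
    exact Submodule.smul_mem _ _ (Submodule.subset_span (Submodule.mem_span_singleton_self _))

theorem mem_unitLattice_iff {e : E} : (fun _ => e) ∈ unitLattice E ↔ IsIntegral ℤ e := by
  rw [unitLattice, Submodule.mem_span_singleton]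
  constructor
  · rintro ⟨a, ha⟩
    have h1 : (a : E) = e := by simpa [Algebra.smul_def] using congrFun ha 0
    rw [← h1]
    exact RingOfIntegers.isIntegral_coe a
  · intro he
    refine ⟨⟨e, he⟩, funext fun i => ?_⟩
    exact (Algebra.smul_def (⟨e, he⟩ : 𝓞 E) (1 : E)).trans (mul_one e)

/-- Integrality of adelic values is expressed through the rank-one lattice 𝓞_E, so that descent to E
is again `emb_mem_completion_iff`. -/
theorem adelicHerm_mem (hint : Integral L) {x y : Fin n → QHat ⊗[ℚ] E} (hx : x ∈ completion L)
    (hy : y ∈ completion L) :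
    (fun _ => adelicHerm x y) ∈ completion (unitLattice E) := by
  have hfst : ∀ v ∈ L, ∀ y ∈ completion L,
      (fun _ => adelicHerm (emb v) y) ∈ completion (unitLattice E) := by
    intro v hv y hy
    induction hy using Submodule.span_induction with
    | mem y hy =>
      obtain ⟨w, hw, rfl⟩ := hy
      simp only [adelicHerm_emb]
      exact emb_mem_completion (mem_unitLattice_iff.2 (hint hv w hw))
    | zero =>
      convert zero_mem (completion (unitLattice E)) using 1
      funext i
      simp [adelicHerm]
    | add y z _ _ hy hz =>
      simp only [adelicHerm_add_right]
      exact add_mem hy hz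
    | smul c y _ hy =>
      have h1 : c • y = (c : QHat) • y := rfl
      simp only [h1, adelicHerm_smul_right]
      exact smul_mem_of_mem_ZHat c.2 hy
  induction hx using Submodule.span_induction with
  | mem x hx =>
    obtain ⟨v, hv, rfl⟩ := hx
    exact hfst v hv y hy
  | zero =>
    convert zero_mem (completion (unitLattice E)) using 1
    funext i
    simp [adelicHerm, dotProduct]
  | add x z _ _ hx hz =>
    simp only [adelicHerm_add_left]
    exact add_mem hx hz
  | smul c x _ hx =>
    have h1 : c • x = (c : QHat) • x := rfl
    simp only [h1, adelicHerm_smul_left]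
    exact smul_mem_of_mem_ZHat c.2 hx

theorem act_integral (hint : Integral L) : Integral (act g L) := by
  intro v hv w hw
  rw [← mem_unitLattice_iff, ← emb_mem_completion_iff (unitLattice_isLattice E)]
  have h1 := adelicHerm_mem hint ((mem_act g).1 hv) ((mem_act g).1 hw)
  rw [adelicHerm_mulVec, adelicHerm_emb] at h1
  exact h1

theorem act_mem_neighbours {𝔭 : Ideal (𝓞 E)} (hp : 𝔭.IsMaximal) (hL : L.IsLattice E)
    (h : L' ∈ neighbours L 𝔭) : act g L' ∈ neighbours (act g L) 𝔭 := by
  rw [mem_neighbours_iff hp] at h ⊢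
  obtain ⟨hL', hint, ⟨h₁, h₂⟩, h₃, h₄⟩ := h
  have hinf := isLattice_inf hL hL'
  refine ⟨act_isLattice g hL', act_integral g hint, ⟨?_, fun a ha v hv => ?_⟩, ?_,
    fun a ha v hv => ?_⟩
  · rw [← act_inf g hL hL']
    exact act_covBy g hinf hL h₁
  · exact smul_mem_act g (h₂ a ha) hv
  · rw [← act_inf g hL hL']
    exact act_covBy g hinf hL' h₃
  · exact smul_mem_act g (h₄ a ha) hv

end Action

/-! ### Adelic points supported at one prime -/

section Splice

variable {R A : Type*} [CommRing R] [CommRing A] [Algebra R A]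

/-- The matrix that equals `M` on the summand cut out by the idempotent `e` and `1` on the
other one. -/
def splice (e : R) (M : Matrix (Fin n) (Fin n) A) : Matrix (Fin n) (Fin n) A :=
  (1 - e) • 1 + e • M

theorem splice_one (e : R) : splice e (1 : Matrix (Fin n) (Fin n) A) = 1 := by
  rw [splice, ← add_smul, sub_add_cancel, one_smul]

theorem splice_mul {e : R} (he : e * e = e) (M N : Matrix (Fin n) (Fin n) A) :
    splice e M * splice e N = splice e (M * N) := by
  have h1 : (1 - e) * (1 - e) = 1 - e := by linear_combination he
  have h2 : (1 - e) * e = 0 := by linear_combination -he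
  have h3 : e * (1 - e) = 0 := by linear_combination -he
  simp only [splice, add_mul, mul_add, smul_add, smul_mul_assoc, mul_smul_comm, smul_smul,
    h1, h2, h3, he, one_mul, mul_one, zero_smul, add_zero, zero_add]

theorem splice_mulVec (e : R) (M : Matrix (Fin n) (Fin n) A) (x : Fin n → A) :
    (splice e M).mulVec x = (1 - e) • x + e • M.mulVec x := by
  rw [splice, Matrix.add_mulVec, Matrix.smul_mulVec, Matrix.smul_mulVec, Matrix.one_mulVec]

theorem splice_map (e : R) (M : Matrix (Fin n) (Fin n) A) (σ : A →ₐ[R] A) :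
    (splice e M).map σ = splice e (M.map σ) := by
  ext i j
  by_cases h : i = j <;> simp [splice, h]

theorem splice_transpose (e : R) (M : Matrix (Fin n) (Fin n) A) :
    (splice e M).transpose = splice e M.transpose := by
  simp [splice]

end Splice

section Local

variable {L L₂ : Submodule (𝓞 E) (Fin n → E)}

/-- The matrix over `ℚ̂ ⊗ E` of an endomorphism of `E ^ n`. -/
def adelicMatrix (g : (Fin n → E) →ₗ[E] (Fin n → E)) :
    Matrix (Fin n) (Fin n) (QHat ⊗[ℚ] E) :=
  (LinearMap.toMatrix' g).map (Algebra.TensorProduct.includeRight : E →ₐ[ℚ] QHat ⊗[ℚ] E)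

theorem adelicMatrix_mul (g h : (Fin n → E) →ₗ[E] (Fin n → E)) :
    adelicMatrix g * adelicMatrix h = adelicMatrix (g ∘ₗ h) := by
  rw [adelicMatrix, adelicMatrix, ← Matrix.map_mul, ← LinearMap.toMatrix'_comp, adelicMatrix]

theorem adelicMatrix_id : adelicMatrix (LinearMap.id : (Fin n → E) →ₗ[E] (Fin n → E)) = 1 := by
  rw [adelicMatrix, LinearMap.toMatrix'_id]
  exact Matrix.map_one _ (map_zero _) (map_one _)

theorem adelicMatrix_mulVec_emb (g : (Fin n → E) →ₗ[E] (Fin n → E)) (v : Fin n → E) :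
    (adelicMatrix g).mulVec (emb v) = emb (g v) := by
  funext i
  have h1 := RingHom.map_mulVec
    ((Algebra.TensorProduct.includeRight : E →ₐ[ℚ] QHat ⊗[ℚ] E) : E →+* QHat ⊗[ℚ] E)
    (LinearMap.toMatrix' g) v i
  rw [LinearMap.toMatrix'_mulVec] at h1
  exact h1.symm

theorem conjTranspose_toMatrix'_mul {g : (Fin n → E) ≃ₗ[E] (Fin n → E)} (hg : IsIsometry g) :
    ((LinearMap.toMatrix' (g : (Fin n → E) →ₗ[E] (Fin n → E))).map (conj E)).transpose *
      LinearMap.toMatrix' (g : (Fin n → E) →ₗ[E] (Fin n → E)) = 1 := by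
  ext i j
  have h1 := hg (Pi.single i 1) (Pi.single j 1)
  simp only [herm] at h1
  have h2 : ∀ k l, LinearMap.toMatrix' (g : (Fin n → E) →ₗ[E] (Fin n → E)) k l =
      g (Pi.single l 1) k := fun _ _ => rfl
  simp only [Matrix.mul_apply, Matrix.transpose_apply, Matrix.map_apply, h2]
  rw [h1]
  by_cases h : i = j
  · subst h; simp [Pi.single_apply]
  · simp [Pi.single_apply, h, Ne.symm h]

theorem conjTranspose_adelicMatrix_mul {g : (Fin n → E) ≃ₗ[E] (Fin n → E)} (hg : IsIsometry g) :
    ((adelicMatrix (g : (Fin n → E) →ₗ[E] (Fin n → E))).map (conjTensor E QHat)).transpose *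
      adelicMatrix (g : (Fin n → E) →ₗ[E] (Fin n → E)) = 1 := by
  have h1 := congrArg (fun M => M.map (Algebra.TensorProduct.includeRight : E →ₐ[ℚ] QHat ⊗[ℚ] E))
    (conjTranspose_toMatrix'_mul hg)
  simp only [Matrix.map_mul] at h1
  rw [Matrix.map_one _ (map_zero _) (map_one _)] at h1
  rw [← h1]
  congr 1

/-- The adelic unitary transformation that is `g` at the prime `v` and `1` elsewhere. -/
def unitaryAt (v : HeightOneSpectrum ℤ) {g : (Fin n → E) ≃ₗ[E] (Fin n → E)} (hg : IsIsometry g) :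
    unitary E n QHat where
  val :=
    { val := splice (idempotentAt v) (adelicMatrix (g : (Fin n → E) →ₗ[E] (Fin n → E)))
      inv := splice (idempotentAt v) (adelicMatrix (g.symm : (Fin n → E) →ₗ[E] (Fin n → E)))
      val_inv := by
        rw [splice_mul (idempotentAt_mul_self v), adelicMatrix_mul, LinearEquiv.comp_symm,
          adelicMatrix_id, splice_one]
      inv_val := by
        rw [splice_mul (idempotentAt_mul_self v), adelicMatrix_mul, LinearEquiv.symm_comp,
          adelicMatrix_id, splice_one] }
  property := by
    change (Matrix.map (splice _ _) _).transpose * splice _ _ = 1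
    rw [splice_map, splice_transpose, splice_mul (idempotentAt_mul_self v),
      conjTranspose_adelicMatrix_mul hg, splice_one]

theorem smul_emb_eq {m : ℤ} (hm : m ≠ 0) (c : QHat) (x : Fin n → E) :
    c • emb x = (c * algebraMap ℚ QHat (m : ℚ)⁻¹) • emb (m • x) := by
  have hm' : (m : ℚ) ≠ 0 := by exact_mod_cast hm
  rw [emb_zsmul, smul_smul, mul_assoc, ← map_mul, inv_mul_cancel₀ hm', map_one, mul_one]

theorem splice_mulVec_emb (e : QHat) (g : (Fin n → E) →ₗ[E] (Fin n → E)) (u : Fin n → E) :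
    (splice e (adelicMatrix g)).mulVec (emb u) = (1 - e) • emb u + e • emb (g u) := by
  rw [splice_mulVec, adelicMatrix_mulVec_emb]

/-- The two idempotent components are treated separately: m is invertible at v, and k is invertible
at every other place. -/
theorem splice_mulVec_emb_mem {v : HeightOneSpectrum ℤ} (g : (Fin n → E) →ₗ[E] (Fin n → E))
    {u : Fin n → E} (h₁ : ∃ m ∉ v.asIdeal, m • g u ∈ L)
    (h₂ : ∃ m, (∀ w ≠ v, m ∉ w.asIdeal) ∧ m ≠ 0 ∧ m • u ∈ L) :
    (splice (idempotentAt v) (adelicMatrix g)).mulVec (emb u) ∈ completion L := by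
  obtain ⟨m, hm, hmu⟩ := h₁
  obtain ⟨k, hk, hk0, hku⟩ := h₂
  have hm0 : m ≠ 0 := by
    rintro rfl
    exact hm (zero_mem _)
  rw [splice_mulVec_emb]
  refine add_mem ?_ ?_
  · rw [smul_emb_eq hk0]
    exact smul_mem_of_mem_ZHat (one_sub_idempotentAt_mul_inv_mem hk) (emb_mem_completion hku)
  · rw [smul_emb_eq hm0]
    exact smul_mem_of_mem_ZHat (idempotentAt_mul_inv_mem hm) (emb_mem_completion hmu)

theorem act_unitaryAt {v : HeightOneSpectrum ℤ} {g : (Fin n → E) ≃ₗ[E] (Fin n → E)}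
    (hg : IsIsometry g) (hL₂ : L₂.IsLattice E)
    (h₁ : ∀ u ∈ L, ∃ m ∉ v.asIdeal, m • g u ∈ L₂)
    (h₂ : ∀ u ∈ L₂, ∃ m ∉ v.asIdeal, m • g.symm u ∈ L)
    (h₃ : ∀ u ∈ L, ∃ m, (∀ w ≠ v, m ∉ w.asIdeal) ∧ m ≠ 0 ∧ m • u ∈ L₂)
    (h₄ : ∀ u ∈ L₂, ∃ m, (∀ w ≠ v, m ∉ w.asIdeal) ∧ m ≠ 0 ∧ m • u ∈ L) :
    act (unitaryAt v hg) L = L₂ := by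
  apply le_antisymm
  · rintro u ⟨x, hx, hxu⟩
    rw [← emb_mem_completion_iff hL₂, ← hxu]
    clear hxu
    induction hx using Submodule.span_induction with
    | mem x hx =>
      obtain ⟨w, hw, rfl⟩ := hx
      exact splice_mulVec_emb_mem _ (h₁ w hw) (h₃ w hw)
    | zero => rw [Matrix.mulVec_zero]; exact zero_mem _
    | add x y _ _ hx hy => rw [Matrix.mulVec_add]; exact add_mem hx hy
    | smul c x _ hx =>
      have h1 : c • x = (c : QHat) • x := rfl
      rw [h1, mulVec_qsmul]
      exact smul_mem_of_mem_ZHat c.2 hx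
  · intro u hu
    rw [mem_act]
    exact splice_mulVec_emb_mem _ (h₂ u hu) (h₄ u hu)

variable {𝔭 : Ideal (𝓞 E)} {hp : 𝔭.IsPrime}

/-- A prime number below `𝔭`: it lies in `𝔭` and in the conjugate of `𝔭`, and in no other prime
ideal of `ℤ` than the one below `𝔭`. -/
theorem exists_heightOneSpectrum_int (hp : 𝔭.IsPrime) (hp0 : 𝔭 ≠ ⊥) :
    ∃ (v : HeightOneSpectrum ℤ) (p : ℤ), (∀ m : ℤ, (m : 𝓞 E) ∉ 𝔭 → m ∉ v.asIdeal) ∧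
      (∀ w ≠ v, p ∉ w.asIdeal) ∧ p ≠ 0 ∧ (p : 𝓞 E) ∈ 𝔭 ∧ (p : 𝓞 E) ∈ 𝔭.map (conjInt E) := by
  have h0 : 𝔭.comap (algebraMap ℤ (𝓞 E)) ≠ ⊥ := by
    obtain ⟨a, ha, ha0⟩ := Submodule.exists_mem_ne_zero_of_ne_bot hp0
    obtain ⟨m, hm⟩ := exists_int_mul_conjInt a
    refine (Submodule.ne_bot_iff _).2 ⟨m, ?_, ?_⟩
    · rw [Ideal.mem_comap, eq_intCast, hm]
      exact 𝔭.mul_mem_right _ ha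
    · rintro rfl
      rw [Int.cast_zero, eq_comm, mul_eq_zero] at hm
      exact hm.elim ha0 (by simpa using ha0)
  let v : HeightOneSpectrum ℤ := ⟨𝔭.comap (algebraMap ℤ (𝓞 E)), hp.comap _, h0⟩
  obtain ⟨p, hpv⟩ : ∃ p, v.asIdeal = Ideal.span {p} :=
    (IsPrincipalIdealRing.principal v.asIdeal).principal
  have hmem : p ∈ v.asIdeal := hpv ▸ Ideal.mem_span_singleton_self p
  have hp𝔭 : (p : 𝓞 E) ∈ 𝔭 := by simpa [v] using hmem
  refine ⟨v, p, fun m hm hmv => hm (by simpa [v] using hmv), fun w hw hpw => hw ?_, ?_, hp𝔭, ?_⟩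
  · apply HeightOneSpectrum.ext
    refine (v.isMaximal.eq_of_le w.isPrime.ne_top ?_).symm
    rw [hpv, Ideal.span_singleton_le_iff_mem]
    exact hpw
  · rintro rfl
    exact v.ne_bot (by rw [hpv, Ideal.span_singleton_eq_bot])
  · rw [← map_intCast (conjInt E) p]
    exact Ideal.mem_map_of_mem _ hp𝔭

/-- A denominator s prime to 𝔭 and 𝔭̄ is replaced by the rational integer ss̄, which is still
outside 𝔭. -/
theorem exists_zsmul_mem_of_mem_loc {v : HeightOneSpectrum ℤ}
    (hv : ∀ m : ℤ, (m : 𝓞 E) ∉ 𝔭 → m ∉ v.asIdeal) {u : Fin n → E} (hu : u ∈ loc hp L) :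
    ∃ m ∉ v.asIdeal, m • u ∈ L := by
  obtain ⟨s, hs, hsu⟩ := mem_loc.1 hu
  obtain ⟨m, hm⟩ := exists_int_mul_conjInt s
  refine ⟨m, hv m ?_, ?_⟩
  · rw [hm]
    exact fun h => (hp.mem_or_mem h).elim hs.1 hs.2
  · rw [← Int.cast_smul_eq_zsmul (𝓞 E), hm, mul_comm, mul_smul]
    exact L.smul_mem _ hsu

/-- An isometry that maps `L₁` onto `L₂` locally at `𝔭` gives a unitary adele that maps every such
pair of lattices onto each other, provided that the two agree away from `𝔭`. -/
theorem exists_unitary_act_eq (hp : 𝔭.IsPrime) {v : HeightOneSpectrum ℤ} {p : ℤ}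
    (hv : ∀ m : ℤ, (m : 𝓞 E) ∉ 𝔭 → m ∉ v.asIdeal) (hpw : ∀ w ≠ v, p ∉ w.asIdeal) (hp0 : p ≠ 0)
    {g : (Fin n → E) ≃ₗ[E] (Fin n → E)} (hg : IsIsometry g) :
    ∃ κ : unitary E n QHat, ∀ L L₂ : Submodule (𝓞 E) (Fin n → E), L₂.IsLattice E →
      (∀ u ∈ loc hp L, g u ∈ loc hp L₂) → (∀ u ∈ loc hp L₂, g.symm u ∈ loc hp L) →
      (∀ u ∈ L, p ^ 2 • u ∈ L₂) → (∀ u ∈ L₂, p ^ 2 • u ∈ L) → act κ L = L₂ := by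
  have hpw' : ∀ w ≠ v, p ^ 2 ∉ w.asIdeal := fun w hw h =>
    hpw w hw (w.isPrime.mem_of_pow_mem 2 h)
  refine ⟨unitaryAt v hg, fun L L₂ hL₂ h₁ h₂ h₃ h₄ => act_unitaryAt hg hL₂
    (fun u hu => exists_zsmul_mem_of_mem_loc hv (h₁ u (le_loc hu)))
    (fun u hu => exists_zsmul_mem_of_mem_loc hv (h₂ u (le_loc hu)))
    (fun u hu => ⟨_, hpw', pow_ne_zero 2 hp0, h₃ u hu⟩)
    (fun u hu => ⟨_, hpw', pow_ne_zero 2 hp0, h₄ u hu⟩)⟩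

end Local

/-! ### Neighbours in rank at most one -/

section RankOne

variable {L L₁ L₂ : Submodule (𝓞 E) (Fin n → E)} {𝔭 I : Ideal (𝓞 E)}

/-- The localisation at I is a valuation ring, so of two vectors on a line one is a local multiple
of the other. -/
theorem exists_notMem_smul_eq (hn : n ≤ 1) (hI : I.IsMaximal) (hI0 : I ≠ ⊥) (x y : Fin n → E) :
    ∃ t ∉ I, ∃ a : 𝓞 E, t • x = a • y ∨ t • y = a • x := by
  have h1I : (1 : 𝓞 E) ∉ I := (Ideal.ne_top_iff_one I).1 hI.ne_top
  by_cases hx : x = 0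
  · exact ⟨1, h1I, 0, Or.inl (by rw [hx, smul_zero, zero_smul])⟩
  obtain ⟨i, hi⟩ := Function.ne_iff.1 hx
  have hsub : ∀ j, j = i := fun j => Fin.ext (by omega)
  let v : HeightOneSpectrum (𝓞 E) := ⟨I, hI.isPrime, hI0⟩
  obtain ⟨a, t, h⟩ := v.exists_primeCompl_mul_eq_or_mul_eq (K := E) (y i / x i)
  have hxi : x i ≠ 0 := hi
  refine ⟨t, t.2, a, ?_⟩
  rcases h with h | h
  · right
    funext j
    rw [hsub j, Pi.smul_apply, Pi.smul_apply, Algebra.smul_def, Algebra.smul_def, ← h]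
    field_simp
  · left
    funext j
    rw [hsub j, Pi.smul_apply, Pi.smul_apply, Algebra.smul_def, Algebra.smul_def, ← h]
    field_simp

/-- The hypotheses make the two modules agree away from I, and at I submodules of a line are totally
ordered. -/
theorem le_or_le_of_rank_le_one (hn : n ≤ 1) (hI : I.IsMaximal) (hI0 : I ≠ ⊥)
    (h₁ : ∀ a ∈ I, ∀ v ∈ L₁, a • v ∈ L₂) (h₂ : ∀ a ∈ I, ∀ v ∈ L₂, a • v ∈ L₁) :
    L₁ ≤ L₂ ∨ L₂ ≤ L₁ := by
  have key : ∀ {A B : Submodule (𝓞 E) (Fin n → E)} {x y : Fin n → E} {t a : 𝓞 E},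
      (∀ a ∈ I, ∀ v ∈ A, a • v ∈ B) → x ∈ A → y ∈ B → t ∉ I → t • x = a • y → x ∈ B := by
    intro A B x y t a h hx hy ht hxy
    obtain ⟨c, i, hi, hci⟩ := hI.exists_inv ht
    rw [← one_smul (𝓞 E) x, ← hci, add_smul, mul_smul, hxy]
    exact add_mem (B.smul_mem _ (B.smul_mem _ hy)) (h i hi x hx)
  by_contra! hcon
  obtain ⟨x, hx, hx'⟩ := SetLike.not_le_iff_exists.1 hcon.1
  obtain ⟨y, hy, hy'⟩ := SetLike.not_le_iff_exists.1 hcon.2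
  obtain ⟨t, ht, a, h | h⟩ := exists_notMem_smul_eq hn hI hI0 x y
  · exact hx' (key h₁ hx hy ht h)
  · exact hy' (key h₂ hy hx ht h)

/-- The intersections L ∩ L₁ and L ∩ L₂ are comparable and both maximal in L, hence equal. Then L₁
and L₂ are comparable, by the same argument at 𝔭̄, and both are minimal over this intersection. -/
theorem eq_of_mem_neighbours_of_rank_le_one (hn : n ≤ 1) (hp : 𝔭.IsMaximal) (hp0 : 𝔭 ≠ ⊥)
    (h₁ : L₁ ∈ neighbours L 𝔭) (h₂ : L₂ ∈ neighbours L 𝔭) : L₁ = L₂ := by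
  rw [mem_neighbours_iff hp] at h₁ h₂
  obtain ⟨-, -, ⟨hc₁, hs₁⟩, hc₁', hs₁'⟩ := h₁
  obtain ⟨-, -, ⟨hc₂, hs₂⟩, hc₂', hs₂'⟩ := h₂
  have hinf : L ⊓ L₁ = L ⊓ L₂ := by
    rcases le_or_le_of_rank_le_one hn hp hp0 (L₁ := L ⊓ L₁) (L₂ := L ⊓ L₂)
      (fun a ha v hv => ⟨L.smul_mem a hv.1, hs₂ a ha v hv.1⟩)
      (fun a ha v hv => ⟨L.smul_mem a hv.1, hs₁ a ha v hv.1⟩) with h | h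
    · exact ((hc₁.eq_or_eq h inf_le_left).resolve_right hc₂.ne).symm
    · exact (hc₂.eq_or_eq h inf_le_left).resolve_right hc₁.ne
  have hle₁ : ∀ v ∈ L, v ∈ L₁ → v ∈ L₂ := fun v hv hv' =>
    (hinf ▸ (⟨hv, hv'⟩ : v ∈ L ⊓ L₁) : v ∈ L ⊓ L₂).2
  have hle₂ : ∀ v ∈ L, v ∈ L₂ → v ∈ L₁ := fun v hv hv' =>
    (hinf ▸ (⟨hv, hv'⟩ : v ∈ L ⊓ L₂) : v ∈ L ⊓ L₁).2
  have hp0' : 𝔭.map (conjInt E) ≠ ⊥ := by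
    rwa [Ne, Ideal.map_eq_bot_iff_of_injective (conjInt E).injective]
  rcases le_or_le_of_rank_le_one hn (isMaximal_map_conjInt hp) hp0'
    (fun a ha v hv => hle₁ _ (hs₁' a ha v hv) (L₁.smul_mem a hv))
    (fun a ha v hv => hle₂ _ (hs₂' a ha v hv) (L₂.smul_mem a hv)) with h | h
  · exact (hc₂'.eq_or_eq (hinf ▸ inf_le_right) h).resolve_left (hinf ▸ hc₁'.ne')
  · exact ((hc₁'.eq_or_eq (hinf ▸ inf_le_right) h).resolve_left (hinf ▸ hc₂'.ne')).symm

end RankOne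

/-! ### The neighbours form one orbit -/

section Main

variable {L L₁ L₂ : Submodule (𝓞 E) (Fin n → E)} {𝔭 : Ideal (𝓞 E)}

theorem zsmul_mem_of_mem_neighbours (hp : 𝔭.IsMaximal) {p : ℤ} (h₁ : (p : 𝓞 E) ∈ 𝔭)
    (h₂ : (p : 𝓞 E) ∈ 𝔭.map (conjInt E)) (hL₁ : L₁ ∈ neighbours L 𝔭) :
    (∀ v ∈ L, p • v ∈ L₁) ∧ ∀ v ∈ L₁, p • v ∈ L := by
  rw [mem_neighbours_iff hp] at hL₁
  obtain ⟨-, -, ⟨-, h₃⟩, -, h₄⟩ := hL₁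
  constructor
  · intro v hv
    rw [← Int.cast_smul_eq_zsmul (𝓞 E)]
    exact h₃ _ h₁ v hv
  · intro v hv
    rw [← Int.cast_smul_eq_zsmul (𝓞 E)]
    exact h₄ _ h₂ v hv

theorem neighbours_subset_genus (hp : 𝔭.IsPrime) (hp0 : 𝔭 ≠ ⊥)
    (hM : IsUnimodular hp (loc hp L)) (hT : TraceCondition hp (loc hp L)) (hn : 2 ≤ n) :
    neighbours L 𝔭 ⊆ genus L := by
  intro L' hL'
  obtain ⟨g, hg, h₁, h₂⟩ := exists_isometry_loc hp0 hM hT hn hL'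
  obtain ⟨v, p, hv, hpw, hpne, hp₁, hp₂⟩ := exists_heightOneSpectrum_int hp hp0
  obtain ⟨h₃, h₄⟩ := zsmul_mem_of_mem_neighbours (hp.isMaximal hp0) hp₁ hp₂ hL'
  obtain ⟨κ, hκ⟩ := exists_unitary_act_eq hp hv hpw hpne hg
  refine ⟨κ, hκ L L' hL'.1 h₁ h₂ (fun u hu => ?_) fun u hu => ?_⟩
  · rw [pow_two, mul_smul]
    exact zsmul_mem (h₃ u hu) p
  · rw [pow_two, mul_smul]
    exact zsmul_mem (h₄ u hu) p

theorem exists_mem_stab_act_eq (hL : L.IsLattice E) (hint : Integral L) (hp : 𝔭.IsPrime)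
    (hp0 : 𝔭 ≠ ⊥) (hM : IsUnimodular hp (loc hp L)) (hT : TraceCondition hp (loc hp L))
    (hL₁ : L₁ ∈ neighbours L 𝔭) (hL₂ : L₂ ∈ neighbours L 𝔭) :
    ∃ κ ∈ stab L, act κ L₁ = L₂ := by
  rcases le_or_gt 2 n with hn | hn
  · obtain ⟨g, hg, ⟨h₁, h₁'⟩, h₂, h₂'⟩ := exists_isometry_loc_loc hp0 hint hM hT hn hL₁ hL₂
    obtain ⟨v, p, hv, hpw, hpne, hp₁, hp₂⟩ := exists_heightOneSpectrum_int hp hp0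
    obtain ⟨h₃, h₄⟩ := zsmul_mem_of_mem_neighbours (hp.isMaximal hp0) hp₁ hp₂ hL₁
    obtain ⟨h₅, h₆⟩ := zsmul_mem_of_mem_neighbours (hp.isMaximal hp0) hp₁ hp₂ hL₂
    obtain ⟨κ, hκ⟩ := exists_unitary_act_eq hp hv hpw hpne hg
    refine ⟨κ, hκ L L hL h₁ h₁' (fun u hu => zsmul_mem hu _) fun u hu => zsmul_mem hu _,
      hκ L₁ L₂ hL₂.1 h₂ h₂' (fun u hu => ?_) fun u hu => ?_⟩
    -- Passing from L₁ to L₂ goes through L and costs one factor p for each step, whence p².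
    · rw [pow_two, mul_smul]
      exact h₅ _ (h₄ u hu)
    · rw [pow_two, mul_smul]
      exact h₃ _ (h₆ u hu)
  · refine ⟨1, act_one hL, ?_⟩
    rw [act_one hL₁.1]
    exact eq_of_mem_neighbours_of_rank_le_one (by omega) (hp.isMaximal hp0) hp0 hL₁ hL₂

theorem mem_neighbours_of_mem_stab {κ : unitary E n QHat} (hL : L.IsLattice E)
    (hp : 𝔭.IsMaximal) (hκ : κ ∈ stab L) (hL₁ : L₁ ∈ neighbours L 𝔭) :
    act κ L₁ ∈ neighbours L 𝔭 := by
  have h := act_mem_neighbours κ hp hL hL₁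
  rwa [show act κ L = L from hκ] at h

end Main

end HermitianNeighbour

end

theorem mainTheorem8 (E : Type*) [Field E] [NumberField E] [IsTotallyComplex E]
    [Algebra.IsQuadraticExtension ℚ E] (n : ℕ)
    (L : Submodule (𝓞 E) (Fin n → E)) (hL : L.IsLattice E)
    (hint : HermitianNeighbour.Integral L)
    (𝔭 : Ideal (𝓞 E)) (hp : 𝔭.IsPrime) (hp0 : 𝔭 ≠ ⊥)
    (hdisc : ¬ HermitianNeighbour.discr L ≤ (𝔭 : FractionalIdeal (𝓞 E)⁰ E))
    (hram : Odd n ∨ ¬ 𝔭 ^ 2 ∣ Ideal.span {(2 : 𝓞 E)}) :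
    (3 ≤ n → HermitianNeighbour.neighbours L 𝔭 ⊆ HermitianNeighbour.genus L) ∧
    ∀ γ : HermitianNeighbour.unitary E n HermitianNeighbour.QHat,
      HermitianNeighbour.act γ L ∈ HermitianNeighbour.neighbours L 𝔭 →
      HermitianNeighbour.neighbours L 𝔭 =
        (fun g => HermitianNeighbour.act g L) ''
          DoubleCoset.doubleCoset γ (HermitianNeighbour.stab L) (HermitianNeighbour.stab L) := by
  have hM := HermitianNeighbour.isUnimodular_loc hp hL hint hdisc
  have hT := HermitianNeighbour.traceCondition_loc hM hdisc hram
  have hmax := hp.isMaximal hp0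
  refine ⟨fun hn => HermitianNeighbour.neighbours_subset_genus hp hp0 hM hT (by omega),
    fun γ hγ => ?_⟩
  ext L'
  simp only [Set.mem_image, DoubleCoset.mem_doubleCoset]
  constructor
  · intro hL'
    obtain ⟨κ, hκ, h⟩ := HermitianNeighbour.exists_mem_stab_act_eq hL hint hp hp0 hM hT hγ hL'
    -- The right-hand factor fixes L, so it can be taken trivial; transitivity of K_L on the
    -- neighbours supplies κ.
    refine ⟨κ * γ * 1, ⟨κ, hκ, 1, HermitianNeighbour.act_one hL, rfl⟩, ?_⟩
    rw [mul_one, HermitianNeighbour.act_mul _ _ hL, h]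
  · rintro ⟨_, ⟨κ, hκ, κ', hκ', rfl⟩, rfl⟩
    have h : HermitianNeighbour.act κ' L = L := hκ'
    rw [HermitianNeighbour.act_mul _ _ hL, h, HermitianNeighbour.act_mul _ _ hL]
    exact HermitianNeighbour.mem_neighbours_of_mem_stab hL hmax hκ hγ
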